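/- **Setting.** Items are divisible. A market $I$ has $n\ge 1$ sellers; seller $i$ has public utility $u_i>0$, private cost $c_i\ge 0$ and cost-per-utility $\gamma_i=c_i/u_i$. A mechanism for $n$ sellers (which may depend on $n$, on the $u_i$ and on the budget) maps each profile of reported costs-per-utility to (expected) fractions $g_i\in[0,1]$ of the items bought and (expected) payments $Q_iu_i$. It is truthful-in-expectation and individually rational if each seller's expected profit $Q_iu_i-g_ic_i$ is maximized by the truthful report and is then nonnegative. It need not be uniform, i.e. it may treat sellers differently. It is budget-feasible for $B$ if $\sum_iQ_iu_i\le B$ on every profile. $\mathrm{OPT}(I,B)$ denotes the optimum of the fractional knapsack problem with public costs: maximize $\sum_i x_iu_i$ subject to $x\in[0,1]^n$, $\sum_ix_ic_i\le B$. Let $\mathcal D$ be a distribution on $m\ge1$ budgets $0<B_1<\dots<B_m$, with probabilities $p_k>0$. The expected competitive ratio on $I$ of a mechanism obtaining expected utility $V(I,B)$ is $\sum_kp_kV(I,B_k)/\mathrm{OPT}(I,B_k)$. For $\delta>0$, its budget-smoothed competitive ratio is the infimum of this over all markets with $\delta$-small sellers, i.e. with $c_i\le\delta B_k$ for all $i,k$.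 A *Bayesian market* has $n\ge1$ sellers of the same utility $u>0$ whose costs are drawn i.i.d. from a distribution on $[0,\infty)$ with CDF $F$ continuous on $[0,\infty)$ (so an atom at $0$ is allowed). Here mechanisms are (measurable) truthful-in-expectation and individually rational mechanisms, possibly non-uniform, whose expected total payment is at most the budget; the utility of a mechanism is its expected total utility; and $\mathrm{OPT}(B)$ is the maximum of $nu\int x\,dF$ over measurable $x:[0,\infty)\to[0,1]$ with $n\int c\,x(c)\,dF(c)\le B$. A Bayesian market is *worst* for $\mathcal D$ if it minimizes, among all Bayesian markets, the best expected competitive ratio $\sup\sum_kp_k\,\mathrm{utility}_k/\mathrm{OPT}(B_k)$ that is achievable by a mechanism (which may depend on the budget). **Greedy** (sellers' costs known; budget $B$). Let $U(x)$ be the total utility of the sellers with $\gamma_i\le x$. Start with $x=0$, with the items of cost $0$ fully bought, and $b=B$. While there are sellers with $\gamma_i>x$, choose among their values $\gamma_i$ a value $p$ maximizing $(U(p)-U(x))/q(x,p)$, where $q(x,p)=(p-x)U(x)+p(U(p)-U(x))$. If $q(x,p)\le b$, buy all items with $\gamma_i\in(x,p]$, replace $b$ by $b-q(x,p)$ and $x$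 by $p$, and repeat; otherwise buy the fraction $t=b/q(x,p)$ of each item with $\gamma_i\in(x,p]$ and stop. The result is an allocation rule $f$ that is $1$ on $[0,p_1]$, $t\in[0,1)$ on $(p_1,p_2]$ and $0$ above (with $t=0$, $p_1=p_2=x$ if all items are bought); the payment per utility is $Q_f(\gamma)=\gamma f(\gamma)+\int_\gamma^\infty f$. **Random-Sampling-Greedy** (parameters $\varepsilon_1,\delta_1\in(0,1)$, $\eta>0$, an integer $C\ge1$; budget $B$). Buy the items of the set $T$ of the $C$ sellers of highest utility (all sellers if $n\le C$) at price $\varepsilon_1B/C$ each. Split the other sellers uniformly at random into $X$ and $Y$. Run Greedy virtually on $X$ and on $Y$, each with budget $(1-\delta_1)B/2$, giving rules $f_X,f_Y$. Truncate each rule: if the sellers outside $T$ with $\gamma_i\le p_1$ have total utility less than $\frac{1}{\eta C}\sum_{i\in T}u_i$, lower its value on $[0,p_1]$ to $t$. Then, in an arbitrary order, apply the truncated $f_X$ with its payment rule to the sellers of $Y$ one after the other, stopping before the payments on $Y$ would exceed $(1-\varepsilon_1)B/2$, and likewise the truncated $f_Y$ to $X$. **Theorem.** For every such distribution $\mathcal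 D$ on $m$ budgets: 1. A worst Bayesian market for $\mathcal D$ exists. For every worst Bayesian market, let $T=\mathrm{OPT}(B_m)/(nu)\in(0,1]$ be the fraction of the market bought by the non-IC optimum with the largest budget. On the part of the market up to the $T$-quantile of the costs, $cF(c)$, plotted against $F(c)\in[0,T]$, is a convex piecewise-linear function: it is first zero and then has at most $m$ nonzero linear pieces, with positive non-decreasing slopes. Moreover, there is a worst Bayesian market with $T=1$, for which this describes the whole curve. 2. For every worst Bayesian market and every $k$, some uniform cutoff rule (every seller is offered the same price; an item is bought iff $c/u\le c^*/u^*$) is feasible for budget $B_k$ and maximizes the expected utility among all, possibly non-uniform, mechanisms feasible for $B_k$. 3. Greedy is worst-case optimal for $\mathcal D$: for every $\delta>0$, its budget-smoothed competitive ratio over markets with $\delta$-small sellers is at least that of every, possibly non-uniform, mechanism that is truthful-in-expectation, individually rational and budget-feasible on all profiles with $\delta$-small costs, for each budget in the support of $\mathcal D$. 4. Hence so is Random-Sampling-Greedy, up to an arbitrarily small loss: for every $\varepsilon>0$ there are parameters $\varepsilon_1,\delta_1,\eta,C$, not depending on $\mathcal D$, such that for every $\mathcal D$, every choice of processing orders and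 every $0<\delta\le\varepsilon_1/C$, its budget-smoothed competitive ratio over markets with $\delta$-small sellers is at least $(1-\varepsilon)$ times that of every mechanism as in 3. -/

import Mathlib

open MeasureTheory ProbabilityTheory

noncomputable section

namespace BudgetSmoothed

/-! ### Budget distributions -/

/-- A probability distribution supported on exactly `m` positive budgets, listed increasingly. -/
structure BudgetDistribution (m : ℕ) where
  budget : Fin m → ℝ
  prob : Fin m → ℝ
  budget_pos : ∀ k, 0 < budget k
  budget_strictMono : StrictMono budget
  prob_pos : ∀ k, 0 < prob k
  prob_sum : ∑ k, prob k = 1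

/-! ### Direct mechanisms for divisible items -/

/-- A direct mechanism for `n` sellers. Given the reported costs-per-utility `γ`, `alloc γ i` is the
(expected) fraction bought of item `i`, and `pay γ i` is the (expected) payment per unit of utility,
so that seller `i` receives `pay γ i * u i`. -/
structure Mechanism (n : ℕ) where
  alloc : (Fin n → ℝ) → Fin n → ℝ
  pay : (Fin n → ℝ) → Fin n → ℝ

namespace Mechanism

variable {n : ℕ}

/-- Expected net profit of seller `i` of utility `u i` and true cost-per-utility `r`
(true cost `r * u i`) when the reported profile is `γ`. -/
def profit (M : Mechanism n) (u : Fin n → ℝ) (i : Fin n) (r : ℝ) (γ : Fin n → ℝ) : ℝ :=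
  M.pay γ i * u i - M.alloc γ i * (r * u i)

/-- On the set `S` of report profiles: no seller gains in expectation by misreporting. -/
def TruthfulInExpectationOn (M : Mechanism n) (u : Fin n → ℝ) (S : Set (Fin n → ℝ)) : Prop :=
  ∀ γ ∈ S, ∀ i z, Function.update γ i z ∈ S →
    M.profit u i (γ i) (Function.update γ i z) ≤ M.profit u i (γ i) γ

/-- On the set `S` of report profiles: truthful sellers never make an expected loss. -/
def IndividuallyRationalOn (M : Mechanism n) (u : Fin n → ℝ) (S : Set (Fin n → ℝ)) : Prop :=
  ∀ γ ∈ S, ∀ i, 0 ≤ M.profit u i (γ i) γ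

/-- Allocations are fractions, and the mechanism is truthful-in-expectation and individually
rational, on the set `S` of report profiles. -/
structure AdmissibleOn (M : Mechanism n) (u : Fin n → ℝ) (S : Set (Fin n → ℝ)) : Prop where
  alloc_mem : ∀ γ ∈ S, ∀ i, M.alloc γ i ∈ Set.Icc (0 : ℝ) 1
  truthful : M.TruthfulInExpectationOn u S
  rational : M.IndividuallyRationalOn u S

/-- The uniform cutoff rule: every seller is offered the payment-per-utility `r`. The payment is the
Myerson payment of the allocation rule `γ ↦ 1(γ ≤ r)`. -/
def cutoff (n : ℕ) (r : ℝ) : Mechanism n where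
  alloc γ i := if γ i ≤ r then 1 else 0
  pay γ i := if γ i ≤ r then r else 0

end Mechanism

/-! ### Bayesian markets -/

/-- A Bayesian market: `n` sellers of the same utility `u`, whose costs are drawn independently from
a distribution `μ` on `[0, ∞)` whose distribution function is continuous on `[0, ∞)`
(an atom at cost `0` is allowed). -/
structure BayesianMarket where
  n : ℕ
  n_pos : 0 < n
  u : ℝ
  u_pos : 0 < u
  μ : Measure ℝ
  isProb : IsProbabilityMeasure μ
  nonneg : μ (Set.Iio 0) = 0
  continuous_cdf : ContinuousOn (cdf μ) (Set.Ici 0)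

namespace BayesianMarket

/-- The distribution function `F` of the costs. -/
def F (I : BayesianMarket) (c : ℝ) : ℝ := cdf I.μ c

/-- The law of the cost profile. -/
def law (I : BayesianMarket) : Measure (Fin I.n → ℝ) :=
  haveI := I.isProb
  Measure.pi fun _ => I.μ

/-- The profile of costs-per-utility of a cost profile. -/
def perUtility (I : BayesianMarket) (c : Fin I.n → ℝ) : Fin I.n → ℝ := fun i => c i / I.u

/-- `M` is a (possibly non-uniform) truthful-in-expectation, individually rational mechanism whose
expected total payment in the market is at most `B`. -/
structure Feasible (I : BayesianMarket) (B : ℝ) (M : Mechanism I.n) : Prop where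
  admissible : M.AdmissibleOn (fun _ => I.u) {γ | ∀ i, 0 ≤ γ i}
  measurable_alloc : ∀ i, Measurable fun γ => M.alloc γ i
  measurable_pay : ∀ i, Measurable fun γ => M.pay γ i
  integrable_pay : ∀ i, Integrable (fun c => M.pay (I.perUtility c) i) I.law
  budget : (∫ c, ∑ i, M.pay (I.perUtility c) i * I.u ∂I.law) ≤ B

/-- Expected total utility of the buyer. -/
def utility (I : BayesianMarket) (M : Mechanism I.n) : ℝ :=
  ∫ c, ∑ i, M.alloc (I.perUtility c) i * I.u ∂I.law

/-- Non-IC optimum: the largest expected utility when costs are public and items are divisible, a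
fraction `x c` of the item of a seller of cost `c` being bought at its cost, with total expected
cost at most `B`. -/
def opt (I : BayesianMarket) (B : ℝ) : ℝ :=
  sSup {v | ∃ x : ℝ → ℝ, Measurable x ∧ (∀ c, x c ∈ Set.Icc (0 : ℝ) 1) ∧
    Integrable (fun c => c * x c) I.μ ∧ I.n * (∫ c, c * x c ∂I.μ) ≤ B ∧
    v = I.n * I.u * ∫ c, x c ∂I.μ}

/-- The best expected competitive ratio that any mechanism, which may depend on the budget, can
achieve in the market for the budget distribution. -/
def bestRatio {m : ℕ} (D : BudgetDistribution m) (I : BayesianMarket) : ℝ :=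
  sSup {r | ∃ M : Fin m → Mechanism I.n, (∀ k, I.Feasible (D.budget k) (M k)) ∧
    r = ∑ k, D.prob k * (I.utility (M k) / I.opt (D.budget k))}

/-- The market is worst for the budget distribution. -/
def IsWorst {m : ℕ} (D : BudgetDistribution m) (I : BayesianMarket) : Prop :=
  ∀ J : BayesianMarket, I.bestRatio D ≤ J.bestRatio D

/-- The uniform cutoff rule at cost-per-utility `r` maximizes the expected utility among all feasible
mechanisms for budget `B`. -/
def CutoffOptimal (I : BayesianMarket) (B r : ℝ) : Prop :=
  I.Feasible B (Mechanism.cutoff I.n r) ∧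
    ∀ M : Mechanism I.n, I.Feasible B M → I.utility M ≤ I.utility (Mechanism.cutoff I.n r)

end BayesianMarket

/-- On `[0, T]`, `φ` is zero at first (on `[0, x 0]`) and is then linear with positive slopes
`a 0 ≤ a 1 ≤ ⋯` on at most `m` successive intervals (which may be degenerate). -/
def ConvexPiecewiseLinear (m : ℕ) (T : ℝ) (φ : ℝ → ℝ) : Prop :=
  ∃ (x : Fin (m + 1) → ℝ) (a : Fin m → ℝ),
    Monotone x ∧ 0 ≤ x 0 ∧ x (Fin.last m) = T ∧ (∀ j, 0 < a j) ∧ Monotone a ∧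
    (∀ s ∈ Set.Icc 0 (x 0), φ s = 0) ∧
    ∀ j, ∀ s ∈ Set.Icc (x j.castSucc) (x j.succ),
      φ s = φ (x j.castSucc) + a j * (s - x j.castSucc)

/-- The part `0 ≤ F c ≤ T` of the plot of `c * F c` against `F c` (the costs `c ≥ 0` that are at most
the `T`-quantile) is the graph of a convex piecewise linear function with at most `m` nonzero
pieces. -/
def BayesianMarket.CurveUpTo (I : BayesianMarket) (m : ℕ) (T : ℝ) : Prop :=
  ∃ φ : ℝ → ℝ, ConvexPiecewiseLinear m T φ ∧
    ∀ c, 0 ≤ c → (∀ c' < c, I.F c' < T) → c * I.F c = φ (I.F c)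

/-! ### Markets and budget-smoothed competitive ratios -/

/-- A market: `n ≥ 1` sellers with public utilities and private costs. -/
structure Market where
  n : ℕ
  n_pos : 0 < n
  u : Fin n → ℝ
  c : Fin n → ℝ
  u_pos : ∀ i, 0 < u i
  c_nonneg : ∀ i, 0 ≤ c i

namespace Market

/-- Cost-per-utility. -/
def γ (I : Market) (i : Fin I.n) : ℝ := I.c i / I.u i

/-- Non-IC optimum: the optimal utility of the knapsack problem with divisible items. -/
def opt (I : Market) (B : ℝ) : ℝ :=
  sSup {v | ∃ x : Fin I.n → ℝ, (∀ i, x i ∈ Set.Icc (0 : ℝ) 1) ∧ ∑ i, x i * I.c i ≤ B ∧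
    v = ∑ i, x i * I.u i}

/-- Small-bidder assumption: each cost is at most a `δ` fraction of each possible budget. -/
def SmallBidders {m : ℕ} (I : Market) (D : BudgetDistribution m) (δ : ℝ) : Prop :=
  ∀ k i, I.c i ≤ δ * D.budget k

/-- Expected competitive ratio on the market `I` of a mechanism that obtains the (expected) utility
`V I B` with budget `B`. -/
def expectedRatio {m : ℕ} (D : BudgetDistribution m) (V : Market → ℝ → ℝ) (I : Market) : ℝ :=
  ∑ k, D.prob k * (V I (D.budget k) / I.opt (D.budget k))

end Market

/-- Budget-smoothed competitive ratio: the worst expected competitive ratio over all markets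
whose sellers are `δ`-small. -/
def smoothedRatio {m : ℕ} (D : BudgetDistribution m) (δ : ℝ) (V : Market → ℝ → ℝ) : ℝ :=
  ⨅ I : {I : Market // I.SmallBidders D δ}, I.1.expectedRatio D V

/-- A mechanism for all numbers of sellers, all public utilities and all budgets. -/
abbrev GeneralMechanism := (n : ℕ) → (Fin n → ℝ) → ℝ → Mechanism n

namespace GeneralMechanism

/-- Expected utility obtained on the market `I` with budget `B`. -/
def utility (P : GeneralMechanism) (I : Market) (B : ℝ) : ℝ :=
  ∑ i, (P I.n I.u B).alloc I.γ i * I.u i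

/-- For each budget in the support of `D`, on all profiles of reports with `δ`-small costs, the
mechanism is truthful-in-expectation, individually rational, and budget-feasible. -/
def Feasible {m : ℕ} (P : GeneralMechanism) (D : BudgetDistribution m) (δ : ℝ) : Prop :=
  ∀ (n : ℕ) (u : Fin n → ℝ), (∀ i, 0 < u i) → ∀ k,
    (P n u (D.budget k)).AdmissibleOn u {γ | ∀ i, 0 ≤ γ i ∧ γ i * u i ≤ δ * D.budget k} ∧
    ∀ γ : Fin n → ℝ, (∀ i, 0 ≤ γ i ∧ γ i * u i ≤ δ * D.budget k) →
      ∑ i, (P n u (D.budget k)).pay γ i * u i ≤ D.budget k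

end GeneralMechanism

/-! ### The greedy mechanism -/

/-- The allocation rule equal to `1` on `γ ≤ p₁`, to `t` on `p₁ < γ ≤ p₂`, and to `0` above. -/
structure TwoStepRule where
  t : ℝ
  p₁ : ℝ
  p₂ : ℝ

namespace TwoStepRule

def alloc (f : TwoStepRule) (γ : ℝ) : ℝ := if γ ≤ f.p₁ then 1 else if γ ≤ f.p₂ then f.t else 0

/-- Myerson payment-per-utility. -/
def pay (f : TwoStepRule) (γ : ℝ) : ℝ := γ * f.alloc γ + ∫ z in Set.Ioi γ, f.alloc z

end TwoStepRule

namespace Market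

/-- Total utility of the sellers in `A` of cost-per-utility at most `p`. -/
def utilityUpTo (I : Market) (A : Finset (Fin I.n)) (p : ℝ) : ℝ := ∑ i ∈ A with I.γ i ≤ p, I.u i

/-- Extra payment made when, all sellers in `A` up to cost-per-utility `x` being fully bought, one also
buys fully all those in `(x, p]`. -/
def stepPay (I : Market) (A : Finset (Fin I.n)) (x p : ℝ) : ℝ :=
  (p - x) * I.utilityUpTo A x + p * (I.utilityUpTo A p - I.utilityUpTo A x)

/-- Marginal utility per marginal payment of this extra purchase. -/
def stepEfficiency (I : Market) (A : Finset (Fin I.n)) (x p : ℝ) : ℝ :=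
  (I.utilityUpTo A p - I.utilityUpTo A x) / I.stepPay A x p

/-- The iterations of Greedy on the sellers in `A`, all those of cost-per-utility at most `x` being
already bought and `b` being the remaining budget: choose the most efficient next
cost-per-utility `p` in the market, buy all of `(x, p]` if `b` suffices and continue, otherwise buy
an equal fraction of each item in `(x, p]` and stop. The first argument bounds the number of
iterations. When the budget is used up exactly, one more iteration with fraction `0` is made,
which does not change the rule and keeps `t < 1`. -/
def greedyLoop (I : Market) (A : Finset (Fin I.n)) : ℕ → ℝ → ℝ → TwoStepRule
  | 0, x, _ => ⟨0, x, x⟩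
  | N + 1, x, b =>
    open Classical in
    if h : ((A.image I.γ).filter (fun p => x < p)).Nonempty then
      let p := (Finset.exists_max_image _ (I.stepEfficiency A x) h).choose
      if I.stepPay A x p ≤ b then greedyLoop I A N p (b - I.stepPay A x p)
      else ⟨b / I.stepPay A x p, x, p⟩
    else ⟨0, x, x⟩

/-- The rule chosen by Greedy on the sellers in `A` with budget `B`. -/
def greedy (I : Market) (A : Finset (Fin I.n)) (B : ℝ) : TwoStepRule :=
  I.greedyLoop A A.card 0 B

/-- Utility obtained by Greedy on the whole market. -/
def greedyUtility (I : Market) (B : ℝ) : ℝ :=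
  ∑ i, (I.greedy Finset.univ B).alloc (I.γ i) * I.u i

end Market

/-! ### The mechanism Random-Sampling-Greedy -/

/-- The parameters of Random-Sampling-Greedy. -/
structure SamplingParameters where
  ε₁ : ℝ
  δ₁ : ℝ
  η : ℝ
  C : ℕ
  ε₁_mem : ε₁ ∈ Set.Ioo (0 : ℝ) 1
  δ₁_mem : δ₁ ∈ Set.Ioo (0 : ℝ) 1
  η_pos : 0 < η
  C_pos : 0 < C

namespace Market

open Classical in
/-- The `C` sellers of highest utilities (all sellers if there are at most `C`), with ties broken by
index. -/
def top (I : Market) (C : ℕ) : Finset (Fin I.n) :=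
  {i | (Finset.univ.filter fun j => I.u i < I.u j ∨ (I.u i = I.u j ∧ j < i)).card < C}

open Classical in
/-- Truncation: the price `p₁` is made negative if the sellers outside of `top C` of
cost-per-utility at most `p₁` have small total utility compared with `top C`. -/
def truncate (I : Market) (s : SamplingParameters) (f : TwoStepRule) : TwoStepRule :=
  ⟨f.t,
    if I.utilityUpTo (I.top s.C)ᶜ f.p₁ < (∑ i ∈ I.top s.C, I.u i) / (s.η * s.C) then -1 else f.p₁,
    f.p₂⟩

open Classical in
/-- Utility obtained from the sellers in `A` by applying the rule `f` and its payments to them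
sequentially in the order `ord`, until the payment limit `L` is reached: seller `i` is served
exactly if the payments up to and including `i` are at most `L`. -/
def serve (I : Market) (ord : Equiv.Perm (Fin I.n)) (A : Finset (Fin I.n)) (f : TwoStepRule)
    (L : ℝ) : ℝ :=
  ∑ i ∈ A, if (∑ j ∈ A with ord j ≤ ord i, f.pay (I.γ j) * I.u j) ≤ L
    then f.alloc (I.γ i) * I.u i else 0

/-- Utility of Random-Sampling-Greedy when the sellers outside of `top C` are split into `X`, `Y`. -/
def splitUtility (I : Market) (s : SamplingParameters) (ord : Equiv.Perm (Fin I.n)) (B : ℝ)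
    (X Y : Finset (Fin I.n)) : ℝ :=
  (∑ i ∈ I.top s.C, I.u i)
    + I.serve ord Y (I.truncate s (I.greedy X ((1 - s.δ₁) * B / 2))) ((1 - s.ε₁) * B / 2)
    + I.serve ord X (I.truncate s (I.greedy Y ((1 - s.δ₁) * B / 2))) ((1 - s.ε₁) * B / 2)

open Classical in
/-- Expected utility of Random-Sampling-Greedy: the items in `top C` are all bought (at price
`ε₁ * B / C` each), and `X` is a uniformly random subset of the other sellers. -/
def samplingUtility (s : SamplingParameters) (ord : (n : ℕ) → Equiv.Perm (Fin n)) (I : Market)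
    (B : ℝ) : ℝ :=
  (∑ X ∈ (I.top s.C)ᶜ.powerset, I.splitUtility s (ord I.n) B X ((I.top s.C)ᶜ \ X))
    / 2 ^ (I.top s.C)ᶜ.card

end Market

end BudgetSmoothed

end

noncomputable section

namespace BudgetSmoothed

/-! ### Truthful rules for one seller as mixtures of posted prices -/

section

/-! ### Single-parameter incentive compatibility -/

/-! One Lagrangian principle bounds all mechanisms. Suppose that for a random cost no posted price
makes (probability of sale) minus `l` times (expected payment) larger than `κ`. The level sets of a
truthful allocation are initial segments, and truthfulness forces payments at least as large as if
each level were bought at its supremum. So a truthful rule is no better than a mixture of posted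
prices and obeys E[x] ≤ κ + l E[Q] (`TruthfulPair.lintegral_alloc_le`). Fixing the other reports
extends this to non-uniform mechanisms with i.i.d. sellers
(`Mechanism.AdmissibleOn.integral_alloc_le`).

Greedy: in the plane of payments r U(r) and utilities U(r), it walks along the upper concave hull of
the posted prices, so its last slope is a multiplier certifying optimality
(`Market.greedy_isOptimalRule`). Given a market, sample many sellers of equal, tiny utility, with
costs-per-utility drawn in proportion to utility. They are small, their knapsack optimum is close to
that of the market with high probability, and by the multiplier no mechanism gets more on average
than Greedy on the market. So no mechanism has a better worst case than Greedy
(`Market.smoothedRatio_le_expectedRatio_greedy`).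

Random-Sampling-Greedy: Chebyshev's inequality on a geometric net of utility levels shows that most
splits are balanced at all prices of non-negligible utility (`Market.card_not_balanced_le`). Then
the rule of one half is affordable and nearly optimal on the other, and the top sellers, bought
outright, make up for the remaining losses (`Market.greedy_le_splitUtility`).

Bayesian markets: let G(y) be the probability that n times the cost is at most y. The best fraction
`icOpt` that mechanisms can buy is concave in the budget, so it has a supporting line κ + l b at
each budget of the distribution; such a line implies G(y) (1 - l y) ≤ κ. By duality the non-IC
fraction is the largest v ≤ 1 with v r ≤ B + ∫₀ʳ G for all r, which increases with G. For given
lines the worst G is therefore the largest function below the hyperbolas, `envelope`, and the search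
for a worst market becomes a finite-dimensional problem over `Configuration`s, solved by compactness
(`exists_isWorst`). A minimizer may have lines through the origin, whose envelope can jump;
`Configuration.exists_pos` removes them without increasing the value, since the area gained near the
pole of a hyperbola outweighs the raising of the lines.

Conversely no configuration beats a worst market, so perturbing its lines shows that they have
positive slopes and that G is the envelope below the relevant level (`Lines.l_pos`,
`Lines.G_eq_envelope`). On a binding hyperbola y G = (G - κ) / l. Hence y G as a function of G is
the maximum of zero and one line per budget: convex and piecewise linear. The curve passes through
the points (`icOpt` B, B), so a single posted price is optimal for each budget. -/

/-- On the set `D` of nonnegative reports, the allocation `x` and the payment `Q` of a single seller are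
truthful and individually rational, and the allocation is a fraction. -/
structure TruthfulPair (D : Set ℝ) (x Q : ℝ → ℝ) : Prop where
  nonneg : ∀ z ∈ D, 0 ≤ z
  alloc_mem : ∀ z ∈ D, x z ∈ Set.Icc (0 : ℝ) 1
  truthful : ∀ z ∈ D, ∀ w ∈ D, Q w - z * x w ≤ Q z - z * x z
  rational : ∀ z ∈ D, 0 ≤ Q z - z * x z

namespace TruthfulPair

variable {D : Set ℝ} {x Q : ℝ → ℝ}

/-- The reports at which a fraction of at least `(j + 1) / N` is bought. -/
def level (D : Set ℝ) (x : ℝ → ℝ) (N j : ℕ) : Set ℝ := {z | z ∈ D ∧ ((j : ℝ) + 1) / N ≤ x z}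

/-- A seller `z` reporting some `a > z` in the level would earn at least `(a - z) * (j + 1) / N`,
which truthfulness caps by its profit. So the supremum of a nonempty level is a genuine price. -/
lemma bddAbove_level (h : TruthfulPair D x Q) {N : ℕ} (hN : 0 < N) (j : ℕ) :
    BddAbove (level D x N j) := by
  by_cases hne : D.Nonempty
  · obtain ⟨z, hz⟩ := hne
    refine ⟨z + (Q z - z * x z) * N / (j + 1), ?_⟩
    rintro a ⟨haD, ha⟩
    have h1 := h.truthful z hz a haD
    have h2 := h.rational a haD
    have hN' : (0 : ℝ) < N := by exact_mod_cast hN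
    have h3 := h.rational z hz
    have hj : (0 : ℝ) < (j : ℝ) + 1 := by positivity
    by_cases haz : a ≤ z
    · have : 0 ≤ (Q z - z * x z) * N / (j + 1) := by positivity
      linarith
    · push Not at haz
      have h4 : (a - z) * (((j : ℝ) + 1) / N) ≤ Q z - z * x z := by
        have : (a - z) * (((j : ℝ) + 1) / N) ≤ (a - z) * x a :=
          mul_le_mul_of_nonneg_left ha (by linarith)
        linarith
      have h5 : a - z ≤ (Q z - z * x z) * N / (j + 1) := by
        rw [le_div_iff₀ hj]
        calc (a - z) * (j + 1) = (a - z) * (((j : ℝ) + 1) / N) * N := by field_simp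
          _ ≤ _ := mul_le_mul_of_nonneg_right h4 hN'.le
      linarith
  · exact ⟨0, fun a ha => (hne ⟨a, ha.1⟩).elim⟩

lemma antitone (h : TruthfulPair D x Q) {z w : ℝ} (hz : z ∈ D) (hw : w ∈ D) (hzw : z ≤ w) :
    x w ≤ x z := by
  rcases hzw.eq_or_lt with rfl | hlt
  · exact le_rfl
  · have h1 := h.truthful z hz w hw
    have h2 := h.truthful w hw z hz
    by_contra hcon
    push Not at hcon
    nlinarith

/-- A discrete form of "profit is at least the integral of the allocation", valid on any domain `D`.
A seller `z` can imitate a report `a` just below the supremum of the last level. The induction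
hypothesis at `a` bounds the profit there, and passing from `a` to `z` raises each of the `K + 1`
summands by at most `a - z`, up to the error `e`. -/
lemma sum_max_le_profit (h : TruthfulPair D x Q) {N : ℕ} (hN : 0 < N) (K : ℕ) :
    ∀ z ∈ D, (∑ j ∈ Finset.range K, max (sSup (level D x N j) - z) 0) / N ≤ Q z - z * x z := by
  have hN' : (0 : ℝ) < N := by exact_mod_cast hN
  induction K with
  | zero => intro z hz; simpa using h.rational z hz
  | succ K ih =>
    intro z hz
    rw [Finset.sum_range_succ]
    rcases le_or_gt (sSup (level D x N K)) z with hle | hlt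
    · rw [max_eq_right (by linarith), add_zero]; exact ih z hz
    · rw [max_eq_left (by linarith)]
      -- An empty level has supremum `0` by convention, which is not above a nonnegative `z`.
      have hne : (level D x N K).Nonempty := by
        by_contra hcon
        rw [Set.not_nonempty_iff_eq_empty] at hcon
        rw [hcon, Real.sSup_empty] at hlt
        exact absurd (h.nonneg z hz) (by linarith)
      refine le_of_forall_pos_le_add fun e he => ?_
      obtain ⟨a, ⟨haD, ha⟩, ha2⟩ := exists_lt_of_lt_csSup hne
        (max_lt hlt (by have : 0 < e * N := by positivity
                        linarith : sSup (level D x N K) - e * N < sSup (level D x N K)))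
      have haz : z < a := lt_of_le_of_lt (le_max_left _ _) ha2
      have hae : sSup (level D x N K) - e * N < a := lt_of_le_of_lt (le_max_right _ _) ha2
      have h1 := h.truthful z hz a haD
      have h2 := ih a haD
      have h3 : (a - z) * (((K : ℝ) + 1) / N) ≤ (a - z) * x a :=
        mul_le_mul_of_nonneg_left ha (by linarith)
      have h4 : ∑ j ∈ Finset.range K, max (sSup (level D x N j) - z) 0 ≤
          ∑ j ∈ Finset.range K, max (sSup (level D x N j) - a) 0 + K * (a - z) := by
        have : (K : ℝ) * (a - z) = ∑ j ∈ Finset.range K, (a - z) := by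
          rw [Finset.sum_const, Finset.card_range, nsmul_eq_mul]
        rw [this, ← Finset.sum_add_distrib]
        refine Finset.sum_le_sum fun j _ => max_le ?_ ?_
        · linarith [le_max_left (sSup (level D x N j) - a) 0]
        · linarith [le_max_right (sSup (level D x N j) - a) 0]
      rw [div_le_iff₀ hN'] at h2 ⊢
      have h5 : (a - z) * (K + 1) ≤ (a - z) * x a * N := by
        have := mul_le_mul_of_nonneg_right h3 hN'.le
        calc (a - z) * (K + 1) = (a - z) * (((K : ℝ) + 1) / N) * N := by field_simp
          _ ≤ _ := this
      nlinarith

lemma sum_indicator_eq (N : ℕ) {y : ℝ} (hy : y ∈ Set.Icc (0 : ℝ) 1) (hN : 0 < N) :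
    (∑ j ∈ Finset.range N, if ((j : ℝ) + 1) / N ≤ y then (1 : ℝ) else 0) = ⌊N * y⌋₊ := by
  have hN' : (0 : ℝ) < N := by exact_mod_cast hN
  have hle : ⌊N * y⌋₊ ≤ N := by
    refine Nat.floor_le_of_le ?_
    nlinarith [hy.2]
  rw [Finset.sum_boole]
  congr 1
  have : (Finset.range N).filter (fun j : ℕ => ((j : ℝ) + 1) / N ≤ y) = Finset.range ⌊N * y⌋₊ := by
    ext j
    simp only [Finset.mem_filter, Finset.mem_range]
    rw [div_le_iff₀ hN']
    have h0 : 0 ≤ N * y := mul_nonneg hN'.le hy.1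
    have : (j : ℝ) + 1 ≤ y * N ↔ j + 1 ≤ ⌊N * y⌋₊ := by
      rw [Nat.le_floor_iff h0]; push_cast; rw [mul_comm]
    rw [this]; omega
  rw [this, Finset.card_range]

open Classical in
lemma alloc_le (h : TruthfulPair D x Q) {N : ℕ} (hN : 0 < N) {z : ℝ} (hz : z ∈ D) :
    x z ≤ 1 / N + (∑ j ∈ Finset.range N, if z ∈ level D x N j then (1 : ℝ) else 0) / N := by
  have hN' : (0 : ℝ) < N := by exact_mod_cast hN
  have h1 := sum_indicator_eq N (h.alloc_mem z hz) hN
  have h2 : (∑ j ∈ Finset.range N, if z ∈ level D x N j then (1 : ℝ) else 0) = ⌊N * x z⌋₊ := by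
    rw [← h1]; refine Finset.sum_congr rfl fun j _ => ?_; simp [level, hz]
  rw [h2, ← add_div, le_div_iff₀ hN']
  have := Nat.lt_floor_add_one (N * x z)
  linarith

-- Payment is profit plus `z * x z`. Each level containing `z` contributes at least `sSup - z` to
-- `N` times the first and `z` to `N` times the second, together the price of the level.
open Classical in
lemma pay_ge (h : TruthfulPair D x Q) {N : ℕ} (hN : 0 < N) {z : ℝ} (hz : z ∈ D) :
    (∑ j ∈ Finset.range N, if z ∈ level D x N j then sSup (level D x N j) else 0) / N ≤ Q z := by
  have hN' : (0 : ℝ) < N := by exact_mod_cast hN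
  have h1 := sum_indicator_eq N (h.alloc_mem z hz) hN
  have h2 : (∑ j ∈ Finset.range N, if z ∈ level D x N j then (1 : ℝ) else 0) ≤ N * x z := by
    have : (∑ j ∈ Finset.range N, if z ∈ level D x N j then (1 : ℝ) else 0) = ⌊N * x z⌋₊ := by
      rw [← h1]; refine Finset.sum_congr rfl fun j _ => ?_; simp [level, hz]
    rw [this]
    exact Nat.floor_le (mul_nonneg hN'.le (h.alloc_mem z hz).1)
  have h3 := h.sum_max_le_profit hN N z hz
  rw [div_le_iff₀ hN'] at h3 ⊢
  have h4 : (∑ j ∈ Finset.range N, if z ∈ level D x N j then sSup (level D x N j) else 0) ≤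
      ∑ j ∈ Finset.range N, max (sSup (level D x N j) - z) 0 +
        z * ∑ j ∈ Finset.range N, (if z ∈ level D x N j then (1 : ℝ) else 0) := by
    rw [Finset.mul_sum, ← Finset.sum_add_distrib]
    refine Finset.sum_le_sum fun j _ => ?_
    split_ifs with hj
    · linarith [le_max_left (sSup (level D x N j) - z) 0]
    · simp
  nlinarith [h.nonneg z hz]

variable {Ω : Type*} [MeasurableSpace Ω]

/-- Needed because a level may miss its supremum. The bound passes to strict inequalities by
continuity of the measure along prices increasing to `r`. -/
lemma measure_lt_le {μ : Measure Ω} [IsProbabilityMeasure μ] {c : Ω → ℝ} {κ l : ℝ}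
    (hF : ∀ r, 0 ≤ r → μ.real {ω | c ω ≤ r} * (1 - l * r) ≤ κ) (hc0 : ∀ ω, 0 ≤ c ω)
    (hl : 0 ≤ l) {r : ℝ} (hr : 0 ≤ r) :
    μ.real {ω | c ω < r} * (1 - l * r) ≤ κ := by
  have hκ : 0 ≤ κ := le_trans (by simp) (hF 0 le_rfl)
  rcases hr.eq_or_lt with rfl | hr0
  · have : {ω | c ω < 0} = ∅ := by ext ω; simpa using hc0 ω
    simp [this, hκ]
  rcases le_or_gt (1 - l * r) 0 with hneg | hpos
  · exact le_trans (mul_nonpos_of_nonneg_of_nonpos measureReal_nonneg hneg) hκ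
  · obtain ⟨s, hs1, hs2, hs3⟩ := exists_seq_strictMono_tendsto' hr0
    have hU : {ω | c ω < r} = ⋃ n, {ω | c ω ≤ s n} := by
      ext ω
      simp only [Set.mem_ofPred_eq, Set.mem_iUnion]
      constructor
      · intro h
        exact ((hs3.eventually (lt_mem_nhds h)).exists).imp fun n hn => hn.le
      · rintro ⟨n, hn⟩
        exact lt_of_le_of_lt hn (hs2 n).2
    have hmono : Monotone fun n => {ω | c ω ≤ s n} := fun a b hab ω hω =>
      le_trans hω (hs1.monotone hab)
    have ht := tendsto_measure_iUnion_atTop (μ := μ) hmono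
    rw [← hU] at ht
    have ht2 : Filter.Tendsto (fun n => μ.real {ω | c ω ≤ s n}) Filter.atTop
        (nhds (μ.real {ω | c ω < r})) :=
      (ENNReal.tendsto_toReal (measure_ne_top μ _)).comp ht
    refine le_of_tendsto (ht2.mul_const (1 - l * r)) (Filter.Eventually.of_forall fun n => ?_)
    refine le_trans (mul_le_mul_of_nonneg_left ?_ measureReal_nonneg) (hF (s n) (hs2 n).1.le)
    have := mul_le_mul_of_nonneg_left (hs2 n).2.le hl
    linarith

/-- Lagrangian bound for a single seller: if no posted price yields more than `κ` in terms of utility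
minus `l` times the payment, then no truthful mechanism does. -/
theorem lintegral_alloc_le (h : TruthfulPair D x Q) {μ : Measure Ω} [IsProbabilityMeasure μ]
    {c : Ω → ℝ} (hc : Measurable c) (hcD : ∀ ω, c ω ∈ D) {κ l : ℝ} (hl : 0 ≤ l)
    (hF : ∀ r, 0 ≤ r → μ.real {ω | c ω ≤ r} * (1 - l * r) ≤ κ) :
    ∫⁻ ω, ENNReal.ofReal (x (c ω)) ∂μ ≤
      ENNReal.ofReal κ + ENNReal.ofReal l * ∫⁻ ω, ENNReal.ofReal (Q (c ω)) ∂μ := by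
  classical
  have hc0 : ∀ ω, 0 ≤ c ω := fun ω => h.nonneg _ (hcD ω)
  have hκ : 0 ≤ κ := le_trans (by simp) (hF 0 le_rfl)
  -- Use `N` levels at the cost of an error `1 / N`. Integrals are taken in `ENNReal` since nothing
  -- is known about integrability of the payment.
  have key : ∀ N : ℕ, 0 < N → ∫⁻ ω, ENNReal.ofReal (x (c ω)) ∂μ ≤ ENNReal.ofReal (1 / N) +
      (ENNReal.ofReal κ + ENNReal.ofReal l * ∫⁻ ω, ENNReal.ofReal (Q (c ω)) ∂μ) := by
    intro N hN
    have hN' : (0 : ℝ) < N := by exact_mod_cast hN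
    set A : ℕ → Set Ω := fun j => {ω | c ω ∈ level D x N j} with hA
    set r : ℕ → ℝ := fun j => sSup (level D x N j) with hr
    have hr0 : ∀ j, 0 ≤ r j := fun j => Real.sSup_nonneg fun z hz => h.nonneg z hz.1
    -- each level is an initial segment
    have hAcase : ∀ j, A j = {ω | c ω ≤ r j} ∨ A j = {ω | c ω < r j} ∨ A j = ∅ := by
      intro j
      have hlow : ∀ z ∈ level D x N j, ∀ w ∈ D, w ≤ z → w ∈ level D x N j := fun z hz w hw hwz =>
        ⟨hw, hz.2.trans (h.antitone hw hz.1 hwz)⟩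
      have hb := h.bddAbove_level hN j
      by_cases hne : (level D x N j).Nonempty
      · by_cases hm : r j ∈ level D x N j
        · left
          ext ω
          exact ⟨fun hω => le_csSup hb hω, fun hω => hlow _ hm _ (hcD ω) hω⟩
        · right; left
          ext ω
          constructor
          · intro hω
            refine lt_of_le_of_ne (le_csSup hb hω) fun heq => hm ?_
            have hω' : c ω ∈ level D x N j := hω
            rwa [heq] at hω'
          · intro hω
            obtain ⟨a, ha, haω⟩ := exists_lt_of_lt_csSup hne hω
            exact hlow a ha _ (hcD ω) haω.le
      · right; right
        rw [Set.not_nonempty_iff_eq_empty] at hne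
        simp [hA, hne]
    have hAm : ∀ j, MeasurableSet (A j) := by
      intro j
      rcases hAcase j with h1 | h1 | h1 <;> rw [h1]
      · exact measurableSet_le hc measurable_const
      · exact measurableSet_lt hc measurable_const
      · exact MeasurableSet.empty
    -- The hypothesis on posted prices, level by level; what remains is averaging over the levels.
    have hAb : ∀ j, μ.real (A j) ≤ κ + l * (r j * μ.real (A j)) := by
      intro j
      have : μ.real (A j) * (1 - l * r j) ≤ κ := by
        rcases hAcase j with h1 | h1 | h1 <;> rw [h1]
        · exact hF _ (hr0 j)
        · exact measure_lt_le hF hc0 hl (hr0 j)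
        · simpa using hκ
      linarith
    have hint : ∀ (j : ℕ) (a : ℝ), Integrable (fun ω => if ω ∈ A j then a else 0) μ := by
      intro j a
      have : (fun ω => if ω ∈ A j then a else 0) = (A j).indicator fun _ => a := by
        ext ω; simp [Set.indicator]
      rw [this]; exact (integrable_const a).indicator (hAm j)
    have hval : ∀ (j : ℕ) (a : ℝ), ∫ ω, (if ω ∈ A j then a else 0) ∂μ = a * μ.real (A j) := by
      intro j a
      have : (fun ω => if ω ∈ A j then a else 0) = (A j).indicator fun _ => a := by
        ext ω; simp [Set.indicator]
      rw [this, integral_indicator_const a (hAm j), smul_eq_mul, mul_comm]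
    have hQ : ENNReal.ofReal ((∑ j ∈ Finset.range N, r j * μ.real (A j)) / N) ≤
        ∫⁻ ω, ENNReal.ofReal (Q (c ω)) ∂μ := by
      have e1 : (∑ j ∈ Finset.range N, r j * μ.real (A j)) / N =
          ∫ ω, (∑ j ∈ Finset.range N, if ω ∈ A j then r j else 0) / N ∂μ := by
        rw [integral_div, integral_finsetSum _ fun j _ => hint j _]
        simp_rw [hval]
      rw [e1, ofReal_integral_eq_lintegral_ofReal
        ((integrable_finsetSum _ fun j _ => hint j _).div_const _)]
      · exact lintegral_mono fun ω => ENNReal.ofReal_le_ofReal (h.pay_ge hN (hcD ω))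
      · refine Filter.Eventually.of_forall fun ω => div_nonneg (Finset.sum_nonneg fun j _ => ?_) hN'.le
        split_ifs
        exacts [hr0 j, le_rfl]
    have hX : ∫⁻ ω, ENNReal.ofReal (x (c ω)) ∂μ ≤
        ENNReal.ofReal (1 / N + (∑ j ∈ Finset.range N, μ.real (A j)) / N) := by
      have e1 : 1 / (N : ℝ) + (∑ j ∈ Finset.range N, μ.real (A j)) / N =
          ∫ ω, (1 / (N : ℝ) + (∑ j ∈ Finset.range N, if ω ∈ A j then (1 : ℝ) else 0) / N) ∂μ := by
        rw [integral_add (integrable_const _)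
          ((integrable_finsetSum _ fun j _ => hint j _).div_const _), integral_const, integral_div _ fun ω =>
            ∑ j ∈ Finset.range N, if ω ∈ A j then (1 : ℝ) else 0, integral_finsetSum _ fun j _ => hint j _]
        simp_rw [hval]
        simp
      rw [e1, ofReal_integral_eq_lintegral_ofReal]
      · exact lintegral_mono fun ω => ENNReal.ofReal_le_ofReal (h.alloc_le hN (hcD ω))
      · exact (integrable_const _).add
          ((integrable_finsetSum _ fun j _ => hint j _).div_const _)
      · refine Filter.Eventually.of_forall fun ω => add_nonneg (by positivity)
          (div_nonneg (Finset.sum_nonneg fun j _ => ?_) hN'.le)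
        split_ifs <;> norm_num
    have hS : (∑ j ∈ Finset.range N, μ.real (A j)) / N ≤
        κ + l * ((∑ j ∈ Finset.range N, r j * μ.real (A j)) / N) := by
      rw [div_le_iff₀ hN']
      calc ∑ j ∈ Finset.range N, μ.real (A j)
          ≤ ∑ j ∈ Finset.range N, (κ + l * (r j * μ.real (A j))) :=
            Finset.sum_le_sum fun j _ => hAb j
        _ = _ := by
          rw [Finset.sum_add_distrib, ← Finset.mul_sum]
          simp
          field_simp
    have hnn : 0 ≤ (∑ j ∈ Finset.range N, r j * μ.real (A j)) / N :=
      div_nonneg (Finset.sum_nonneg fun j _ => mul_nonneg (hr0 j) measureReal_nonneg) hN'.le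
    calc ∫⁻ ω, ENNReal.ofReal (x (c ω)) ∂μ ≤ _ := hX
      _ ≤ ENNReal.ofReal (1 / N + (κ + l * ((∑ j ∈ Finset.range N, r j * μ.real (A j)) / N))) :=
          ENNReal.ofReal_le_ofReal (by linarith)
      _ = ENNReal.ofReal (1 / N) + (ENNReal.ofReal κ + ENNReal.ofReal l *
            ENNReal.ofReal ((∑ j ∈ Finset.range N, r j * μ.real (A j)) / N)) := by
          rw [ENNReal.ofReal_add (by positivity) (by positivity), ENNReal.ofReal_add hκ (by positivity),
            ENNReal.ofReal_mul hl]
      _ ≤ _ := by gcongr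
  have hlim : Filter.Tendsto (fun N : ℕ => ENNReal.ofReal (1 / N) +
      (ENNReal.ofReal κ + ENNReal.ofReal l * ∫⁻ ω, ENNReal.ofReal (Q (c ω)) ∂μ)) Filter.atTop
      (nhds (ENNReal.ofReal 0 +
        (ENNReal.ofReal κ + ENNReal.ofReal l * ∫⁻ ω, ENNReal.ofReal (Q (c ω)) ∂μ))) :=
    ((ENNReal.continuous_ofReal.tendsto 0).comp tendsto_one_div_atTop_nhds_zero_nat).add
      tendsto_const_nhds
  rw [ENNReal.ofReal_zero, zero_add] at hlim
  refine ge_of_tendsto hlim ?_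
  filter_upwards [Filter.eventually_gt_atTop 0] with N hN using key N hN

end TruthfulPair

/-- A bound on the integrals over one coordinate of a product of probability spaces passes to the
integrals over the product. -/
theorem lintegral_pi_le_of_coordinate {n : ℕ} {Ω : Type*} [MeasurableSpace Ω] {μ : Measure Ω}
    [IsProbabilityMeasure μ] {f g : (Fin n → Ω) → ENNReal} (hf : Measurable f) (hg : Measurable g)
    {a b : ENNReal} (i : Fin n)
    (h : ∀ ω, ∫⁻ z, f (Function.update ω i z) ∂μ ≤ a + b * ∫⁻ z, g (Function.update ω i z) ∂μ) :
    ∫⁻ ω, f ω ∂(Measure.pi fun _ => μ) ≤ a + b * ∫⁻ ω, g ω ∂(Measure.pi fun _ => μ) := by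
  have h1 : ∫⁻ ω, f ω ∂(Measure.pi fun _ => μ) ≤ ∫⁻ ω, (a + b * g ω) ∂(Measure.pi fun _ => μ) := by
    refine lintegral_le_of_lmarginal_le (μ := fun _ => μ) {i} hf (measurable_const.add (hg.const_mul b)) ?_
    intro ω
    rw [lmarginal_singleton, lmarginal_singleton]
    refine (h ω).trans (le_of_eq ?_)
    beta_reduce
    rw [lintegral_add_left measurable_const, lintegral_const_mul _
      (f := fun z => g (Function.update ω i z)) (hg.comp (measurable_update ω))]
    simp
  refine h1.trans (le_of_eq ?_)
  rw [lintegral_add_left measurable_const, lintegral_const_mul _ hg]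
  simp

end

/-! ### Greedy and the concave hull of the posted prices -/

section

namespace Market

variable (I : Market) (A : Finset (Fin I.n))

lemma γ_nonneg (i : Fin I.n) : 0 ≤ I.γ i := div_nonneg (I.c_nonneg i) (I.u_pos i).le

lemma γ_mul_u (i : Fin I.n) : I.γ i * I.u i = I.c i := div_mul_cancel₀ _ (I.u_pos i).ne'

lemma utilityUpTo_nonneg (p : ℝ) : 0 ≤ I.utilityUpTo A p :=
  Finset.sum_nonneg fun i _ => (I.u_pos i).le

lemma utilityUpTo_mono {p q : ℝ} (h : p ≤ q) : I.utilityUpTo A p ≤ I.utilityUpTo A q := by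
  refine Finset.sum_le_sum_of_subset_of_nonneg ?_ fun i _ _ => (I.u_pos i).le
  intro i hi
  rw [Finset.mem_filter] at hi ⊢
  exact ⟨hi.1, hi.2.trans h⟩

lemma utilityUpTo_lt {p q : ℝ} (h : p < q) (hq : q ∈ A.image I.γ) :
    I.utilityUpTo A p < I.utilityUpTo A q := by
  obtain ⟨i, hi, rfl⟩ := Finset.mem_image.1 hq
  refine Finset.sum_lt_sum_of_subset (i := i) ?_ ?_ ?_ (I.u_pos i) fun j _ _ => (I.u_pos j).le
  · intro j hj
    rw [Finset.mem_filter] at hj ⊢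
    exact ⟨hj.1, hj.2.trans h.le⟩
  · simp [hi]
  · simp [h]

lemma stepPay_eq (x p : ℝ) :
    I.stepPay A x p = p * I.utilityUpTo A p - x * I.utilityUpTo A x := by
  unfold stepPay; ring

lemma stepPay_pos {x p : ℝ} (hx : 0 ≤ x) (h : x < p) (hp : p ∈ A.image I.γ) :
    0 < I.stepPay A x p := by
  rw [stepPay_eq]
  have h1 := I.utilityUpTo_lt A h hp
  have h2 := I.utilityUpTo_nonneg A x
  nlinarith

/-- Rounding a price down to a cost-per-utility of a seller does not change the sellers bought. -/
lemma utilityUpTo_round {x r : ℝ} (hxr : x ≤ r) :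
    I.utilityUpTo A r = I.utilityUpTo A x ∨
      ∃ p ∈ A.image I.γ, x < p ∧ p ≤ r ∧ I.utilityUpTo A r = I.utilityUpTo A p := by
  classical
  by_cases h : ((A.image I.γ).filter fun p => x < p ∧ p ≤ r).Nonempty
  · right
    refine ⟨_, (Finset.mem_filter.1 (Finset.max'_mem _ h)).1,
      (Finset.mem_filter.1 (Finset.max'_mem _ h)).2.1,
      (Finset.mem_filter.1 (Finset.max'_mem _ h)).2.2, ?_⟩
    refine Finset.sum_congr (Finset.filter_congr fun i hi => ?_) fun _ _ => rfl
    constructor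
    · intro hir
      by_cases hix : I.γ i ≤ x
      · exact hix.trans (Finset.mem_filter.1 (Finset.max'_mem _ h)).2.1.le
      · exact Finset.le_max' _ _ (Finset.mem_filter.2
          ⟨Finset.mem_image_of_mem _ hi, not_le.1 hix, hir⟩)
    · exact fun hi' => hi'.trans (Finset.mem_filter.1 (Finset.max'_mem _ h)).2.2
  · left
    rw [Finset.not_nonempty_iff_eq_empty, Finset.filter_eq_empty_iff] at h
    refine Finset.sum_congr (Finset.filter_congr fun i hi => ?_) fun _ _ => rfl
    constructor
    · intro hir
      by_contra hcon
      exact h (Finset.mem_image_of_mem _ hi) ⟨not_le.1 hcon, hir⟩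
    · exact fun hi' => hi'.trans hxr

/-- The rule `f` is a mixture of two posted prices that is affordable on `A` for the budget `B`, and it
is optimal, as witnessed by a Lagrange multiplier. -/
structure IsOptimalRule (B : ℝ) (f : TwoStepRule) : Prop where
  t_nonneg : 0 ≤ f.t
  t_le_one : f.t ≤ 1
  p₁_nonneg : 0 ≤ f.p₁
  p₁_le_p₂ : f.p₁ ≤ f.p₂
  pay_le : (1 - f.t) * (f.p₁ * I.utilityUpTo A f.p₁) + f.t * (f.p₂ * I.utilityUpTo A f.p₂) ≤ B
  multiplier : ∃ l, 0 ≤ l ∧ ∀ r, 0 ≤ r → I.utilityUpTo A r * (1 - l * r) ≤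
    (1 - f.t) * I.utilityUpTo A f.p₁ + f.t * I.utilityUpTo A f.p₂ - l * B

/-- No price up to `x` lies above the line through `x` and a later price. -/
def GreedyInvariant (x : ℝ) : Prop :=
  ∀ r, 0 ≤ r → r ≤ x → ∀ p ∈ A.image I.γ, x < p →
    I.utilityUpTo A r - I.utilityUpTo A x ≤
      I.stepEfficiency A x p * (r * I.utilityUpTo A r - x * I.utilityUpTo A x)

lemma stepEfficiency_nonneg {x p : ℝ} (hx : 0 ≤ x) (h : x < p) (hp : p ∈ A.image I.γ) :
    0 ≤ I.stepEfficiency A x p :=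
  div_nonneg (by linarith [I.utilityUpTo_lt A h hp]) (I.stepPay_pos A hx h hp).le

lemma line_of_greedy_choice {x p : ℝ} (hx : 0 ≤ x) (hinv : I.GreedyInvariant A x)
    (hp : p ∈ A.image I.γ) (hxp : x < p)
    (hmax : ∀ p' ∈ A.image I.γ, x < p' → I.stepEfficiency A x p' ≤ I.stepEfficiency A x p)
    {r : ℝ} (hr : 0 ≤ r) :
    I.utilityUpTo A r - I.utilityUpTo A x ≤
      I.stepEfficiency A x p * (r * I.utilityUpTo A r - x * I.utilityUpTo A x) := by
  have he := I.stepEfficiency_nonneg A hx hxp hp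
  rcases le_or_gt r x with hrx | hrx
  · exact hinv r hr hrx p hp hxp
  rcases I.utilityUpTo_round A hrx.le with h | ⟨p', hp', h1, h2, h⟩
  · rw [h]
    have : 0 ≤ r * I.utilityUpTo A x - x * I.utilityUpTo A x := by
      have := I.utilityUpTo_nonneg A x
      nlinarith
    nlinarith
  · rw [h]
    have hq := I.stepPay_pos A hx h1 hp'
    have hm := hmax p' hp' h1
    have h3 : I.utilityUpTo A p' - I.utilityUpTo A x ≤
        I.stepEfficiency A x p * (p' * I.utilityUpTo A p' - x * I.utilityUpTo A x) := by
      rw [← stepPay_eq]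
      unfold stepEfficiency at hm
      rw [div_le_iff₀ hq] at hm
      exact hm
    have h4 : p' * I.utilityUpTo A p' ≤ r * I.utilityUpTo A p' :=
      mul_le_mul_of_nonneg_right h2 (I.utilityUpTo_nonneg A p')
    nlinarith

/-- Greedy traverses the upper concave hull; the slope of the segment on which the money runs out is
the multiplier. The total budget is the remaining `b` plus the amount `x * U(x)` already spent. -/
lemma greedyLoop_isOptimalRule (N : ℕ) : ∀ (x b : ℝ), 0 ≤ x → 0 ≤ b → I.GreedyInvariant A x →
    ((A.image I.γ).filter fun p => x < p).card ≤ N →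
    I.IsOptimalRule A (b + x * I.utilityUpTo A x) (I.greedyLoop A N x b) := by
  -- Once all sellers are bought, the multiplier `0` certifies optimality.
  have hdone : ∀ (x b : ℝ), 0 ≤ x → 0 ≤ b → ¬((A.image I.γ).filter fun p => x < p).Nonempty →
      I.IsOptimalRule A (b + x * I.utilityUpTo A x) ⟨0, x, x⟩ := by
    intro x b hx hb h
    refine ⟨le_rfl, zero_le_one, hx, le_rfl, by simpa using hb, 0, le_rfl, fun r hr => ?_⟩
    simp only [zero_mul, sub_zero, mul_one, one_mul, add_zero]
    rcases le_or_gt r x with hrx | hrx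
    · exact I.utilityUpTo_mono A hrx
    · rcases I.utilityUpTo_round A hrx.le with h' | ⟨p, hp, h1, -⟩
      · exact h'.le
      · exact (h ⟨p, Finset.mem_filter.2 ⟨hp, h1⟩⟩).elim
  induction N with
  | zero =>
    intro x b hx hb _ hcard
    refine hdone x b hx hb ?_
    rw [Finset.not_nonempty_iff_eq_empty, ← Finset.card_eq_zero]; omega
  | succ N ih =>
    intro x b hx hb hinv hcard
    unfold greedyLoop
    by_cases h : ((A.image I.γ).filter fun p => x < p).Nonempty
    · rw [dif_pos h]
      have hspec := (Finset.exists_max_image _ (I.stepEfficiency A x) h).choose_spec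
      set p := (Finset.exists_max_image _ (I.stepEfficiency A x) h).choose with hpdef
      obtain ⟨hpm, hmax'⟩ := hspec
      obtain ⟨hp, hxp⟩ := Finset.mem_filter.1 hpm
      have hmax : ∀ p' ∈ A.image I.γ, x < p' → I.stepEfficiency A x p' ≤ I.stepEfficiency A x p :=
        fun p' hp' hx' => hmax' p' (Finset.mem_filter.2 ⟨hp', hx'⟩)
      have hq := I.stepPay_pos A hx hxp hp
      have he := I.stepEfficiency_nonneg A hx hxp hp
      have hline : ∀ {r : ℝ}, 0 ≤ r → _ := fun {r} hr =>
        I.line_of_greedy_choice A hx hinv hp hxp hmax (r := r) hr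
      have heq : I.stepEfficiency A x p * (p * I.utilityUpTo A p - x * I.utilityUpTo A x) =
          I.utilityUpTo A p - I.utilityUpTo A x := by
        rw [← stepPay_eq]; exact div_mul_cancel₀ _ hq.ne'
      have hp0 : 0 ≤ p := hx.trans hxp.le
      dsimp only
      by_cases hb' : I.stepPay A x p ≤ b
      · rw [if_pos hb']
        have := ih p (b - I.stepPay A x p) hp0 (by linarith) ?_ ?_
        · convert this using 1
          rw [stepPay_eq]; ring
        -- Slopes decrease along the hull, and prices below `p` pay less than `p`; so they stay
        -- below the line when its slope through `p` decreases.
        · intro r hr hrp p' hp' hpp'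
          have hq' := I.stepPay_pos A hp0 hpp' hp'
          have h1 : ∀ {s : ℝ}, 0 ≤ s → I.utilityUpTo A s - I.utilityUpTo A p ≤
              I.stepEfficiency A x p * (s * I.utilityUpTo A s - p * I.utilityUpTo A p) := by
            intro s hs
            have := hline hs
            linarith
          have h2 : I.stepEfficiency A p p' ≤ I.stepEfficiency A x p := by
            have := h1 (hp0.trans hpp'.le)
            rw [← stepPay_eq] at this
            exact (div_le_iff₀ hq').2 this
          have h3 : r * I.utilityUpTo A r ≤ p * I.utilityUpTo A p :=
            mul_le_mul hrp (I.utilityUpTo_mono A hrp) (I.utilityUpTo_nonneg A r) hp0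
          have := h1 hr
          nlinarith
        · have hsub : ((A.image I.γ).filter fun p' => p < p') ⊂
              ((A.image I.γ).filter fun p' => x < p') := by
            rw [Finset.ssubset_iff_of_subset]
            · exact ⟨p, hpm, by simp⟩
            · intro p' hp'
              rw [Finset.mem_filter] at hp' ⊢
              exact ⟨hp'.1, hxp.trans hp'.2⟩
          have := Finset.card_lt_card hsub
          omega
      · rw [if_neg hb']
        push Not at hb'
        have ht : b / I.stepPay A x p * (p * I.utilityUpTo A p - x * I.utilityUpTo A x) = b := by
          rw [← stepPay_eq]; exact div_mul_cancel₀ _ hq.ne'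
        refine ⟨div_nonneg hb hq.le, (div_le_one hq).2 hb'.le, hx, hxp.le, ?_,
          I.stepEfficiency A x p, he, fun r hr => ?_⟩
        · dsimp only
          nlinarith
        · dsimp only
          have h1 := hline hr
          have h2 : b / I.stepPay A x p * (I.utilityUpTo A p - I.utilityUpTo A x) =
              I.stepEfficiency A x p * b := by
            rw [← heq, mul_left_comm, ht]
          nlinarith
    · rw [dif_neg h]
      exact hdone x b hx hb h

theorem greedy_isOptimalRule {B : ℝ} (hB : 0 ≤ B) : I.IsOptimalRule A B (I.greedy A B) := by
  have := I.greedyLoop_isOptimalRule A A.card 0 B le_rfl hB ?_ ?_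
  · simpa [greedy] using this
  · intro r hr hr0 p hp hp0
    obtain rfl := le_antisymm hr0 hr
    simp
  · exact (Finset.card_filter_le _ _).trans Finset.card_image_le

lemma sum_alloc_mul {f : TwoStepRule} (h : f.p₁ ≤ f.p₂) :
    ∑ i ∈ A, f.alloc (I.γ i) * I.u i =
      (1 - f.t) * I.utilityUpTo A f.p₁ + f.t * I.utilityUpTo A f.p₂ := by
  unfold utilityUpTo
  rw [Finset.sum_filter, Finset.sum_filter, Finset.mul_sum, Finset.mul_sum, ← Finset.sum_add_distrib]
  refine Finset.sum_congr rfl fun i _ => ?_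
  unfold TwoStepRule.alloc
  split_ifs with h1 h2
  · ring
  · exact absurd (h1.trans h) h2
  · ring
  · ring

lemma greedyUtility_eq {B : ℝ} (hB : 0 ≤ B) : I.greedyUtility B =
    (1 - (I.greedy Finset.univ B).t) * I.utilityUpTo Finset.univ (I.greedy Finset.univ B).p₁ +
      (I.greedy Finset.univ B).t * I.utilityUpTo Finset.univ (I.greedy Finset.univ B).p₂ :=
  I.sum_alloc_mul _ (I.greedy_isOptimalRule _ hB).p₁_le_p₂

lemma exists_multiplier_greedyUtility {B : ℝ} (hB : 0 ≤ B) : ∃ l, 0 ≤ l ∧ ∀ r, 0 ≤ r →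
    I.utilityUpTo Finset.univ r * (1 - l * r) ≤ I.greedyUtility B - l * B := by
  rw [I.greedyUtility_eq hB]
  exact (I.greedy_isOptimalRule _ hB).multiplier

end Market

end

/-! ### Lagrangian bounds for mechanisms, concentration, and the knapsack optimum -/

section

namespace Mechanism

variable {n : ℕ} {M : Mechanism n} {u : Fin n → ℝ} {S : Set (Fin n → ℝ)}

/-- With the other reports frozen, a mechanism is a rule for one seller, and the positive utility
cancels from its incentive constraints. -/
lemma AdmissibleOn.truthfulPair (h : M.AdmissibleOn u S) (hu : ∀ i, 0 < u i) {D : Set ℝ}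
    (hD : ∀ z ∈ D, 0 ≤ z) {γ : Fin n → ℝ} {i : Fin n} (hγ : ∀ z ∈ D, Function.update γ i z ∈ S) :
    TruthfulPair D (fun z => M.alloc (Function.update γ i z) i)
      (fun z => M.pay (Function.update γ i z) i) where
  nonneg := hD
  alloc_mem z hz := h.alloc_mem _ (hγ z hz) i
  truthful z hz w hw := by
    have := h.truthful _ (hγ z hz) i w (by simpa using hγ w hw)
    simp only [profit, Function.update_self, Function.update_idem] at this
    have hui := hu i
    refine le_of_mul_le_mul_right ?_ hui
    linarith
  rational z hz := by
    have := h.rational _ (hγ z hz) i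
    simp only [profit, Function.update_self] at this
    refine le_of_mul_le_mul_right ?_ (hu i)
    linarith

lemma AdmissibleOn.pay_nonneg (h : M.AdmissibleOn u S) (hu : ∀ i, 0 < u i)
    {γ : Fin n → ℝ} (hγ : γ ∈ S) {i : Fin n} (hγi : 0 ≤ γ i) : 0 ≤ M.pay γ i := by
  have h1 := h.rational _ hγ i
  have h2 := (h.alloc_mem _ hγ i).1
  simp only [profit] at h1
  have h3 : 0 ≤ M.alloc γ i * (γ i * u i) := mul_nonneg h2 (mul_nonneg hγi (hu i).le)
  exact le_of_mul_le_mul_right (by linarith) (hu i)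

/-- Lagrangian bound for one seller of a market with independent costs. -/
theorem AdmissibleOn.integral_alloc_le (h : M.AdmissibleOn u S) (hu : ∀ i, 0 < u i)
    {Ω : Type*} [MeasurableSpace Ω] {μ : Measure Ω} [IsProbabilityMeasure μ] {c : Ω → ℝ}
    (hc : Measurable c) {D : Set ℝ} (hD : ∀ z ∈ D, 0 ≤ z) (hcD : ∀ ω, c ω ∈ D)
    (hS : ∀ γ : Fin n → ℝ, (∀ i, γ i ∈ D) → γ ∈ S) (i : Fin n)
    (ha : Measurable fun σ : Fin n → Ω => M.alloc (fun j => c (σ j)) i)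
    (hp : Measurable fun σ : Fin n → Ω => M.pay (fun j => c (σ j)) i)
    (hpi : Integrable (fun σ : Fin n → Ω => M.pay (fun j => c (σ j)) i) (Measure.pi fun _ => μ))
    {κ l : ℝ} (hl : 0 ≤ l) (hF : ∀ r, 0 ≤ r → μ.real {ω | c ω ≤ r} * (1 - l * r) ≤ κ) :
    ∫ σ : Fin n → Ω, M.alloc (fun j => c (σ j)) i ∂(Measure.pi fun _ => μ) ≤
      κ + l * ∫ σ : Fin n → Ω, M.pay (fun j => c (σ j)) i ∂(Measure.pi fun _ => μ) := by
  have hκ : 0 ≤ κ := le_trans (by simp) (hF 0 le_rfl)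
  have hmem : ∀ σ : Fin n → Ω, (fun j => c (σ j)) ∈ S := fun σ => hS _ fun j => hcD _
  have ha0 : ∀ σ : Fin n → Ω, M.alloc (fun j => c (σ j)) i ∈ Set.Icc (0 : ℝ) 1 :=
    fun σ => h.alloc_mem _ (hmem σ) i
  have hp0 : ∀ σ : Fin n → Ω, 0 ≤ M.pay (fun j => c (σ j)) i :=
    fun σ => h.pay_nonneg hu (hmem σ) (hD _ (hcD _))
  have hai : Integrable (fun σ : Fin n → Ω => M.alloc (fun j => c (σ j)) i)
      (Measure.pi fun _ => μ) :=
    Integrable.of_bound ha.aestronglyMeasurable 1 (Filter.Eventually.of_forall fun σ => by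
      rw [Real.norm_eq_abs, abs_of_nonneg (ha0 σ).1]; exact (ha0 σ).2)
  have hupd : ∀ (σ : Fin n → Ω) (z : Ω), (fun j => c (Function.update σ i z j)) =
      Function.update (fun j => c (σ j)) i (c z) := by
    intro σ z; ext j
    by_cases hj : j = i
    · subst hj; simp
    · simp [hj]
  -- The one-seller bound has the same `κ` and `l` whatever the other costs are; this is why
  -- non-uniform rules do not help.
  have key := lintegral_pi_le_of_coordinate (μ := μ) ha.ennreal_ofReal hp.ennreal_ofReal
    (a := ENNReal.ofReal κ) (b := ENNReal.ofReal l) i (fun σ => by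
      simp_rw [hupd]
      refine (h.truthfulPair hu hD (γ := fun j => c (σ j)) (i := i) fun z hz =>
        hS _ fun j => ?_).lintegral_alloc_le hc hcD hl hF
      by_cases hj : j = i
      · subst hj; simpa using hz
      · simpa [hj] using hcD _)
  rw [← ofReal_integral_eq_lintegral_ofReal hai (Filter.Eventually.of_forall fun σ => (ha0 σ).1),
    ← ofReal_integral_eq_lintegral_ofReal hpi (Filter.Eventually.of_forall hp0),
    ← ENNReal.ofReal_mul hl, ← ENNReal.ofReal_add hκ (mul_nonneg hl (integral_nonneg hp0))] at key
  exact (ENNReal.ofReal_le_ofReal_iff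
    (add_nonneg hκ (mul_nonneg hl (integral_nonneg hp0)))).1 key

end Mechanism

/-! ### A weak law of large numbers -/

/-- Chebyshev's inequality: the average of `n` independent copies has variance `variance f w / n`.
-/
lemma eventually_measureReal_le {ι : Type*} [Finite ι] [MeasurableSpace ι] [DiscreteMeasurableSpace ι]
    (w : Measure ι) [IsProbabilityMeasure w] (f : ι → ℝ) {e d : ℝ} (he : 0 < e) (hd : 0 < d) :
    ∀ᶠ n : ℕ in Filter.atTop, (Measure.pi fun _ : Fin n => w).real
      {σ | e ≤ |(∑ i, f (σ i)) / n - ∫ j, f j ∂w|} ≤ d := by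
  have hL : MemLp f 2 w := MemLp.of_discrete
  have hlim : Filter.Tendsto (fun n : ℕ => variance f w / e ^ 2 / (n : ℝ)) Filter.atTop (nhds 0) :=
    tendsto_const_div_atTop_nhds_zero_nat _
  filter_upwards [hlim.eventually (gt_mem_nhds hd), Filter.eventually_gt_atTop 0] with n hn hn0
  have hn' : (0 : ℝ) < n := by exact_mod_cast hn0
  set X : (Fin n → ι) → ℝ := fun σ => (∑ i, f (σ i)) / n with hX
  have hXL : MemLp X 2 (Measure.pi fun _ : Fin n => w) := MemLp.of_discrete
  have hE : ∫ σ, X σ ∂(Measure.pi fun _ : Fin n => w) = ∫ j, f j ∂w := by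
    simp only [hX]
    rw [integral_div, integral_finsetSum _ fun i _ => Integrable.of_finite]
    have : ∀ i : Fin n, ∫ σ : Fin n → ι, f (σ i) ∂(Measure.pi fun _ : Fin n => w) = ∫ j, f j ∂w :=
      fun i => integral_comp_eval (μ := fun _ : Fin n => w) (i := i) (f := f)
        hL.aestronglyMeasurable
    simp_rw [this]
    simp [hn'.ne']
  have hV : variance X (Measure.pi fun _ : Fin n => w) = variance f w / n := by
    have h1 := variance_sum_pi (μ := fun _ : Fin n => w) (X := fun _ => f) (fun _ => hL)
    have h2 : X = fun σ => (n : ℝ)⁻¹ * (∑ i, fun σ : Fin n → ι => f (σ i)) σ := by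
      ext σ; simp [hX, div_eq_inv_mul]
    rw [h2, variance_const_mul, h1]
    simp; field_simp
  have h := meas_ge_le_variance_div_sq hXL he
  rw [hE, hV] at h
  refine le_trans (ENNReal.toReal_le_of_le_ofReal (by positivity [variance_nonneg f w]) h) ?_
  refine le_trans (le_of_eq ?_) hn.le
  field_simp

namespace Market

variable (I : Market)

/-! ### The knapsack optimum -/

lemma opt_set_bddAbove (B : ℝ) : BddAbove {v | ∃ x : Fin I.n → ℝ, (∀ i, x i ∈ Set.Icc (0 : ℝ) 1) ∧
    ∑ i, x i * I.c i ≤ B ∧ v = ∑ i, x i * I.u i} := by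
  refine ⟨∑ i, I.u i, ?_⟩
  rintro v ⟨x, hx, -, rfl⟩
  exact Finset.sum_le_sum fun i _ => mul_le_of_le_one_left (I.u_pos i).le (hx i).2

lemma le_opt {B : ℝ} {x : Fin I.n → ℝ} (hx : ∀ i, x i ∈ Set.Icc (0 : ℝ) 1)
    (hB : ∑ i, x i * I.c i ≤ B) : ∑ i, x i * I.u i ≤ I.opt B :=
  le_csSup (I.opt_set_bddAbove B) ⟨x, hx, hB, rfl⟩

lemma sum_u_pos : 0 < ∑ i, I.u i :=
  Finset.sum_pos (fun i _ => I.u_pos i) ⟨⟨0, I.n_pos⟩, Finset.mem_univ _⟩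

/-- An allocation that overspends can be scaled down. -/
lemma div_le_opt {B s : ℝ} (hs : 1 ≤ s) {x : Fin I.n → ℝ}
    (hx : ∀ i, x i ∈ Set.Icc (0 : ℝ) 1) (hc : ∑ i, x i * I.c i ≤ s * B) :
    (∑ i, x i * I.u i) / s ≤ I.opt B := by
  have hs0 : 0 < s := by linarith
  have : (∑ i, x i * I.u i) / s = ∑ i, x i / s * I.u i := by
    rw [Finset.sum_div]; exact Finset.sum_congr rfl fun i _ => by ring
  rw [this]
  refine I.le_opt (fun i => ⟨div_nonneg (hx i).1 hs0.le, ?_⟩) ?_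
  · exact (div_le_one hs0).2 ((hx i).2.trans hs)
  · have : ∑ i, x i / s * I.c i = (∑ i, x i * I.c i) / s := by
      rw [Finset.sum_div]; exact Finset.sum_congr rfl fun i _ => by ring
    rw [this, div_le_iff₀ hs0]; linarith

/-- Everything can be bought after scaling down by `1 + (total cost) / B`. -/
lemma opt_pos {B : ℝ} (hB : 0 < B) : 0 < I.opt B := by
  have hc : 0 ≤ ∑ i, I.c i := Finset.sum_nonneg fun i _ => I.c_nonneg i
  have h := I.div_le_opt (B := B) (s := 1 + (∑ i, I.c i) / B) (by linarith [div_nonneg hc hB.le])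
    (x := fun _ => 1) (fun _ => ⟨zero_le_one, le_rfl⟩) (by simp; field_simp; linarith)
  refine lt_of_lt_of_le (div_pos ?_ (by positivity)) h
  simpa using I.sum_u_pos

lemma greedyUtility_nonneg {B : ℝ} (hB : 0 ≤ B) : 0 ≤ I.greedyUtility B := by
  rw [I.greedyUtility_eq hB]
  have h := I.greedy_isOptimalRule Finset.univ hB
  exact add_nonneg (mul_nonneg (by linarith [h.t_le_one]) (I.utilityUpTo_nonneg _ _))
    (mul_nonneg h.t_nonneg (I.utilityUpTo_nonneg _ _))

end Market

namespace GeneralMechanism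

variable {m : ℕ} {D : BudgetDistribution m} {δ : ℝ} {P : GeneralMechanism}

lemma _root_.BudgetSmoothed.Market.SmallBidders.γ_mem {I : Market} (h : I.SmallBidders D δ)
    (k : Fin m) : ∀ i, 0 ≤ I.γ i ∧ I.γ i * I.u i ≤ δ * D.budget k :=
  fun i => ⟨I.γ_nonneg i, by rw [I.γ_mul_u]; exact h k i⟩

lemma Feasible.utility_nonneg (hP : P.Feasible D δ) {I : Market} (hI : I.SmallBidders D δ)
    (k : Fin m) : 0 ≤ P.utility I (D.budget k) :=
  Finset.sum_nonneg fun i _ => mul_nonneg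
    (((hP I.n I.u I.u_pos k).1.alloc_mem _ (hI.γ_mem k) i).1) (I.u_pos i).le

/-- Individual rationality makes payments cover costs, so the allocation is feasible for the
knapsack. -/
lemma Feasible.utility_le_opt (hP : P.Feasible D δ) {I : Market} (hI : I.SmallBidders D δ)
    (k : Fin m) : P.utility I (D.budget k) ≤ I.opt (D.budget k) := by
  obtain ⟨h1, h2⟩ := hP I.n I.u I.u_pos k
  refine I.le_opt (h1.alloc_mem _ (hI.γ_mem k)) (le_trans ?_ (h2 _ (hI.γ_mem k)))
  refine Finset.sum_le_sum fun i _ => ?_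
  have := h1.rational _ (hI.γ_mem k) i
  simp only [Mechanism.profit, I.γ_mul_u] at this
  linarith

end GeneralMechanism

lemma Market.expectedRatio_nonneg {m : ℕ} {D : BudgetDistribution m} {V : Market → ℝ → ℝ} {I : Market}
    (h : ∀ k, 0 ≤ V I (D.budget k)) : 0 ≤ I.expectedRatio D V :=
  Finset.sum_nonneg fun k _ => mul_nonneg (D.prob_pos k).le
    (div_nonneg (h k) (I.opt_pos (D.budget_pos k)).le)

/-- A real infimum is below its members only for families bounded below; nonnegativity of the
utilities provides the bound. -/
lemma smoothedRatio_le {m : ℕ} {D : BudgetDistribution m} {δ : ℝ} {V : Market → ℝ → ℝ}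
    (hV : ∀ I : Market, I.SmallBidders D δ → ∀ k, 0 ≤ V I (D.budget k)) {I : Market}
    (hI : I.SmallBidders D δ) : smoothedRatio D δ V ≤ I.expectedRatio D V :=
  ciInf_le (f := fun I : {I : Market // I.SmallBidders D δ} => I.1.expectedRatio D V)
    ⟨0, by rintro _ ⟨J, rfl⟩; exact Market.expectedRatio_nonneg (hV J.1 J.2)⟩ ⟨I, hI⟩

instance {m : ℕ} {D : BudgetDistribution m} {δ : ℝ} [Fact (0 ≤ δ)] :
    Nonempty {I : Market // I.SmallBidders D δ} :=
  ⟨⟨⟨1, one_pos, fun _ => 1, fun _ => 0, fun _ => one_pos, fun _ => le_rfl⟩,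
    fun k _ => mul_nonneg (Fact.out) (D.budget_pos k).le⟩⟩

end

/-! ### No mechanism beats Greedy: random samples of a market -/

section

namespace Market

variable (I : Market)

/-! ### Markets of independently sampled sellers -/

/-- The distribution on the sellers of the market that is proportional to their utilities. -/
def weight : Measure (Fin I.n) := ∑ j, ENNReal.ofReal (I.u j / ∑ i, I.u i) • Measure.dirac j

lemma integral_weight (f : Fin I.n → ℝ) :
    ∫ j, f j ∂I.weight = (∑ j, I.u j * f j) / ∑ i, I.u i := by
  unfold weight
  rw [integral_finsetSum_measure fun j _ => Integrable.of_finite.smul_measure ENNReal.ofReal_ne_top]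
  rw [Finset.sum_div]
  refine Finset.sum_congr rfl fun j _ => ?_
  rw [integral_smul_measure, integral_dirac,
    ENNReal.toReal_ofReal (div_nonneg (I.u_pos j).le I.sum_u_pos.le), smul_eq_mul]
  ring

instance : IsProbabilityMeasure I.weight := by
  constructor
  unfold weight
  rw [Measure.finsetSum_apply]
  simp only [Measure.smul_apply, measure_univ, smul_eq_mul, mul_one]
  rw [← ENNReal.ofReal_sum_of_nonneg fun j _ => div_nonneg (I.u_pos j).le I.sum_u_pos.le,
    ← Finset.sum_div, div_self I.sum_u_pos.ne', ENNReal.ofReal_one]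

lemma weight_real_le (r : ℝ) :
    I.weight.real {j | I.γ j ≤ r} = I.utilityUpTo Finset.univ r / ∑ i, I.u i := by
  classical
  have h := integral_indicator_one (μ := I.weight) (s := {j | I.γ j ≤ r})
    (MeasurableSet.of_discrete)
  rw [← h, I.integral_weight]
  unfold utilityUpTo
  rw [Finset.sum_filter]
  congr 1
  refine Finset.sum_congr rfl fun j _ => ?_
  by_cases hj : I.γ j ≤ r <;> simp [hj, Set.indicator]

/-- The market of `n` sellers of equal utility, and the same total utility as `I`, that have the
costs-per-utility of the sellers `σ` of `I`. -/
def sample {n : ℕ} (hn : 0 < n) (σ : Fin n → Fin I.n) : Market where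
  n := n
  n_pos := hn
  u := fun _ => (∑ i, I.u i) / n
  c := fun i => I.γ (σ i) * ((∑ i, I.u i) / n)
  u_pos := fun _ => div_pos I.sum_u_pos (by exact_mod_cast hn)
  c_nonneg := fun i => mul_nonneg (I.γ_nonneg _)
    (div_pos I.sum_u_pos (by exact_mod_cast hn)).le

lemma sample_γ {n : ℕ} (hn : 0 < n) (σ : Fin n → Fin I.n) :
    (I.sample hn σ).γ = fun i => I.γ (σ i) := by
  ext i
  exact mul_div_cancel_right₀ _ ((I.sample hn σ).u_pos i).ne'

lemma exists_γ_le : ∃ R, 0 < R ∧ ∀ i, I.γ i ≤ R := by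
  obtain ⟨R, hR⟩ := (Set.finite_range I.γ).bddAbove
  exact ⟨max R 1, by positivity, fun i => (hR ⟨i, rfl⟩).trans (le_max_left _ _)⟩

/-- Costs-per-utility stay bounded while each utility is the `n`-th part of the total, uniformly
over all samples. -/
lemma eventually_sample_small {m : ℕ} (D : BudgetDistribution m) {δ : ℝ} (hδ : 0 < δ) :
    ∀ᶠ n : ℕ in Filter.atTop, ∀ (hn : 0 < n) (σ : Fin n → Fin I.n),
      (I.sample hn σ).SmallBidders D δ := by
  obtain ⟨R, hR0, hR⟩ := I.exists_γ_le
  have h1 : Filter.Tendsto (fun n : ℕ => R * (∑ i, I.u i) / (n : ℝ)) Filter.atTop (nhds 0) :=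
    tendsto_const_div_atTop_nhds_zero_nat _
  have h2 : ∀ᶠ n : ℕ in Filter.atTop, ∀ k, R * (∑ i, I.u i) / (n : ℝ) < δ * D.budget k :=
    Filter.eventually_all.2 fun k => h1.eventually (gt_mem_nhds (mul_pos hδ (D.budget_pos k)))
  filter_upwards [h2] with n hn hn0 σ k i
  refine le_trans ?_ (hn k).le
  change I.γ (σ i) * ((∑ i, I.u i) / n) ≤ _
  rw [mul_div_assoc]
  exact mul_le_mul_of_nonneg_right (hR _) (div_nonneg I.sum_u_pos.le (Nat.cast_nonneg n))

/-- Under the sampling law, the posted price `r` sells with probability `U(r) / U`, so Greedy's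
multiplier `l` on `I` bounds each sampled seller. Summed with weights `U / n`, the payments are at
most the budget, which cancels the term `- l * B` of the multiplier inequality. -/
lemma integral_sample_utility_le {m : ℕ} {D : BudgetDistribution m} {δ : ℝ}
    {P : GeneralMechanism} (hP : P.Feasible D δ) {n : ℕ} (hn : 0 < n)
    (hs : ∀ σ : Fin n → Fin I.n, (I.sample hn σ).SmallBidders D δ) (k : Fin m) :
    ∫ σ, P.utility (I.sample hn σ) (D.budget k) ∂(Measure.pi fun _ : Fin n => I.weight) ≤
      I.greedyUtility (D.budget k) := by
  have hn' : (0 : ℝ) < n := by exact_mod_cast hn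
  have hU := I.sum_u_pos
  set U := ∑ i, I.u i with hUdef
  have hu : 0 < U / n := div_pos hU hn'
  obtain ⟨l, hl, hline⟩ := I.exists_multiplier_greedyUtility (D.budget_pos k).le
  obtain ⟨hadm, hbud⟩ := hP n (fun _ => U / n) (fun _ => hu) k
  set M := P n (fun _ => U / n) (D.budget k) with hM
  have hF : ∀ r, 0 ≤ r → I.weight.real {j | I.γ j ≤ r} * (1 - l * r) ≤
      (I.greedyUtility (D.budget k) - l * D.budget k) / U := by
    intro r hr
    rw [I.weight_real_le, div_mul_eq_mul_div]
    exact div_le_div_of_nonneg_right (hline r hr) hU.le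
  have hmem : ∀ σ : Fin n → Fin I.n, ∀ i, 0 ≤ I.γ (σ i) ∧ I.γ (σ i) * (U / n) ≤ δ * D.budget k := by
    intro σ i
    exact ⟨I.γ_nonneg _, hs σ k i⟩
  -- Reports are restricted to small costs, on which alone the mechanism is assumed truthful.
  have hi : ∀ i, _ := fun i => hadm.integral_alloc_le (fun _ => hu) (μ := I.weight) (c := I.γ)
    (Measurable.of_discrete) (D := {z | 0 ≤ z ∧ z * (U / n) ≤ δ * D.budget k}) (fun z hz => hz.1)
    (fun j => hmem (fun _ => j) ⟨0, hn⟩) (fun γ hγ => hγ) i Measurable.of_discrete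
    Measurable.of_discrete Integrable.of_finite hl hF
  have hb : ∫ σ : Fin n → Fin I.n, ∑ i, M.pay (fun j => I.γ (σ j)) i * (U / n)
      ∂(Measure.pi fun _ : Fin n => I.weight) ≤ D.budget k := by
    calc _ ≤ ∫ σ : Fin n → Fin I.n, D.budget k ∂(Measure.pi fun _ : Fin n => I.weight) :=
          integral_mono Integrable.of_finite Integrable.of_finite fun σ =>
            hbud _ (hmem σ)
      _ = _ := by simp
  have hV : ∀ σ : Fin n → Fin I.n, P.utility (I.sample hn σ) (D.budget k) =
      ∑ i, M.alloc (fun j => I.γ (σ j)) i * (U / n) := by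
    intro σ
    have := I.sample_γ hn σ
    unfold GeneralMechanism.utility
    rw [this]; rfl
  simp_rw [hV]
  rw [integral_finsetSum _ fun i _ => Integrable.of_finite] at hb ⊢
  simp_rw [integral_mul_const] at hb ⊢
  rw [← Finset.sum_mul] at hb ⊢
  set E := ∑ i, ∫ σ : Fin n → Fin I.n, M.pay (fun j => I.γ (σ j)) i
    ∂(Measure.pi fun _ : Fin n => I.weight) with hE
  have hsum : ∑ i, ∫ σ : Fin n → Fin I.n, M.alloc (fun j => I.γ (σ j)) i
      ∂(Measure.pi fun _ : Fin n => I.weight) ≤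
      n * ((I.greedyUtility (D.budget k) - l * D.budget k) / U) + l * E := by
    refine (Finset.sum_le_sum fun i _ => hi i).trans (le_of_eq ?_)
    rw [Finset.sum_add_distrib, ← Finset.mul_sum]
    simp [hE]
  calc _ ≤ (n * ((I.greedyUtility (D.budget k) - l * D.budget k) / U) + l * E) * (U / n) :=
        mul_le_mul_of_nonneg_right hsum hu.le
    _ = I.greedyUtility (D.budget k) - l * D.budget k + l * (E * (U / n)) := by
        field_simp
    _ ≤ _ := by nlinarith

/-- A nearly optimal allocation of `I` is applied to the sampled sellers. One factor `1 - e` is lost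
in choosing it, another to fluctuations of the utility, and `1 + e` to scaling down after
overspending; the two deviations have probability at most `e / 2` each. -/
lemma eventually_measureReal_opt_sample_lt {B : ℝ} (hB : 0 < B) {e : ℝ} (he : 0 < e) (he1 : e < 1) :
    ∀ᶠ n : ℕ in Filter.atTop, ∀ hn : 0 < n, (Measure.pi fun _ : Fin n => I.weight).real
      {σ | (I.sample hn σ).opt B < (1 - e) ^ 2 / (1 + e) * I.opt B} ≤ e := by
  have hO := I.opt_pos hB
  have hU := I.sum_u_pos
  obtain ⟨v, ⟨x, hx, hxB, rfl⟩, hv⟩ := exists_lt_of_lt_csSup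
    (s := {v | ∃ x : Fin I.n → ℝ, (∀ i, x i ∈ Set.Icc (0 : ℝ) 1) ∧
      ∑ i, x i * I.c i ≤ B ∧ v = ∑ i, x i * I.u i})
    ⟨0, fun _ => 0, fun _ => ⟨le_rfl, zero_le_one⟩, by simpa using hB.le, by simp⟩
    (show (1 - e) * I.opt B < I.opt B by nlinarith)
  set v := ∑ i, x i * I.u i with hvdef
  have hv0 : 0 < v := lt_trans (mul_pos (by linarith) hO) hv
  set U := ∑ i, I.u i with hUdef
  have h1 := eventually_measureReal_le I.weight x (e := e * (v / U)) (d := e / 2)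
    (by positivity) (by linarith)
  have h2 := eventually_measureReal_le I.weight (fun j => x j * I.γ j) (e := e * (B / U)) (d := e / 2)
    (by positivity) (by linarith)
  filter_upwards [h1, h2] with n h1 h2 hn
  have hn' : (0 : ℝ) < n := by exact_mod_cast hn
  refine le_trans (measureReal_mono (s₂ := _ ∪ _) ?_) ((measureReal_union_le _ _).trans
    ((add_le_add h1 h2).trans (by linarith)))
  intro σ hσ
  by_contra hcon
  simp only [Set.mem_union, Set.mem_ofPred_eq, not_or, not_le, I.integral_weight] at hcon
  obtain ⟨hc1, hc2⟩ := hcon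
  rw [← hUdef] at hc1 hc2
  have e1 : ∑ j, I.u j * x j = v := Finset.sum_congr rfl fun j _ => mul_comm _ _
  have e2 : ∑ j, I.u j * (x j * I.γ j) ≤ B := by
    refine le_trans (le_of_eq (Finset.sum_congr rfl fun j _ => ?_)) hxB
    rw [← I.γ_mul_u]; ring
  rw [e1] at hc1
  have hc1' := (abs_lt.1 hc1).1
  have hc2' := (abs_lt.1 hc2).2
  have f1 : (1 - e) * v ≤ ∑ i, x (σ i) * (U / n) := by
    rw [← Finset.sum_mul]
    have : (1 - e) * (v / U) ≤ (∑ i, x (σ i)) / n := by linarith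
    calc (1 - e) * v = (1 - e) * (v / U) * U := by field_simp
      _ ≤ (∑ i, x (σ i)) / n * U := mul_le_mul_of_nonneg_right this hU.le
      _ = _ := by ring
  have f2 : ∑ i, x (σ i) * (I.γ (σ i) * (U / n)) ≤ (1 + e) * B := by
    have e3 : ∑ i, x (σ i) * (I.γ (σ i) * (U / n)) = (∑ i, x (σ i) * I.γ (σ i)) / n * U := by
      rw [div_mul_eq_mul_div, mul_div_assoc, Finset.sum_mul]
      exact Finset.sum_congr rfl fun i _ => by ring
    have e4 : (∑ j, I.u j * (x j * I.γ j)) / U ≤ B / U := div_le_div_of_nonneg_right e2 hU.le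
    rw [e3]
    calc _ ≤ (B / U + e * (B / U)) * U := mul_le_mul_of_nonneg_right (by linarith) hU.le
      _ = _ := by field_simp
  have := (I.sample hn σ).div_le_opt (B := B) (s := 1 + e) (by linarith) (x := fun i => x (σ i))
    (fun i => hx _) f2
  have hσ' : (I.sample hn σ).opt B < (1 - e) ^ 2 / (1 + e) * I.opt B := hσ
  have f3 : (1 - e) ^ 2 / (1 + e) * I.opt B ≤ (I.sample hn σ).opt B := by
    refine le_trans ?_ this
    rw [div_mul_eq_mul_div]
    refine div_le_div_of_nonneg_right (le_trans ?_ f1) (by linarith)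
    nlinarith
  linarith

/-- Every market has random subsamples on which no mechanism does better than Greedy on the market. -/
theorem smoothedRatio_le_expectedRatio_greedy {m : ℕ} {D : BudgetDistribution m} {δ : ℝ} (hδ : 0 < δ)
    {P : GeneralMechanism} (hP : P.Feasible D δ) :
    smoothedRatio D δ P.utility ≤ I.expectedRatio D greedyUtility := by
  have hg : ∀ k, 0 ≤ I.greedyUtility (D.budget k) := fun k =>
    I.greedyUtility_nonneg (D.budget_pos k).le
  have hO : ∀ k, 0 < I.opt (D.budget k) := fun k => I.opt_pos (D.budget_pos k)
  -- The infimum is at most the average over samples. Where the optimum of the sample is poor, the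
  -- ratio is still at most `1`, and this has probability at most `e`; elsewhere the denominator is
  -- replaced by a constant.
  have key : ∀ e : ℝ, 0 < e → e < 1 → smoothedRatio D δ P.utility ≤
      ∑ k, D.prob k * (I.greedyUtility (D.budget k) / ((1 - e) ^ 2 / (1 + e) * I.opt (D.budget k))
        + e) := by
    intro e he he1
    have h1 : ∀ᶠ n : ℕ in Filter.atTop, ∀ k, ∀ hn : 0 < n,
        (Measure.pi fun _ : Fin n => I.weight).real {σ | (I.sample hn σ).opt (D.budget k) <
          (1 - e) ^ 2 / (1 + e) * I.opt (D.budget k)} ≤ e :=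
      Filter.eventually_all.2 fun k => I.eventually_measureReal_opt_sample_lt (D.budget_pos k) he he1
    obtain ⟨n, h1, hs, hn⟩ := (h1.and ((I.eventually_sample_small D hδ).and
      (Filter.eventually_gt_atTop 0))).exists
    have hs := hs hn
    set μ := Measure.pi fun _ : Fin n => I.weight with hμ
    have hc : (0 : ℝ) < (1 - e) ^ 2 / (1 + e) := div_pos (pow_pos (by linarith) 2) (by linarith)
    calc smoothedRatio D δ P.utility = ∫ σ, smoothedRatio D δ P.utility ∂μ := by simp [hμ]
      _ ≤ ∫ σ, ∑ k, D.prob k * (P.utility (I.sample hn σ) (D.budget k) /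
            ((1 - e) ^ 2 / (1 + e) * I.opt (D.budget k)) +
            Set.indicator {σ | (I.sample hn σ).opt (D.budget k) <
              (1 - e) ^ 2 / (1 + e) * I.opt (D.budget k)} 1 σ) ∂μ := by
          refine integral_mono Integrable.of_finite Integrable.of_finite fun σ => ?_
          refine (smoothedRatio_le (fun J hJ k => hP.utility_nonneg hJ k) (hs σ)).trans ?_
          refine Finset.sum_le_sum fun k _ => mul_le_mul_of_nonneg_left ?_ (D.prob_pos k).le
          have hV0 := hP.utility_nonneg (hs σ) k
          have hV1 := hP.utility_le_opt (hs σ) k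
          have hOs := (I.sample hn σ).opt_pos (D.budget_pos k)
          have hd : 0 < (1 - e) ^ 2 / (1 + e) * I.opt (D.budget k) := mul_pos hc (hO k)
          by_cases hσ : (I.sample hn σ).opt (D.budget k) <
              (1 - e) ^ 2 / (1 + e) * I.opt (D.budget k)
          · simp only [Set.indicator, Set.mem_ofPred_eq]
            rw [if_pos hσ]
            have := (div_le_one hOs).2 hV1
            have := div_nonneg hV0 hd.le
            simp only [Pi.one_apply]
            linarith
          · simp only [Set.indicator, Set.mem_ofPred_eq]
            rw [if_neg hσ, add_zero]
            exact div_le_div_of_nonneg_left hV0 hd (not_lt.1 hσ)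
      _ ≤ _ := by
          rw [integral_finsetSum _ fun k _ => Integrable.of_finite]
          refine Finset.sum_le_sum fun k _ => ?_
          rw [integral_const_mul, integral_add Integrable.of_finite Integrable.of_finite,
            integral_div, integral_indicator_one MeasurableSet.of_discrete]
          refine mul_le_mul_of_nonneg_left (add_le_add ?_ (h1 k hn)) (D.prob_pos k).le
          exact div_le_div_of_nonneg_right (I.integral_sample_utility_le hP hn hs k)
            (mul_pos hc (hO k)).le
  have hcont : ContinuousAt (fun e : ℝ => ∑ k, D.prob k * (I.greedyUtility (D.budget k) /
      ((1 - e) ^ 2 / (1 + e) * I.opt (D.budget k)) + e)) 0 := by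
    refine tendsto_finsetSum _ fun k _ => ?_
    refine ContinuousAt.mul continuousAt_const (ContinuousAt.add (ContinuousAt.div continuousAt_const
      (ContinuousAt.mul (ContinuousAt.div (by fun_prop) (by fun_prop) (by norm_num))
        continuousAt_const) ?_) continuousAt_id)
    simpa using (hO k).ne'
  have hlim := (hcont.tendsto.mono_left (nhdsWithin_le_nhds (s := Set.Ioi 0)))
  have := ge_of_tendsto hlim (by
    filter_upwards [Ioo_mem_nhdsGT (show (0 : ℝ) < 1 from one_pos)] with e he
    exact key e he.1 he.2)
  simpa [expectedRatio] using this

end Market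

theorem smoothedRatio_le_smoothedRatio_greedy {m : ℕ} {D : BudgetDistribution m} {δ : ℝ}
    (hδ : 0 < δ) {P : GeneralMechanism} (hP : P.Feasible D δ) :
    smoothedRatio D δ P.utility ≤ smoothedRatio D δ Market.greedyUtility :=
  haveI : Fact (0 ≤ δ) := ⟨hδ.le⟩
  le_ciInf fun I => I.1.smoothedRatio_le_expectedRatio_greedy hδ hP

end

/-! ### Random halves: variance, ranking by utility, and balance at all prices -/

section

/-! ### Uniformly random subsets -/

/-- The variance of the weight of a uniformly random subset. Pairing the subsets with and without
the new element cancels the cross terms. -/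
lemma sum_powerset_sq_sub {ι : Type*} [DecidableEq ι] (S : Finset ι) (v : ι → ℝ) :
    ∑ X ∈ S.powerset, (∑ i ∈ X, v i - (∑ i ∈ S, v i) / 2) ^ 2 =
      2 ^ S.card / 4 * ∑ i ∈ S, v i ^ 2 := by
  induction S using Finset.induction_on with
  | empty => simp
  | insert a S ha ih =>
    rw [Finset.sum_powerset_insert ha, Finset.sum_insert ha, Finset.sum_insert ha,
      Finset.card_insert_of_notMem ha, ← Finset.sum_add_distrib]
    have h1 : ∀ X ∈ S.powerset, (∑ i ∈ X, v i - (v a + ∑ i ∈ S, v i) / 2) ^ 2 +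
        (∑ i ∈ insert a X, v i - (v a + ∑ i ∈ S, v i) / 2) ^ 2 =
        2 * (∑ i ∈ X, v i - (∑ i ∈ S, v i) / 2) ^ 2 + v a ^ 2 / 2 := by
      intro X hX
      rw [Finset.sum_insert fun h => ha (Finset.mem_powerset.1 hX h)]
      ring
    rw [Finset.sum_congr rfl h1, Finset.sum_add_distrib, ← Finset.mul_sum, ih, Finset.sum_const,
      Finset.card_powerset]
    simp only [nsmul_eq_mul]
    push_cast
    ring

namespace TwoStepRule

lemma alloc_eq {f : TwoStepRule} (h : f.p₁ ≤ f.p₂) (z : ℝ) : f.alloc z =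
    (1 - f.t) * (Set.Iic f.p₁).indicator 1 z + f.t * (Set.Iic f.p₂).indicator 1 z := by
  unfold alloc
  split_ifs with h1 h2
  · simp [h1, h1.trans h]
  · simp [h1, h2]
  · simp [h1, h2]

lemma integral_Ioi_indicator_Iic (γ p : ℝ) :
    ∫ z in Set.Ioi γ, (Set.Iic p).indicator (1 : ℝ → ℝ) z = max (p - γ) 0 := by
  rw [integral_indicator_one measurableSet_Iic, measureReal_restrict_apply measurableSet_Iic,
    Set.inter_comm, Set.Ioi_inter_Iic, Real.volume_real_Ioc]

lemma integrableOn_indicator_Iic (γ p : ℝ) :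
    IntegrableOn ((Set.Iic p).indicator (1 : ℝ → ℝ)) (Set.Ioi γ) := by
  rw [IntegrableOn, integrable_indicator_iff measurableSet_Iic, IntegrableOn,
    Measure.restrict_restrict measurableSet_Iic]
  refine integrableOn_const (C := (1 : ℝ)) ?_
  rw [Set.inter_comm, Set.Ioi_inter_Iic, Real.volume_Ioc]
  exact ENNReal.ofReal_ne_top

/-- The rule posts `p₁` with probability `1 - t` and `p₂` with probability `t`, and the Myerson
payment of a posted price is this price. -/
lemma pay_eq {f : TwoStepRule} (h : f.p₁ ≤ f.p₂) (γ : ℝ) : f.pay γ =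
    (1 - f.t) * (if γ ≤ f.p₁ then f.p₁ else 0) + f.t * (if γ ≤ f.p₂ then f.p₂ else 0) := by
  have h1 : ∫ z in Set.Ioi γ, f.alloc z =
      (1 - f.t) * max (f.p₁ - γ) 0 + f.t * max (f.p₂ - γ) 0 := by
    simp_rw [f.alloc_eq h]
    rw [integral_add ((integrableOn_indicator_Iic _ _).const_mul _)
      ((integrableOn_indicator_Iic _ _).const_mul _), integral_const_mul, integral_const_mul,
      integral_Ioi_indicator_Iic, integral_Ioi_indicator_Iic]
  unfold pay
  rw [h1, f.alloc_eq h]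
  have h2 : ∀ p : ℝ, γ * (Set.Iic p).indicator (1 : ℝ → ℝ) γ + max (p - γ) 0 =
      if γ ≤ p then p else 0 := by
    intro p
    split_ifs with hp
    · simp [hp]
    · simp [hp, (not_le.1 hp).le]
  rw [← h2, ← h2]; ring

end TwoStepRule

namespace Market

variable (I : Market)

lemma sum_pay_mul (A : Finset (Fin I.n)) {f : TwoStepRule} (h : f.p₁ ≤ f.p₂) :
    ∑ i ∈ A, f.pay (I.γ i) * I.u i =
      (1 - f.t) * (f.p₁ * I.utilityUpTo A f.p₁) + f.t * (f.p₂ * I.utilityUpTo A f.p₂) := by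
  unfold utilityUpTo
  rw [Finset.sum_filter, Finset.sum_filter, Finset.mul_sum, Finset.mul_sum, Finset.mul_sum,
    Finset.mul_sum, ← Finset.sum_add_distrib]
  refine Finset.sum_congr rfl fun i _ => ?_
  rw [f.pay_eq h]
  split_ifs <;> ring

lemma serve_nonneg (ord : Equiv.Perm (Fin I.n)) (A : Finset (Fin I.n)) {f : TwoStepRule} (L : ℝ)
    (ht : 0 ≤ f.t) : 0 ≤ I.serve ord A f L := by
  refine Finset.sum_nonneg fun i _ => ?_
  split_ifs
  · refine mul_nonneg ?_ (I.u_pos i).le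
    unfold TwoStepRule.alloc
    split_ifs
    exacts [zero_le_one, ht, le_rfl]
  · exact le_rfl

/-- If the total payment does not exceed the limit, everybody is served. -/
lemma serve_eq (ord : Equiv.Perm (Fin I.n)) (A : Finset (Fin I.n)) {f : TwoStepRule} {L : ℝ}
    (hp : ∀ i ∈ A, 0 ≤ f.pay (I.γ i)) (hL : ∑ i ∈ A, f.pay (I.γ i) * I.u i ≤ L) :
    I.serve ord A f L = ∑ i ∈ A, f.alloc (I.γ i) * I.u i := by
  classical
  refine Finset.sum_congr rfl fun i _ => if_pos (le_trans ?_ hL)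
  exact Finset.sum_le_sum_of_subset_of_nonneg (Finset.filter_subset _ _)
    fun j hj _ => mul_nonneg (hp j hj) (I.u_pos j).le

/-! ### The sellers of highest utility -/

open Classical in
/-- The sellers that precede `i` in the order by decreasing utility. -/
def preceding (i : Fin I.n) : Finset (Fin I.n) :=
  Finset.univ.filter fun j => I.u i < I.u j ∨ (I.u i = I.u j ∧ j < i)

lemma mem_preceding {i j : Fin I.n} :
    j ∈ I.preceding i ↔ I.u i < I.u j ∨ (I.u i = I.u j ∧ j < i) := by
  simp [preceding]

lemma mem_top {C : ℕ} {i : Fin I.n} : i ∈ I.top C ↔ (I.preceding i).card < C := by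
  classical
  simp [top, preceding]

lemma preceding_card_lt {i j : Fin I.n} (h : j ∈ I.preceding i) :
    (I.preceding j).card < (I.preceding i).card := by
  refine Finset.card_lt_card ((Finset.ssubset_iff_of_subset ?_).2 ⟨j, h, ?_⟩)
  · intro k hk
    rw [mem_preceding] at *
    rcases hk with hk | ⟨hk, hk'⟩ <;> rcases h with h | ⟨h, h'⟩
    · left; linarith
    · left; linarith
    · left; linarith
    · right; exact ⟨h.trans hk, hk'.trans h'⟩
  · simp [mem_preceding]

/-- The number of predecessors is strictly monotone along a total order, hence injective, hence onto
by finiteness. -/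
lemma preceding_card_surjective {r : ℕ} (hr : r < I.n) : ∃ i, (I.preceding i).card = r := by
  have hlt : ∀ i, (I.preceding i).card < I.n := by
    intro i
    have : (I.preceding i).card < (Finset.univ : Finset (Fin I.n)).card :=
      Finset.card_lt_card ((Finset.ssubset_iff_of_subset (Finset.subset_univ _)).2
        ⟨i, Finset.mem_univ _, by simp [mem_preceding]⟩)
    simpa using this
  have hinj : Function.Injective fun i : Fin I.n => (⟨(I.preceding i).card, hlt i⟩ : Fin I.n) := by
    intro i j hij
    have hij' : (I.preceding i).card = (I.preceding j).card := congrArg Fin.val hij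
    by_contra hne
    have : j ∈ I.preceding i ∨ i ∈ I.preceding j := by
      rw [mem_preceding, mem_preceding]
      rcases lt_trichotomy (I.u i) (I.u j) with h | h | h
      · exact Or.inl (Or.inl h)
      · rcases lt_or_gt_of_ne hne with h' | h'
        · exact Or.inr (Or.inr ⟨h.symm, h'⟩)
        · exact Or.inl (Or.inr ⟨h, h'⟩)
      · exact Or.inr (Or.inl h)
    rcases this with h | h
    · have := I.preceding_card_lt h; omega
    · have := I.preceding_card_lt h; omega
  obtain ⟨i, hi⟩ := (Finite.injective_iff_surjective.1 hinj) ⟨r, hr⟩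
  exact ⟨i, congrArg Fin.val hi⟩

lemma sum_top_pos {C : ℕ} (hC : 0 < C) : 0 < ∑ i ∈ I.top C, I.u i := by
  obtain ⟨i, hi⟩ := I.preceding_card_surjective I.n_pos
  exact Finset.sum_pos (fun i _ => I.u_pos i) ⟨i, I.mem_top.2 (by omega)⟩

/-- A seller outside has at least `C` predecessors, so `top` has `C` members, none of smaller
utility. This bounds the variance of the random split of the others. -/
lemma mul_u_le_sum_top {C : ℕ} {j : Fin I.n} (hj : j ∉ I.top C) :
    C * I.u j ≤ ∑ i ∈ I.top C, I.u i := by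
  have hjC : C ≤ (I.preceding j).card := by simpa [mem_top] using hj
  have hjn : (I.preceding j).card ≤ I.n := by simpa using Finset.card_le_univ (I.preceding j)
  have h1 : C ≤ (I.top C).card := by
    have hsub : Finset.range C ⊆ (I.top C).image fun i => (I.preceding i).card := by
      intro r hr
      have hr' := Finset.mem_range.1 hr
      obtain ⟨i, hi⟩ := I.preceding_card_surjective (r := r) (by omega)
      exact Finset.mem_image.2 ⟨i, I.mem_top.2 (by omega), hi⟩
    simpa using (Finset.card_le_card hsub).trans Finset.card_image_le
  have h2 : ∀ i ∈ I.top C, I.u j ≤ I.u i := by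
    intro i hi
    by_contra hcon
    push Not at hcon
    have := I.preceding_card_lt (I.mem_preceding.2 (Or.inl hcon))
    have := I.mem_top.1 hi
    omega
  calc (C : ℝ) * I.u j ≤ (I.top C).card * I.u j :=
        mul_le_mul_of_nonneg_right (by exact_mod_cast h1) (I.u_pos j).le
    _ = ∑ i ∈ I.top C, I.u j := by simp
    _ ≤ _ := Finset.sum_le_sum h2

/-! ### Balanced splits -/

/-- Both parts of the split `(X, S \ X)` get at least a fraction `θ` of the utility of the sellers of
`S` up to each price for which this utility is at least `thr`. -/
def Balanced (S : Finset (Fin I.n)) (θ thr : ℝ) (X : Finset (Fin I.n)) : Prop :=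
  ∀ p, thr ≤ I.utilityUpTo S p →
    θ * I.utilityUpTo S p ≤ I.utilityUpTo X p ∧ θ * I.utilityUpTo S p ≤ I.utilityUpTo (S \ X) p

lemma utilityUpTo_add_sdiff {S X : Finset (Fin I.n)} (hX : X ⊆ S) (p : ℝ) :
    I.utilityUpTo X p + I.utilityUpTo (S \ X) p = I.utilityUpTo S p := by
  unfold utilityUpTo
  simp only [Finset.sum_filter]
  rw [add_comm]
  exact Finset.sum_sdiff hX

lemma sum_powerset_sq_utilityUpTo (S : Finset (Fin I.n)) {w : ℝ} (hw : ∀ i ∈ S, I.u i ≤ w) (p : ℝ) :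
    ∑ X ∈ S.powerset, (I.utilityUpTo X p - I.utilityUpTo S p / 2) ^ 2 ≤
      2 ^ S.card / 4 * (w * I.utilityUpTo S p) := by
  have h := sum_powerset_sq_sub S fun i => if I.γ i ≤ p then I.u i else 0
  simp only [utilityUpTo, Finset.sum_filter]
  rw [h]
  refine mul_le_mul_of_nonneg_left ?_ (by positivity)
  rw [Finset.mul_sum]
  refine Finset.sum_le_sum fun i hi => ?_
  split_ifs
  · rw [sq]; exact mul_le_mul_of_nonneg_right (hw i hi) (I.u_pos i).le
  · simp

-- A union bound over all prices would depend on their number. Only the first prices at which the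
-- utility reaches `thr * (1 + α) ^ j` are tested: up to the next level the utility grows by a
-- factor of at most `1 + α`, and the failure probabilities decay geometrically in `j`.
open Classical in
theorem card_not_balanced_le (S : Finset (Fin I.n)) {w thr α : ℝ} (hw : ∀ i ∈ S, I.u i ≤ w)
    (hw0 : 0 ≤ w) (hthr : 0 < thr) (hα : 0 < α) (hα1 : α ≤ 1) :
    ((S.powerset.filter fun X => ¬I.Balanced S (1 / 2 - 2 * α) thr X).card : ℝ) ≤
      2 ^ S.card * (w / (2 * α ^ 3 * thr)) := by
  -- the least price at which the utility reaches the level `thr * (1 + α) ^ j`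
  have hnet : ∀ j : ℕ, (∃ p, thr * (1 + α) ^ j ≤ I.utilityUpTo S p) →
      ∃ p, thr * (1 + α) ^ j ≤ I.utilityUpTo S p ∧
        ∀ q, thr * (1 + α) ^ j ≤ I.utilityUpTo S q → p ≤ q := by
    intro j ⟨p, hp⟩
    have hl : 0 < thr * (1 + α) ^ j := by positivity
    have hround : ∀ q, thr * (1 + α) ^ j ≤ I.utilityUpTo S q → ∃ q' ∈ S.image I.γ, q' ≤ q ∧
        I.utilityUpTo S q = I.utilityUpTo S q' := by
      intro q hq
      rcases le_or_gt q (-1) with hq1 | hq1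
      · have : I.utilityUpTo S q = 0 := by
          refine Finset.sum_eq_zero fun i hi => ?_
          have := (Finset.mem_filter.1 hi).2
          linarith [I.γ_nonneg i]
        linarith
      rcases I.utilityUpTo_round S hq1.le with h | ⟨q', h1, h2, h3, h4⟩
      · have : I.utilityUpTo S (-1) = 0 := by
          refine Finset.sum_eq_zero fun i hi => ?_
          have := (Finset.mem_filter.1 hi).2
          linarith [I.γ_nonneg i]
        linarith
      · exact ⟨q', h1, h3, h4⟩
    obtain ⟨p', hp', -, hpp⟩ := hround p hp
    obtain ⟨p₀, hp₀, hmin⟩ := Finset.exists_min_image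
      ((S.image I.γ).filter fun q => thr * (1 + α) ^ j ≤ I.utilityUpTo S q) id
      ⟨p', Finset.mem_filter.2 ⟨hp', hpp ▸ hp⟩⟩
    refine ⟨p₀, (Finset.mem_filter.1 hp₀).2, fun q hq => ?_⟩
    obtain ⟨q', hq', h1, h2⟩ := hround q hq
    exact (hmin q' (Finset.mem_filter.2 ⟨hq', h2 ▸ hq⟩)).trans h1
  choose! P hP1 hP2 using hnet
  -- Levels above the total utility are never reached.
  obtain ⟨J, hJ⟩ : ∃ J : ℕ, (∑ i ∈ S, I.u i) / thr < (1 + α) ^ J :=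
    pow_unbounded_of_one_lt _ (by linarith)
  set valid := (Finset.range J).filter fun j : ℕ => ∃ p, thr * (1 + α) ^ j ≤ I.utilityUpTo S p
    with hvalid
  have hval : ∀ j ∈ valid, thr * (1 + α) ^ j ≤ I.utilityUpTo S (P j) := fun j hj =>
    hP1 j (Finset.mem_filter.1 hj).2
  set dev : ℕ → Finset (Fin I.n) → ℝ := fun j X =>
    (I.utilityUpTo X (P j) - I.utilityUpTo S (P j) / 2) ^ 2 / (α * I.utilityUpTo S (P j)) ^ 2
    with hdev
  have hdev0 : ∀ j X, 0 ≤ dev j X := fun j X => by positivity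
  -- If all relative deviations at the tested prices are below `α`, balance at any `p` follows from
  -- the tested price of the last level reached by `p`.
  have hgood : ∀ X ∈ S.powerset, ¬I.Balanced S (1 / 2 - 2 * α) thr X → 1 ≤ ∑ j ∈ valid, dev j X := by
    intro X hX hbad
    have hXS := Finset.mem_powerset.1 hX
    by_contra hcon
    push Not at hcon
    refine hbad fun p hp => ?_
    have hsmall : ∀ j ∈ valid, |I.utilityUpTo X (P j) - I.utilityUpTo S (P j) / 2| ≤
        α * I.utilityUpTo S (P j) := by
      intro j hj
      have h1 : dev j X < 1 := lt_of_le_of_lt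
        (Finset.single_le_sum (f := fun j => dev j X) (fun j _ => hdev0 j X) hj) hcon
      have hpos : 0 < α * I.utilityUpTo S (P j) :=
        mul_pos hα (lt_of_lt_of_le (by positivity) (hval j hj))
      rw [hdev, div_lt_one (by positivity)] at h1
      exact abs_le_of_sq_le_sq h1.le hpos.le
    obtain ⟨j, hj1, hj2⟩ := exists_nat_pow_near (x := I.utilityUpTo S p / thr) (y := 1 + α)
      ((one_le_div hthr).2 hp) (by linarith)
    rw [le_div_iff₀ hthr, mul_comm] at hj1
    rw [div_lt_iff₀ hthr, pow_succ] at hj2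
    have hjJ : j < J := by
      have h1 : I.utilityUpTo S p ≤ ∑ i ∈ S, I.u i :=
        Finset.sum_le_sum_of_subset_of_nonneg (Finset.filter_subset _ _) fun i _ _ => (I.u_pos i).le
      have h2 : (1 + α) ^ j < (1 + α) ^ J :=
        lt_of_le_of_lt ((le_div_iff₀ hthr).2 (by rw [mul_comm]; linarith)) hJ
      exact (pow_lt_pow_iff_right₀ (by linarith)).1 h2
    have hj : j ∈ valid := Finset.mem_filter.2 ⟨Finset.mem_range.2 hjJ, p, hj1⟩
    have h3 := abs_le.1 (hsmall j hj)
    have h4 := hP2 j ⟨p, hj1⟩ p hj1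
    have h5 := I.utilityUpTo_mono X h4
    have h6 := I.utilityUpTo_mono (S \ X) h4
    have h7 := I.utilityUpTo_add_sdiff hXS (P j)
    have h8 := hval j hj
    have h9 : 0 < thr * (1 + α) ^ j := by positivity
    have h10 : I.utilityUpTo S p ≤ (1 + α) * I.utilityUpTo S (P j) := by nlinarith
    have h11 : (1 / 2 - 2 * α) * I.utilityUpTo S p ≤ (1 / 2 - α) * I.utilityUpTo S (P j) := by
      rcases le_or_gt (1 / 2 - 2 * α) 0 with hneg | hpos
      · by_cases hα2 : α ≤ 1 / 2
        · have : (1 / 2 - 2 * α) * I.utilityUpTo S p ≤ 0 :=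
            mul_nonpos_of_nonpos_of_nonneg hneg (I.utilityUpTo_nonneg S p)
          have : 0 ≤ (1 / 2 - α) * I.utilityUpTo S (P j) :=
            mul_nonneg (by linarith) (I.utilityUpTo_nonneg S _)
          linarith
        · have := I.utilityUpTo_mono S h4
          have : (1 / 2 - 2 * α) * I.utilityUpTo S p ≤ (1 / 2 - 2 * α) * I.utilityUpTo S (P j) :=
            mul_le_mul_of_nonpos_left this hneg
          have := I.utilityUpTo_nonneg S (P j)
          nlinarith
      · have : (1 / 2 - 2 * α) * I.utilityUpTo S p ≤
            (1 / 2 - 2 * α) * ((1 + α) * I.utilityUpTo S (P j)) :=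
          mul_le_mul_of_nonneg_left h10 hpos.le
        have h12 : 0 ≤ I.utilityUpTo S (P j) := I.utilityUpTo_nonneg S _
        have h13 : (1 / 2 - 2 * α) * (1 + α) ≤ 1 / 2 - α := by nlinarith
        nlinarith
    constructor <;> nlinarith [h3.1, h3.2]
  calc ((S.powerset.filter fun X => ¬I.Balanced S (1 / 2 - 2 * α) thr X).card : ℝ)
      = ∑ X ∈ S.powerset.filter fun X => ¬I.Balanced S (1 / 2 - 2 * α) thr X, (1 : ℝ) := by simp
    _ ≤ ∑ X ∈ S.powerset.filter fun X => ¬I.Balanced S (1 / 2 - 2 * α) thr X,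
          ∑ j ∈ valid, dev j X := Finset.sum_le_sum fun X hX =>
          hgood X (Finset.mem_filter.1 hX).1 (Finset.mem_filter.1 hX).2
    _ ≤ ∑ X ∈ S.powerset, ∑ j ∈ valid, dev j X :=
          Finset.sum_le_sum_of_subset_of_nonneg (Finset.filter_subset _ _)
            fun X _ _ => Finset.sum_nonneg fun j _ => hdev0 j X
    _ = ∑ j ∈ valid, ∑ X ∈ S.powerset, dev j X := Finset.sum_comm
    -- The variance is at most `w / 4` times the utility at the tested price, and it is divided by
    -- the square of `α` times this utility.
    _ ≤ ∑ j ∈ valid, 2 ^ S.card * (w / (4 * α ^ 2 * thr)) * (1 / (1 + α)) ^ j := by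
          refine Finset.sum_le_sum fun j hj => ?_
          have hU := hval j hj
          have hl : 0 < thr * (1 + α) ^ j := by positivity
          have hU0 : 0 < I.utilityUpTo S (P j) := by linarith
          simp only [hdev]
          rw [← Finset.sum_div, div_le_iff₀ (by positivity)]
          refine (I.sum_powerset_sq_utilityUpTo S hw (P j)).trans ?_
          have h1 : 2 ^ S.card * (w / (4 * α ^ 2 * thr)) * (1 / (1 + α)) ^ j *
              (α * I.utilityUpTo S (P j)) ^ 2 = 2 ^ S.card / 4 * (w * (I.utilityUpTo S (P j) *
                (I.utilityUpTo S (P j) / (thr * (1 + α) ^ j)))) := by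
            rw [div_pow, one_pow]; field_simp
          rw [h1]
          have h2 : 1 ≤ I.utilityUpTo S (P j) / (thr * (1 + α) ^ j) := (one_le_div hl).2 hU
          gcongr
          nlinarith
    _ ≤ ∑ j ∈ Finset.range J, 2 ^ S.card * (w / (4 * α ^ 2 * thr)) * (1 / (1 + α)) ^ j :=
          Finset.sum_le_sum_of_subset_of_nonneg (Finset.filter_subset _ _)
            fun j _ _ => by positivity
    _ ≤ 2 ^ S.card * (w / (4 * α ^ 2 * thr)) * ((1 + α) / α) := by
          rw [← Finset.mul_sum]
          refine mul_le_mul_of_nonneg_left ?_ (by positivity)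
          have hr : 1 / (1 + α) < 1 := (div_lt_one (by linarith)).2 (by linarith)
          have hr0 : 0 ≤ 1 / (1 + α) := by positivity
          have := (summable_geometric_of_lt_one hr0 hr).sum_le_tsum (Finset.range J)
            fun j _ => pow_nonneg hr0 j
          rw [tsum_geometric_of_lt_one hr0 hr] at this
          have h1 : 1 - 1 / (1 + α) = α / (1 + α) := by field_simp; ring
          rwa [h1, inv_div] at this
    _ ≤ _ := by
          rw [mul_assoc]
          refine mul_le_mul_of_nonneg_left ?_ (by positivity)
          have : w / (4 * α ^ 2 * thr) * ((1 + α) / α) = w / (2 * α ^ 3 * thr) * ((1 + α) / 2) := by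
            field_simp; norm_num
          rw [this]
          exact mul_le_of_le_one_right (by positivity) (by linarith)

end Market

end

/-! ### Random-Sampling-Greedy against Greedy -/

section

namespace Market

variable (I : Market)

/-! ### Random-Sampling-Greedy on a balanced split -/

lemma utilityUpTo_of_neg (A : Finset (Fin I.n)) {p : ℝ} (hp : p < 0) : I.utilityUpTo A p = 0 := by
  refine Finset.sum_eq_zero fun i hi => ?_
  have := (Finset.mem_filter.1 hi).2
  linarith [I.γ_nonneg i]

/-- The rule that is optimal on one part of a balanced split is nearly as good on the other part. -/
lemma serve_truncate_ge (s : SamplingParameters) (ord : Equiv.Perm (Fin I.n)) {X Y : Finset (Fin I.n)}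
    {θ : ℝ} (hθ : 0 < θ) (hθ1 : θ ≤ 1 / 2)
    (hXY : ∀ p, I.utilityUpTo X p + I.utilityUpTo Y p = I.utilityUpTo (I.top s.C)ᶜ p)
    (hbal : ∀ p, (∑ i ∈ I.top s.C, I.u i) / (s.η * s.C) ≤ I.utilityUpTo (I.top s.C)ᶜ p →
      θ * I.utilityUpTo (I.top s.C)ᶜ p ≤ I.utilityUpTo X p ∧
      θ * I.utilityUpTo (I.top s.C)ᶜ p ≤ I.utilityUpTo Y p)
    {f : TwoStepRule} {B L : ℝ} (hf : I.IsOptimalRule X B f) (hB : B ≤ θ / (1 - θ) * L) :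
    θ / (1 - θ) * ((1 - f.t) * I.utilityUpTo X f.p₁ + f.t * I.utilityUpTo X f.p₂ -
      (∑ i ∈ I.top s.C, I.u i) / (s.η * s.C)) ≤ I.serve ord Y (I.truncate s f) L := by
  set S := (I.top s.C)ᶜ with hS
  set thr := (∑ i ∈ I.top s.C, I.u i) / (s.η * s.C) with hthr
  set ρ := θ / (1 - θ) with hρ
  have hθ' : 0 < 1 - θ := by linarith
  have hρ0 : 0 < ρ := div_pos hθ hθ'
  have hρ1 : ρ ≤ 1 := (div_le_one hθ').2 (by linarith)
  -- the parts are comparable at high prices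
  have hYX : ∀ p, thr ≤ I.utilityUpTo S p → ρ * I.utilityUpTo Y p ≤ I.utilityUpTo X p := by
    intro p hp
    have h1 := (hbal p hp).1
    have h2 := hXY p
    rw [hρ, div_mul_eq_mul_div, div_le_iff₀ hθ']
    nlinarith
  have hXY' : ∀ p, thr ≤ I.utilityUpTo S p → ρ * I.utilityUpTo X p ≤ I.utilityUpTo Y p := by
    intro p hp
    have h1 := (hbal p hp).2
    have h2 := hXY p
    rw [hρ, div_mul_eq_mul_div, div_le_iff₀ hθ']
    nlinarith
  have hXS : ∀ p, I.utilityUpTo X p ≤ I.utilityUpTo S p := fun p => by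
    linarith [hXY p, I.utilityUpTo_nonneg Y p]
  have ht0 := hf.t_nonneg
  have ht1 := hf.t_le_one
  have hp1 := hf.p₁_nonneg
  have hp2 := hp1.trans hf.p₁_le_p₂
  have hUX : ∀ p, 0 ≤ I.utilityUpTo X p := I.utilityUpTo_nonneg X
  have hUY : ∀ p, 0 ≤ I.utilityUpTo Y p := I.utilityUpTo_nonneg Y
  have hserve0 : 0 ≤ I.serve ord Y (I.truncate s f) L := I.serve_nonneg ord Y L ht0
  have hle : (I.truncate s f).p₁ ≤ (I.truncate s f).p₂ := by
    unfold truncate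
    dsimp only
    split_ifs
    · linarith
    · exact hf.p₁_le_p₂
  have hpay0 : ∀ i ∈ Y, 0 ≤ (I.truncate s f).pay (I.γ i) := by
    intro i _
    rw [TwoStepRule.pay_eq hle]
    have hγ := I.γ_nonneg i
    refine add_nonneg (mul_nonneg (by change 0 ≤ 1 - f.t; linarith) ?_) (mul_nonneg ht0 ?_)
    · split_ifs with h
      · exact hγ.trans h
      · exact le_rfl
    · split_ifs with h
      · exact hγ.trans h
      · exact le_rfl
  have hserve : (1 - f.t) * ((I.truncate s f).p₁ * I.utilityUpTo Y (I.truncate s f).p₁) +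
      f.t * (f.p₂ * I.utilityUpTo Y f.p₂) ≤ L → I.serve ord Y (I.truncate s f) L =
      (1 - f.t) * I.utilityUpTo Y (I.truncate s f).p₁ + f.t * I.utilityUpTo Y f.p₂ := by
    intro hL
    rw [I.serve_eq ord Y hpay0 ((I.sum_pay_mul Y hle).trans_le hL), I.sum_alloc_mul Y hle]
    rfl
  -- Payments on `Y` exceed those on `X` by at most the factor `1 / ρ`. The gap between `B` and `L`
  -- allows for it, so the payment limit never binds.
  have hq : ∀ p, 0 ≤ p → thr ≤ I.utilityUpTo S p →
      ρ * (p * I.utilityUpTo Y p) ≤ p * I.utilityUpTo X p := fun p hp h => by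
    have := mul_le_mul_of_nonneg_left (hYX p h) hp
    linarith
  -- If even `p₂` reaches too little utility, the claimed lower bound is not positive.
  rcases lt_or_ge (I.utilityUpTo S f.p₂) thr with h2 | h2
  · have h1 := I.utilityUpTo_mono X hf.p₁_le_p₂
    have h3 := hXS f.p₂
    refine le_trans (mul_nonpos_of_nonneg_of_nonpos hρ0.le ?_) hserve0
    nlinarith
  · have h2' := hq _ hp2 h2
    have h2'' := hXY' _ h2
    rcases lt_or_ge (I.utilityUpTo S f.p₁) thr with h1 | h1
    -- Balance may fail at `p₁`, so the rule is truncated there, at a loss of at most `thr`; balance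
    -- still holds at `p₂`.
    · have e : (I.truncate s f).p₁ = -1 := if_pos h1
      have e0 : I.utilityUpTo Y (-1) = 0 := I.utilityUpTo_of_neg Y (by norm_num)
      rw [e, e0] at hserve
      have hpl := hf.pay_le
      rw [hserve]
      · have h3 := hXS f.p₁
        have h4 : (1 - f.t) * I.utilityUpTo X f.p₁ ≤ thr := by nlinarith [hUX f.p₁]
        nlinarith
      · have h5 : 0 ≤ (1 - f.t) * (f.p₁ * I.utilityUpTo X f.p₁) :=
          mul_nonneg (by linarith) (mul_nonneg hp1 (hUX _))
        have h6 : ρ * (f.t * (f.p₂ * I.utilityUpTo Y f.p₂)) ≤ ρ * L := by nlinarith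
        have := le_of_mul_le_mul_left h6 hρ0
        linarith
    · have e : (I.truncate s f).p₁ = f.p₁ := if_neg (not_lt.2 h1)
      rw [e] at hserve
      have hpl := hf.pay_le
      have h1' := hq _ hp1 h1
      have h1'' := hXY' _ h1
      have hthr0 : 0 ≤ thr := div_nonneg (Finset.sum_nonneg fun i _ => (I.u_pos i).le)
        (mul_nonneg s.η_pos.le (Nat.cast_nonneg _))
      rw [hserve]
      · have := mul_nonneg hρ0.le hthr0
        have := mul_le_mul_of_nonneg_left h1'' (show 0 ≤ 1 - f.t by linarith)
        have := mul_le_mul_of_nonneg_left h2'' ht0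
        nlinarith
      · have := mul_le_mul_of_nonneg_left h1' (show 0 ≤ 1 - f.t by linarith)
        have := mul_le_mul_of_nonneg_left h2' ht0
        have h6 : ρ * ((1 - f.t) * (f.p₁ * I.utilityUpTo Y f.p₁) +
            f.t * (f.p₂ * I.utilityUpTo Y f.p₂)) ≤ ρ * L := by nlinarith
        exact le_of_mul_le_mul_left h6 hρ0

/-- The optimal utility on one part of a balanced split is nearly half of what is possible. -/
lemma half_greedy_le (T X : Finset (Fin I.n)) {θ thr : ℝ} (hθ : 0 < θ) (hθ1 : θ ≤ 1 / 2)
    (hthr : 0 ≤ thr)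
    (hbal : ∀ p, thr ≤ I.utilityUpTo Tᶜ p → θ * I.utilityUpTo Tᶜ p ≤ I.utilityUpTo X p ∧
      I.utilityUpTo X p ≤ (1 - θ) * I.utilityUpTo Tᶜ p)
    {B d : ℝ} (hB : 0 ≤ B) (hd0 : 0 ≤ d) (hd1 : d < 1) {f : TwoStepRule}
    (hf : I.IsOptimalRule X ((1 - d) * B / 2) f) :
    θ / (1 - θ) * (1 - d) / 2 * (I.greedyUtility B - ∑ i ∈ T, I.u i - thr) ≤
      (1 - f.t) * I.utilityUpTo X f.p₁ + f.t * I.utilityUpTo X f.p₂ := by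
  have hθ' : 0 < 1 - θ := by linarith
  obtain ⟨l, hl, hline⟩ := hf.multiplier
  set g := (1 - f.t) * I.utilityUpTo X f.p₁ + f.t * I.utilityUpTo X f.p₂ with hg
  set BX := (1 - d) * B / 2 with hBX
  have hBX0 : 0 ≤ BX := div_nonneg (mul_nonneg (by linarith) hB) (by norm_num)
  have hκ : l * BX ≤ g := by
    have := hline 0 le_rfl
    simp only [mul_zero, sub_zero, mul_one] at this
    linarith [I.utilityUpTo_nonneg X 0]
  have hopt := I.greedy_isOptimalRule Finset.univ hB
  rw [I.greedyUtility_eq hB]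
  generalize I.greedy Finset.univ B = F at hopt
  have ht0 := hopt.t_nonneg
  have ht1 := hopt.t_le_one
  have hp1 := hopt.p₁_nonneg
  have hp2 := hp1.trans hopt.p₁_le_p₂
  have hsplit : ∀ p, I.utilityUpTo T p + I.utilityUpTo Tᶜ p = I.utilityUpTo Finset.univ p := by
    intro p
    have := I.utilityUpTo_add_sdiff (Finset.subset_univ T) p
    rwa [← Finset.compl_eq_univ_sdiff] at this
  have hT : ∀ p, I.utilityUpTo T p ≤ ∑ i ∈ T, I.u i := fun p =>
    Finset.sum_le_sum_of_subset_of_nonneg (Finset.filter_subset _ _) fun i _ _ => (I.u_pos i).le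
  -- at each price, the truncated utility of the sellers outside of `T` satisfies the line of `X`
  set b : ℝ → ℝ := fun p => if thr ≤ I.utilityUpTo Tᶜ p then I.utilityUpTo Tᶜ p else 0 with hb
  have hb0 : ∀ p, 0 ≤ b p := by
    intro p; simp only [hb]; split_ifs
    exacts [I.utilityUpTo_nonneg _ _, le_rfl]
  have hb1 : ∀ p, I.utilityUpTo Tᶜ p ≤ b p + thr := by
    intro p; simp only [hb]; split_ifs with h
    · linarith
    · linarith
  have hb2 : ∀ p, b p ≤ I.utilityUpTo Finset.univ p := by
    intro p; have := hsplit p; have := I.utilityUpTo_nonneg T p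
    simp only [hb]; split_ifs
    · linarith
    · exact I.utilityUpTo_nonneg _ _
  -- The multiplier inequality of `X`, with its utility estimated by balance from below on the left
  -- and from above in the payment.
  have hb3 : ∀ p, 0 ≤ p → θ * b p ≤ g - l * BX + l * ((1 - θ) * (p * b p)) := by
    intro p hp; simp only [hb]; split_ifs with h
    · obtain ⟨h1, h2⟩ := hbal p h
      have h3 := hline p hp
      have h4 : l * (p * I.utilityUpTo X p) ≤ l * (p * ((1 - θ) * I.utilityUpTo Tᶜ p)) :=
        mul_le_mul_of_nonneg_left (mul_le_mul_of_nonneg_left h2 hp) hl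
      nlinarith
    · simp; linarith
  have h1 := hb3 _ hp1
  have h2 := hb3 _ hp2
  have hsum : (1 - F.t) * (F.p₁ * b F.p₁) + F.t * (F.p₂ * b F.p₂) ≤ B := by
    refine le_trans (add_le_add ?_ ?_) hopt.pay_le
    · exact mul_le_mul_of_nonneg_left (mul_le_mul_of_nonneg_left (hb2 _) hp1) (by linarith)
    · exact mul_le_mul_of_nonneg_left (mul_le_mul_of_nonneg_left (hb2 _) hp2) ht0
  set b' := (1 - F.t) * b F.p₁ + F.t * b F.p₂ with hb'
  -- Mix the inequalities at the two prices of Greedy on the whole market, which spends at most `B`.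
  have h3 : θ * b' ≤ g - l * BX + l * ((1 - θ) * B) := by
    have e1 := mul_le_mul_of_nonneg_left h1 (show 0 ≤ 1 - F.t by linarith)
    have e2 := mul_le_mul_of_nonneg_left h2 ht0
    have e3 := mul_le_mul_of_nonneg_left hsum (mul_nonneg hl hθ'.le)
    nlinarith
  -- This factor turns `(1 - θ) * B` into the budget of `X`, and the multiplier cancels.
  have h4 : θ * b' * ((1 - d) / (2 * (1 - θ))) ≤ g := by
    have e1 : l * ((1 - θ) * B) * ((1 - d) / (2 * (1 - θ))) = l * BX := by
      rw [hBX]; field_simp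
    have e2 : (1 - d) / (2 * (1 - θ)) ≤ 1 := (div_le_one (by linarith)).2 (by linarith)
    have e3 : 0 ≤ (1 - d) / (2 * (1 - θ)) := div_nonneg (by linarith) (by linarith)
    have e4 := mul_le_mul_of_nonneg_right h3 e3
    have e5 : (g - l * BX) * ((1 - d) / (2 * (1 - θ))) ≤ g - l * BX :=
      mul_le_of_le_one_right (by linarith) e2
    linarith
  have h5 : (1 - F.t) * I.utilityUpTo Finset.univ F.p₁ + F.t * I.utilityUpTo Finset.univ F.p₂ -
      ∑ i ∈ T, I.u i - thr ≤ b' := by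
    have e1 := hsplit F.p₁
    have e2 := hsplit F.p₂
    have e3 := hT F.p₁
    have e4 := hT F.p₂
    have e5 := hb1 F.p₁
    have e6 := hb1 F.p₂
    nlinarith
  calc _ ≤ θ / (1 - θ) * (1 - d) / 2 * b' := mul_le_mul_of_nonneg_left h5
        (div_nonneg (mul_nonneg (div_nonneg hθ.le hθ'.le) (by linarith)) (by norm_num))
    _ = θ * b' * ((1 - d) / (2 * (1 - θ))) := by field_simp
    _ ≤ g := h4

/-- On a balanced split, Random-Sampling-Greedy nearly achieves the utility of Greedy. -/
lemma greedy_le_splitUtility (s : SamplingParameters) (ord : Equiv.Perm (Fin I.n)) {B θ : ℝ}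
    (hB : 0 ≤ B) (hθ : 0 < θ) (hθ1 : θ ≤ 1 / 2) (hε : 1 - s.δ₁ ≤ θ / (1 - θ) * (1 - s.ε₁))
    (hC : 3 / (s.η * s.C) ≤ s.δ₁) {X : Finset (Fin I.n)} (hX : X ⊆ (I.top s.C)ᶜ)
    (hbal : I.Balanced (I.top s.C)ᶜ θ ((∑ i ∈ I.top s.C, I.u i) / (s.η * s.C)) X) :
    (θ / (1 - θ)) ^ 2 * (1 - s.δ₁) * I.greedyUtility B ≤
      I.splitUtility s ord B X ((I.top s.C)ᶜ \ X) := by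
  have hθ' : 0 < 1 - θ := by linarith
  have hρ0 : 0 < θ / (1 - θ) := div_pos hθ hθ'
  have hρ1 : θ / (1 - θ) ≤ 1 := (div_le_one hθ').2 (by linarith)
  have hd := s.δ₁_mem
  have hBX : 0 ≤ (1 - s.δ₁) * B / 2 := div_nonneg (mul_nonneg (by linarith [hd.2]) hB) (by norm_num)
  set Y := (I.top s.C)ᶜ \ X with hY
  have hXY := fun p => I.utilityUpTo_add_sdiff hX p
  have hu0 : 0 ≤ ∑ i ∈ I.top s.C, I.u i := Finset.sum_nonneg fun i _ => (I.u_pos i).le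
  set uT := ∑ i ∈ I.top s.C, I.u i with huT
  set thr := uT / (s.η * s.C) with hthr
  have hthr0 : 0 ≤ thr := div_nonneg hu0 (mul_nonneg s.η_pos.le (Nat.cast_nonneg _))
  -- Of the utility `uT` bought outright, `(1 - δ₁) * uT` replaces what the halves cannot see. The
  -- rest covers three losses of `thr`: one per truncation, and one in comparing the two halves with
  -- the whole market.
  have hthr1 : 3 * thr ≤ s.δ₁ * uT := by
    have := mul_le_mul_of_nonneg_right hC hu0
    calc 3 * thr = 3 / (s.η * s.C) * uT := by rw [hthr]; ring
      _ ≤ _ := this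
  have hL : (1 - s.δ₁) * B / 2 ≤ θ / (1 - θ) * ((1 - s.ε₁) * B / 2) := by
    have := mul_le_mul_of_nonneg_right hε hB
    linarith
  have oX := I.greedy_isOptimalRule X hBX
  have oY := I.greedy_isOptimalRule Y hBX
  have s1 := I.serve_truncate_ge s ord hθ hθ1 hXY hbal oX hL
  have s2 := I.serve_truncate_ge s ord hθ hθ1 (fun p => by rw [add_comm]; exact hXY p)
    (fun p hp => (hbal p hp).symm) oY hL
  have g1 := I.half_greedy_le (I.top s.C) X hθ hθ1 hthr0
    (fun p hp => ⟨(hbal p hp).1, by linarith [(hbal p hp).2, hXY p]⟩) hB hd.1.le hd.2 oX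
  have g2 := I.half_greedy_le (I.top s.C) Y hθ hθ1 hthr0
    (fun p hp => ⟨(hbal p hp).2, by linarith [(hbal p hp).1, hXY p]⟩) hB hd.1.le hd.2 oY
  rw [← huT, ← hthr] at s1 s2
  unfold splitUtility
  rw [← huT]
  set gX := (1 - (I.greedy X ((1 - s.δ₁) * B / 2)).t) *
    I.utilityUpTo X (I.greedy X ((1 - s.δ₁) * B / 2)).p₁ +
    (I.greedy X ((1 - s.δ₁) * B / 2)).t * I.utilityUpTo X (I.greedy X ((1 - s.δ₁) * B / 2)).p₂
  set gY := (1 - (I.greedy Y ((1 - s.δ₁) * B / 2)).t) *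
    I.utilityUpTo Y (I.greedy Y ((1 - s.δ₁) * B / 2)).p₁ +
    (I.greedy Y ((1 - s.δ₁) * B / 2)).t * I.utilityUpTo Y (I.greedy Y ((1 - s.δ₁) * B / 2)).p₂
  set ρ := θ / (1 - θ)
  set g := I.greedyUtility B
  have e1 := mul_le_mul_of_nonneg_left g1 hρ0.le
  have e2 := mul_le_mul_of_nonneg_left g2 hρ0.le
  have c0 : 0 ≤ ρ ^ 2 * (1 - s.δ₁) := mul_nonneg (sq_nonneg _) (by linarith [hd.2])
  have c1 : ρ ^ 2 * (1 - s.δ₁) ≤ 1 - s.δ₁ :=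
    mul_le_of_le_one_left (by linarith [hd.2]) (pow_le_one₀ hρ0.le hρ1)
  have e3 : ρ ^ 2 * (1 - s.δ₁) * thr ≤ thr := mul_le_of_le_one_left hthr0 (by linarith [hd.1])
  have e4 : ρ ^ 2 * (1 - s.δ₁) * uT ≤ (1 - s.δ₁) * uT := mul_le_mul_of_nonneg_right c1 hu0
  have e5 : ρ * thr ≤ thr := mul_le_of_le_one_left hthr0 hρ1
  nlinarith

lemma splitUtility_nonneg (s : SamplingParameters) (ord : Equiv.Perm (Fin I.n)) {B : ℝ} (hB : 0 ≤ B)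
    (X Y : Finset (Fin I.n)) : 0 ≤ I.splitUtility s ord B X Y := by
  have hBX : 0 ≤ (1 - s.δ₁) * B / 2 :=
    div_nonneg (mul_nonneg (by linarith [s.δ₁_mem.2]) hB) (by norm_num)
  exact add_nonneg (add_nonneg (Finset.sum_nonneg fun i _ => (I.u_pos i).le)
    (I.serve_nonneg ord _ _ (I.greedy_isOptimalRule X hBX).t_nonneg))
    (I.serve_nonneg ord _ _ (I.greedy_isOptimalRule Y hBX).t_nonneg)

theorem greedy_le_samplingUtility (s : SamplingParameters) (ord : (n : ℕ) → Equiv.Perm (Fin n))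
    {B α : ℝ} (hB : 0 ≤ B) (hα : 0 < α) (hα1 : α < 1 / 4)
    (hε : 1 - s.δ₁ ≤ (1 / 2 - 2 * α) / (1 - (1 / 2 - 2 * α)) * (1 - s.ε₁))
    (hC : 3 / (s.η * s.C) ≤ s.δ₁) :
    (1 - s.η / (2 * α ^ 3)) *
      (((1 / 2 - 2 * α) / (1 - (1 / 2 - 2 * α))) ^ 2 * (1 - s.δ₁) * I.greedyUtility B) ≤
      samplingUtility s ord I B := by
  classical
  set S := (I.top s.C)ᶜ with hS
  set θ := 1 / 2 - 2 * α with hθ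
  set uT := ∑ i ∈ I.top s.C, I.u i with huT
  have huT0 : 0 < uT := I.sum_top_pos s.C_pos
  have hC0 : (0 : ℝ) < s.C := by exact_mod_cast s.C_pos
  have hη := s.η_pos
  set thr := uT / (s.η * s.C) with hthr
  have hthr0 : 0 < thr := by positivity
  set G := (θ / (1 - θ)) ^ 2 * (1 - s.δ₁) * I.greedyUtility B with hG
  have hG0 : 0 ≤ G := mul_nonneg (mul_nonneg (sq_nonneg _) (by linarith [s.δ₁_mem.2]))
    (I.greedyUtility_nonneg hB)
  have hbad := I.card_not_balanced_le S (w := uT / s.C) (thr := thr) (α := α)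
    (fun i hi => by
      rw [le_div_iff₀ hC0, mul_comm]
      exact I.mul_u_le_sum_top (Finset.mem_compl.1 hi))
    (by positivity) hthr0 hα (by linarith)
  -- Utilities are at most `uT / C` and the threshold is `uT / (η * C)`, so the failure probability
  -- does not depend on the market.
  have hw : uT / s.C / (2 * α ^ 3 * thr) = s.η / (2 * α ^ 3) := by
    rw [hthr]; field_simp
  rw [hw, ← hθ] at hbad
  have h2 : (0 : ℝ) < 2 ^ S.card := by positivity
  unfold samplingUtility
  rw [le_div_iff₀ h2]
  have hcard := Finset.card_filter_add_card_filter_not (s := S.powerset)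
    (fun X => I.Balanced S θ thr X)
  rw [Finset.card_powerset] at hcard
  have hcard' : ((S.powerset.filter fun X => I.Balanced S θ thr X).card : ℝ) +
      (S.powerset.filter fun X => ¬I.Balanced S θ thr X).card = 2 ^ S.card := by
    exact_mod_cast hcard
  calc (1 - s.η / (2 * α ^ 3)) * G * 2 ^ S.card
      = (2 ^ S.card - 2 ^ S.card * (s.η / (2 * α ^ 3))) * G := by ring
    _ ≤ (S.powerset.filter fun X => I.Balanced S θ thr X).card * G :=
        mul_le_mul_of_nonneg_right (by linarith) hG0
    _ = ∑ X ∈ S.powerset.filter fun X => I.Balanced S θ thr X, G := by simp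
    _ ≤ ∑ X ∈ S.powerset.filter fun X => I.Balanced S θ thr X,
          I.splitUtility s (ord I.n) B X (S \ X) := by
        refine Finset.sum_le_sum fun X hX => ?_
        obtain ⟨hX1, hX2⟩ := Finset.mem_filter.1 hX
        exact I.greedy_le_splitUtility s (ord I.n) hB (by rw [hθ]; linarith) (by rw [hθ]; linarith)
          hε hC (Finset.mem_powerset.1 hX1) hX2
    _ ≤ _ := Finset.sum_le_sum_of_subset_of_nonneg (Finset.filter_subset _ _)
        fun X _ _ => I.splitUtility_nonneg s _ hB _ _

end Market

theorem exists_samplingParameters {ε : ℝ} (hε : 0 < ε) : ∃ s : SamplingParameters,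
    ∀ (ord : (n : ℕ) → Equiv.Perm (Fin n)) (I : Market) (B : ℝ), 0 ≤ B →
      (1 - ε) * I.greedyUtility B ≤ Market.samplingUtility s ord I B := by
  set e := min ε (1 / 2) with he
  have he0 : 0 < e := lt_min hε (by norm_num)
  have he1 : e ≤ 1 / 2 := min_le_right _ _
  have heε : e ≤ ε := min_le_left _ _
  -- With these choices `ρ ≥ 1 - e / 8` and the failure probability is at most `e / 4`. Unbalanced
  -- splits, the factor `ρ ^ 2` and the cut `δ₁` of the budgets then cost a factor of at least `1 -
  -- e / 4` each.
  set α := e / 64 with hα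
  have hα0 : 0 < α := by positivity
  set η := e / 2 * α ^ 3 with hη
  have hη0 : 0 < η := by positivity
  obtain ⟨C, hC⟩ := exists_nat_gt (3 / (η * (e / 4)))
  have hC0 : (0 : ℝ) < C := lt_trans (by positivity) hC
  set s : SamplingParameters := ⟨e / 8, e / 4, η, C, ⟨by positivity, by linarith⟩,
    ⟨by positivity, by linarith⟩, hη0, by exact_mod_cast hC0⟩ with hs
  refine ⟨s, fun ord I B hB => ?_⟩
  have hθ : 1 - e / 8 ≤ (1 / 2 - 2 * α) / (1 - (1 / 2 - 2 * α)) := by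
    rw [le_div_iff₀ (by linarith), hα]; nlinarith
  have h := I.greedy_le_samplingUtility s ord hB hα0 (by rw [hα]; linarith)
    (by
      change 1 - e / 4 ≤ _ * (1 - e / 8)
      have := mul_le_mul_of_nonneg_right hθ (show 0 ≤ 1 - e / 8 by linarith)
      nlinarith)
    (by
      change 3 / (η * C) ≤ e / 4
      rw [div_lt_iff₀ (by positivity)] at hC
      rw [div_le_iff₀ (by positivity)]
      nlinarith)
  refine le_trans ?_ h
  have hg := I.greedyUtility_nonneg hB
  have e1 : s.η / (2 * α ^ 3) = e / 4 := by
    change e / 2 * α ^ 3 / (2 * α ^ 3) = e / 4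
    field_simp; norm_num
  rw [e1]
  change _ ≤ (1 - e / 4) * (_ ^ 2 * (1 - e / 4) * _)
  set ρ := (1 / 2 - 2 * α) / (1 - (1 / 2 - 2 * α))
  have e2 : 1 - e / 4 ≤ ρ ^ 2 := by nlinarith
  have e3 : (1 - e / 4) * (1 - e / 4) * (1 - e / 4) ≤ (1 - e / 4) * (ρ ^ 2 * (1 - e / 4)) := by
    have : 0 ≤ (1 - e / 4) * (1 - e / 4) := mul_self_nonneg _
    nlinarith
  have e4 : 1 - ε ≤ (1 - e / 4) * (1 - e / 4) * (1 - e / 4) := by nlinarith [pow_pos he0 2, pow_pos he0 3]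
  calc (1 - ε) * I.greedyUtility B ≤ (1 - e / 4) * (ρ ^ 2 * (1 - e / 4)) * I.greedyUtility B :=
        mul_le_mul_of_nonneg_right (e4.trans e3) hg
    _ = _ := by ring

/-- Random-Sampling-Greedy is worst-case optimal up to an arbitrarily small loss. -/
theorem exists_smoothedRatio_le_sampling (ε : ℝ) (hε : 0 < ε) : ∃ s : SamplingParameters,
    ∀ (ord : (n : ℕ) → Equiv.Perm (Fin n)) (m : ℕ) (D : BudgetDistribution (m + 1)) (δ : ℝ),
      0 < δ → δ ≤ s.ε₁ / s.C → ∀ P : GeneralMechanism, P.Feasible D δ →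
        (1 - ε) * smoothedRatio D δ P.utility ≤
          smoothedRatio D δ (Market.samplingUtility s ord) := by
  -- Capping `ε` at `1` keeps the factor `1 - ε` nonnegative, so that inequalities can be multiplied
  -- by it.
  obtain ⟨s, hs⟩ := exists_samplingParameters (lt_min hε one_pos)
  refine ⟨s, fun ord m D δ hδ _ P hP => ?_⟩
  have hε1 : 0 ≤ 1 - min ε 1 := by linarith [min_le_right ε 1]
  have : Fact (0 ≤ δ) := ⟨hδ.le⟩
  have h0 : 0 ≤ smoothedRatio D δ P.utility :=
    le_ciInf fun I => Market.expectedRatio_nonneg fun k => hP.utility_nonneg I.2 k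
  refine le_ciInf fun I => ?_
  calc (1 - ε) * smoothedRatio D δ P.utility ≤ (1 - min ε 1) * smoothedRatio D δ P.utility :=
        mul_le_mul_of_nonneg_right (by linarith [min_le_left ε 1]) h0
    _ ≤ (1 - min ε 1) * I.1.expectedRatio D Market.greedyUtility :=
        mul_le_mul_of_nonneg_left (I.1.smoothedRatio_le_expectedRatio_greedy hδ hP) hε1
    _ ≤ _ := by
        unfold Market.expectedRatio
        rw [Finset.mul_sum]
        refine Finset.sum_le_sum fun k _ => ?_
        rw [mul_left_comm, ← mul_div_assoc]
        exact mul_le_mul_of_nonneg_left (div_le_div_of_nonneg_right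
          (hs ord I.1 _ (D.budget_pos k).le) (I.1.opt_pos (D.budget_pos k)).le) (D.prob_pos k).le

end

/-! ### Bayesian markets and the best utility of mechanisms -/

section

namespace BayesianMarket

variable (I : BayesianMarket)

instance : IsProbabilityMeasure I.μ := I.isProb

instance : IsProbabilityMeasure I.law := by unfold law; infer_instance

lemma n_cast_pos : (0 : ℝ) < I.n := by exact_mod_cast I.n_pos

lemma nu_pos : 0 < I.n * I.u := mul_pos I.n_cast_pos I.u_pos

/-! ### The distribution function -/

lemma F_eq (c : ℝ) : I.F c = I.μ.real (Set.Iic c) := cdf_eq_real I.μ c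

lemma F_nonneg (c : ℝ) : 0 ≤ I.F c := cdf_nonneg _ _

lemma F_le_one (c : ℝ) : I.F c ≤ 1 := cdf_le_one _ _

lemma F_mono : Monotone I.F := monotone_cdf _

lemma ae_nonneg : ∀ᵐ c ∂I.μ, 0 ≤ c := by
  rw [ae_iff]; simpa [Set.Iio] using I.nonneg

/-- The distribution function of the total cost of the sellers. -/
def G (y : ℝ) : ℝ := I.F (y / I.n)

lemma G_nonneg (y : ℝ) : 0 ≤ I.G y := I.F_nonneg _

lemma G_le_one (y : ℝ) : I.G y ≤ 1 := I.F_le_one _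

lemma G_mono : Monotone I.G := fun _ _ h =>
  I.F_mono (div_le_div_of_nonneg_right h I.n_cast_pos.le)

lemma G_continuousOn : ContinuousOn I.G (Set.Ici 0) :=
  I.continuous_cdf.comp (by fun_prop) fun _ hy => div_nonneg hy I.n_cast_pos.le

lemma G_tendsto : Filter.Tendsto I.G Filter.atTop (nhds 1) :=
  (tendsto_cdf_atTop I.μ).comp (Filter.tendsto_id.atTop_div_const I.n_cast_pos)

lemma G_mul (c : ℝ) : I.G (I.n * c) = I.F c := by
  unfold G; rw [mul_div_cancel_left₀ _ I.n_cast_pos.ne']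

lemma G_eq (y : ℝ) : I.G y = I.μ.real {c | I.n * c ≤ y} := by
  unfold G
  rw [F_eq]
  congr 1
  ext c
  simp only [Set.mem_Iic, Set.mem_ofPred_eq]
  rw [le_div_iff₀ I.n_cast_pos, mul_comm]

lemma G_intervalIntegrable (a b : ℝ) : IntervalIntegrable I.G volume a b :=
  I.G_mono.intervalIntegrable

/-! ### Mechanisms -/

lemma ae_law_nonneg : ∀ᵐ c ∂I.law, ∀ i, 0 ≤ c i := by
  refine ae_all_iff.2 fun i => ?_
  exact (Measure.quasiMeasurePreserving_eval (fun _ : Fin I.n => I.μ) i).ae I.ae_nonneg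

lemma measurable_perUtility : Measurable I.perUtility :=
  measurable_pi_lambda _ fun i => (measurable_pi_apply i).div_const _

variable {I} {B : ℝ} {M : Mechanism I.n}

lemma Feasible.alloc_mem (h : I.Feasible B M) (i : Fin I.n) :
    ∀ᵐ c ∂I.law, M.alloc (I.perUtility c) i ∈ Set.Icc (0 : ℝ) 1 := by
  filter_upwards [I.ae_law_nonneg] with c hc
  exact h.admissible.alloc_mem _ (fun j => div_nonneg (hc j) I.u_pos.le) i

lemma Feasible.integrable_alloc (h : I.Feasible B M) (i : Fin I.n) :
    Integrable (fun c => M.alloc (I.perUtility c) i) I.law := by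
  refine Integrable.of_bound
    (((h.measurable_alloc i).comp I.measurable_perUtility).aestronglyMeasurable) 1 ?_
  filter_upwards [h.alloc_mem i] with c hc
  rw [Real.norm_eq_abs, abs_of_nonneg hc.1]; exact hc.2

lemma Feasible.utility_eq (h : I.Feasible B M) :
    I.utility M = (∑ i, ∫ c, M.alloc (I.perUtility c) i ∂I.law) * I.u := by
  unfold utility
  rw [integral_finsetSum _ fun i _ => (h.integrable_alloc i).mul_const _, Finset.sum_mul]
  simp_rw [integral_mul_const]

lemma Feasible.pay_le (h : I.Feasible B M) :
    (∑ i, ∫ c, M.pay (I.perUtility c) i ∂I.law) * I.u ≤ B := by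
  have := h.budget
  rw [integral_finsetSum _ fun i _ => (h.integrable_pay i).mul_const _] at this
  simp_rw [integral_mul_const] at this
  rwa [← Finset.sum_mul] at this

/-- Lagrangian bound on the utility of mechanisms. -/
theorem Feasible.utility_le (h : I.Feasible B M) {κ l : ℝ} (hl : 0 ≤ l)
    (hG : ∀ y, 0 ≤ y → I.G y * (1 - l * y) ≤ κ) : I.utility M ≤ I.n * I.u * (κ + l * B) := by
  have hu := I.u_pos
  have hn := I.n_cast_pos
  -- Costs are nonnegative only almost surely, but the one-seller bound asks for it everywhere, so
  -- they are clamped.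
  set c : ℝ → ℝ := fun z => max z 0 / I.u with hc
  have hcm : Measurable c := by fun_prop
  have hc0 : ∀ z, 0 ≤ c z := fun z => div_nonneg (le_max_right _ _) hu.le
  have hae : ∀ᵐ σ ∂I.law, (fun j => c (σ j)) = I.perUtility σ := by
    filter_upwards [I.ae_law_nonneg] with σ hσ
    ext j
    simp [hc, perUtility, max_eq_left (hσ j)]
  have hF : ∀ r, 0 ≤ r → I.μ.real {z | c z ≤ r} * (1 - l * (I.n * I.u) * r) ≤ κ := by
    intro r hr
    have h1 : I.μ.real {z | c z ≤ r} = I.G (I.n * I.u * r) := by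
      rw [mul_assoc, G_mul, F_eq]
      refine measureReal_congr ?_
      filter_upwards [I.ae_nonneg] with z hz
      refine propext ?_
      change max z 0 / I.u ≤ r ↔ z ≤ I.u * r
      rw [max_eq_left hz, div_le_iff₀ hu, mul_comm]
    rw [h1]
    have := hG (I.n * I.u * r) (by positivity)
    linarith
  have hcm' : Measurable fun σ : Fin I.n → ℝ => fun j => c (σ j) :=
    measurable_pi_lambda _ fun j => hcm.comp (measurable_pi_apply j)
  have hi : ∀ i, ∫ σ, M.alloc (I.perUtility σ) i ∂I.law ≤
      κ + l * (I.n * I.u) * ∫ σ, M.pay (I.perUtility σ) i ∂I.law := by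
    intro i
    have e1 : ∫ σ, M.alloc (I.perUtility σ) i ∂I.law =
        ∫ σ, M.alloc (fun j => c (σ j)) i ∂I.law := by
      refine integral_congr_ae ?_
      filter_upwards [hae] with σ hσ
      rw [hσ]
    have e2 : ∫ σ, M.pay (I.perUtility σ) i ∂I.law = ∫ σ, M.pay (fun j => c (σ j)) i ∂I.law := by
      refine integral_congr_ae ?_
      filter_upwards [hae] with σ hσ
      rw [hσ]
    rw [e1, e2]
    refine h.admissible.integral_alloc_le (fun _ => hu) (μ := I.μ) hcm (D := Set.Ici 0)
      (fun z hz => hz) hc0 (fun γ hγ => hγ) i ((h.measurable_alloc i).comp hcm')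
      ((h.measurable_pay i).comp hcm') ?_ (by positivity) hF
    refine (h.integrable_pay i).congr ?_
    filter_upwards [hae] with σ hσ
    rw [hσ]
  rw [h.utility_eq]
  have hsum : ∑ i, ∫ σ, M.alloc (I.perUtility σ) i ∂I.law ≤
      I.n * κ + l * (I.n * I.u) * ∑ i, ∫ σ, M.pay (I.perUtility σ) i ∂I.law := by
    refine (Finset.sum_le_sum fun i _ => hi i).trans (le_of_eq ?_)
    rw [Finset.sum_add_distrib, ← Finset.mul_sum]
    simp
  have hp := h.pay_le
  set E := ∑ i, ∫ σ, M.pay (I.perUtility σ) i ∂I.law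
  have := mul_le_mul_of_nonneg_right hsum hu.le
  have := mul_le_mul_of_nonneg_left hp (show 0 ≤ l * (I.n * I.u) by positivity)
  nlinarith

lemma Feasible.mono {B' : ℝ} (h : I.Feasible B M) (hB : B ≤ B') : I.Feasible B' M :=
  ⟨h.admissible, h.measurable_alloc, h.measurable_pay, h.integrable_pay, h.budget.trans hB⟩

lemma cutoff_admissible (n : ℕ) {u : ℝ} (hu : 0 < u) (r : ℝ) (S : Set (Fin n → ℝ)) :
    (Mechanism.cutoff n r).AdmissibleOn (fun _ => u) S where
  alloc_mem γ _ i := by unfold Mechanism.cutoff; dsimp only; split_ifs <;> norm_num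
  truthful γ _ i z _ := by
    simp only [Mechanism.profit, Mechanism.cutoff, Function.update_self]
    split_ifs <;> nlinarith
  rational γ _ i := by
    simp only [Mechanism.profit, Mechanism.cutoff]
    split_ifs <;> nlinarith

lemma integral_cutoff (I : BayesianMarket) (r a : ℝ) (i : Fin I.n) :
    Integrable (fun c => if I.perUtility c i ≤ r then a else 0) I.law ∧
    ∫ c, (if I.perUtility c i ≤ r then a else 0) ∂I.law = a * I.F (I.u * r) := by
  have hu := I.u_pos
  have hm : MeasurableSet {c : Fin I.n → ℝ | I.perUtility c i ≤ r} :=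
    measurableSet_le ((measurable_pi_apply i).comp I.measurable_perUtility) measurable_const
  have e : (fun c => if I.perUtility c i ≤ r then a else 0) =
      Set.indicator {c : Fin I.n → ℝ | I.perUtility c i ≤ r} fun _ => a := by
    ext c; simp [Set.indicator]
  rw [e]
  refine ⟨(integrable_const a).indicator hm, ?_⟩
  rw [integral_indicator_const a hm, smul_eq_mul, mul_comm, F_eq]
  congr 1
  have h2 := (measurePreserving_eval (fun _ : Fin I.n => I.μ) i).measureReal_preimage
    (s := Set.Iic (I.u * r)) measurableSet_Iic.nullMeasurableSet
  rw [← h2]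
  congr 1
  ext c
  simp only [Set.mem_ofPred_eq, Set.mem_preimage, Set.mem_Iic, Function.eval, perUtility]
  rw [div_le_iff₀ hu, mul_comm]

lemma cutoff_feasible (I : BayesianMarket) {r B : ℝ}
    (hB : I.n * (I.u * r) * I.F (I.u * r) ≤ B) : I.Feasible B (Mechanism.cutoff I.n r) where
  admissible := cutoff_admissible _ I.u_pos _ _
  measurable_alloc i := Measurable.ite (measurableSet_le (measurable_pi_apply i) measurable_const)
    measurable_const measurable_const
  measurable_pay i := Measurable.ite (measurableSet_le (measurable_pi_apply i) measurable_const)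
    measurable_const measurable_const
  integrable_pay i := (I.integral_cutoff r r i).1
  budget := by
    simp only [Mechanism.cutoff]
    rw [integral_finsetSum _ fun i _ => ((I.integral_cutoff r r i).1).mul_const _]
    simp_rw [integral_mul_const, (I.integral_cutoff r r _).2]
    refine le_trans (le_of_eq ?_) hB
    simp; ring

lemma cutoff_utility (I : BayesianMarket) (r : ℝ) :
    I.utility (Mechanism.cutoff I.n r) = I.n * I.u * I.F (I.u * r) := by
  simp only [utility, Mechanism.cutoff]
  rw [integral_finsetSum _ fun i _ => ((I.integral_cutoff r 1 i).1).mul_const _]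
  simp_rw [integral_mul_const, (I.integral_cutoff r 1 _).2]
  simp; ring

/-- The mixture of two mechanisms. -/
def mix {n : ℕ} (a b : ℝ) (M N : Mechanism n) : Mechanism n where
  alloc γ i := a * M.alloc γ i + b * N.alloc γ i
  pay γ i := a * M.pay γ i + b * N.pay γ i

lemma Feasible.mix {a b B' : ℝ} (ha : 0 ≤ a) (hb : 0 ≤ b) (hab : a + b = 1) {N : Mechanism I.n}
    (hM : I.Feasible B M) (hN : I.Feasible B' N) :
    I.Feasible (a * B + b * B') (mix a b M N) where
  admissible :=
    { alloc_mem := fun γ hγ i => convex_Icc (0 : ℝ) 1 (hM.admissible.alloc_mem γ hγ i)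
        (hN.admissible.alloc_mem γ hγ i) ha hb hab
      truthful := fun γ hγ i z hz => by
        have h1 := mul_le_mul_of_nonneg_left (hM.admissible.truthful γ hγ i z hz) ha
        have h2 := mul_le_mul_of_nonneg_left (hN.admissible.truthful γ hγ i z hz) hb
        simp only [Mechanism.profit, BayesianMarket.mix] at *
        linarith
      rational := fun γ hγ i => by
        have h1 := mul_nonneg ha (hM.admissible.rational γ hγ i)
        have h2 := mul_nonneg hb (hN.admissible.rational γ hγ i)
        simp only [Mechanism.profit, BayesianMarket.mix] at *
        linarith }
  measurable_alloc i := ((hM.measurable_alloc i).const_mul a).add ((hN.measurable_alloc i).const_mul b)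
  measurable_pay i := ((hM.measurable_pay i).const_mul a).add ((hN.measurable_pay i).const_mul b)
  integrable_pay i := ((hM.integrable_pay i).const_mul a).add ((hN.integrable_pay i).const_mul b)
  budget := by
    simp only [BayesianMarket.mix]
    have h1 := mul_le_mul_of_nonneg_left hM.pay_le ha
    have h2 := mul_le_mul_of_nonneg_left hN.pay_le hb
    have hi : ∀ i, Integrable (fun c => (a * M.pay (I.perUtility c) i +
        b * N.pay (I.perUtility c) i) * I.u) I.law := fun i =>
      (((hM.integrable_pay i).const_mul a).add ((hN.integrable_pay i).const_mul b)).mul_const _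
    rw [integral_finsetSum _ fun i _ => hi i]
    simp_rw [integral_mul_const, integral_add ((hM.integrable_pay _).const_mul a)
      ((hN.integrable_pay _).const_mul b), integral_const_mul]
    rw [← Finset.sum_mul, Finset.sum_add_distrib, ← Finset.mul_sum, ← Finset.mul_sum]
    linarith

lemma Feasible.mix_utility {a b B' : ℝ} (ha : 0 ≤ a) (hb : 0 ≤ b) (hab : a + b = 1)
    {N : Mechanism I.n} (hM : I.Feasible B M) (hN : I.Feasible B' N) :
    I.utility (BayesianMarket.mix a b M N) = a * I.utility M + b * I.utility N := by
  rw [(hM.mix ha hb hab hN).utility_eq, hM.utility_eq, hN.utility_eq]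
  simp only [BayesianMarket.mix]
  simp_rw [integral_add ((hM.integrable_alloc _).const_mul a)
      ((hN.integrable_alloc _).const_mul b), integral_const_mul]
  rw [Finset.sum_add_distrib, ← Finset.mul_sum, ← Finset.mul_sum]
  ring

/-! ### The optimal mechanism -/

/-- The largest fraction of the market that a mechanism can buy with budget `B`. -/
def icOpt (I : BayesianMarket) (B : ℝ) : ℝ :=
  sSup {v | ∃ M : Mechanism I.n, I.Feasible B M ∧ v = I.utility M / (I.n * I.u)}

lemma icOpt_bddAbove (I : BayesianMarket) (B : ℝ) :
    BddAbove {v | ∃ M : Mechanism I.n, I.Feasible B M ∧ v = I.utility M / (I.n * I.u)} := by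
  refine ⟨1, ?_⟩
  rintro v ⟨M, hM, rfl⟩
  rw [div_le_one I.nu_pos]
  have := hM.utility_le le_rfl (κ := 1) fun y _ => by simpa using I.G_le_one y
  simpa using this

lemma icOpt_nonempty (I : BayesianMarket) {B : ℝ} (hB : 0 ≤ B) :
    {v | ∃ M : Mechanism I.n, I.Feasible B M ∧ v = I.utility M / (I.n * I.u)}.Nonempty :=
  ⟨_, Mechanism.cutoff I.n 0, I.cutoff_feasible (by simpa using hB), rfl⟩

lemma Feasible.le_icOpt (h : I.Feasible B M) : I.utility M / (I.n * I.u) ≤ I.icOpt B :=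
  le_csSup (I.icOpt_bddAbove B) ⟨M, h, rfl⟩

lemma Feasible.utility_le_icOpt (h : I.Feasible B M) : I.utility M ≤ I.n * I.u * I.icOpt B := by
  have := h.le_icOpt
  rwa [div_le_iff₀ I.nu_pos, mul_comm] at this

lemma exists_feasible_gt (I : BayesianMarket) {B : ℝ} (hB : 0 ≤ B) {v : ℝ} (hv : v < I.icOpt B) :
    ∃ M : Mechanism I.n, I.Feasible B M ∧ v < I.utility M / (I.n * I.u) := by
  obtain ⟨_, ⟨M, hM, rfl⟩, h⟩ := exists_lt_of_lt_csSup (I.icOpt_nonempty hB) hv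
  exact ⟨M, hM, h⟩

lemma icOpt_le (I : BayesianMarket) {B κ l : ℝ} (hB : 0 ≤ B) (hl : 0 ≤ l)
    (hG : ∀ y, 0 ≤ y → I.G y * (1 - l * y) ≤ κ) : I.icOpt B ≤ κ + l * B := by
  refine csSup_le (I.icOpt_nonempty hB) ?_
  rintro v ⟨M, hM, rfl⟩
  rw [div_le_iff₀ I.nu_pos, mul_comm]
  exact hM.utility_le hl hG

/-- Offering `y / n` to each seller buys the fraction `G y` for the expected payment `y * G y`. -/
lemma G_le_icOpt (I : BayesianMarket) {y B : ℝ} (h : y * I.G y ≤ B) :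
    I.G y ≤ I.icOpt B := by
  have hn := I.n_cast_pos
  have hu := I.u_pos
  have e : I.u * (y / (I.n * I.u)) = y / I.n := by field_simp
  have h1 := (I.cutoff_feasible (r := y / (I.n * I.u)) (B := B) (by
    rw [e]
    have : I.n * (y / I.n) = y := by field_simp
    rw [this]; exact h)).le_icOpt
  rwa [cutoff_utility, e, mul_div_cancel_left₀ _ I.nu_pos.ne'] at h1

lemma icOpt_le_one (I : BayesianMarket) {B : ℝ} (hB : 0 ≤ B) : I.icOpt B ≤ 1 := by
  have := I.icOpt_le hB le_rfl (κ := 1) fun y _ => by simpa using I.G_le_one y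
  simpa using this

lemma icOpt_monotoneOn (I : BayesianMarket) : MonotoneOn I.icOpt (Set.Ici 0) := by
  intro B hB B' _ h
  refine csSup_le (I.icOpt_nonempty hB) ?_
  rintro v ⟨M, hM, rfl⟩
  exact (hM.mono h).le_icOpt

/-- Mixing mechanisms mixes budgets and utilities alike; the suprema need not be attained, hence the
error `e`. -/
lemma icOpt_concaveOn (I : BayesianMarket) : ConcaveOn ℝ (Set.Ici 0) I.icOpt := by
  refine ⟨convex_Ici 0, fun B hB B' hB' a b ha hb hab => ?_⟩
  simp only [smul_eq_mul]
  refine le_of_forall_pos_sub_le fun e he => ?_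
  obtain ⟨M, hM, h1⟩ := I.exists_feasible_gt hB (sub_lt_self (I.icOpt B) he)
  obtain ⟨N, hN, h2⟩ := I.exists_feasible_gt hB' (sub_lt_self (I.icOpt B') he)
  have h3 := (hM.mix ha hb hab hN).le_icOpt
  rw [hM.mix_utility ha hb hab hN, add_div, mul_div_assoc, mul_div_assoc] at h3
  have h4 := mul_le_mul_of_nonneg_left h1.le ha
  have h5 := mul_le_mul_of_nonneg_left h2.le hb
  have : a * e + b * e = e := by rw [← add_mul, hab, one_mul]
  linarith

end BayesianMarket

/-- A concave monotone function has a supporting line of nonnegative slope at each interior point. -/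
lemma exists_supporting_line {f : ℝ → ℝ} (hf : ConcaveOn ℝ (Set.Ici 0) f)
    (hm : MonotoneOn f (Set.Ici 0)) {b : ℝ} (hb : 0 < b) :
    ∃ l, 0 ≤ l ∧ ∀ x, 0 ≤ x → f x ≤ f b + l * (x - b) := by
  -- Slopes to the right of `b`; by concavity their supremum is at most every slope to the left.
  set T := {s | ∃ y, b < y ∧ s = (f y - f b) / (y - b)} with hT
  have hne : T.Nonempty := ⟨_, b + 1, by linarith, rfl⟩
  have hub : ∀ x, 0 ≤ x → x < b → ∀ s ∈ T, s ≤ (f b - f x) / (b - x) := by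
    rintro x hx hxb s ⟨y, hy, rfl⟩
    exact hf.slope_anti_adjacent hx (by exact (hb.trans hy).le) hxb hy
  have hbdd : BddAbove T := ⟨_, fun s hs => hub 0 le_rfl hb s hs⟩
  refine ⟨sSup T, ?_, fun x hx => ?_⟩
  · refine le_trans ?_ (le_csSup hbdd ⟨b + 1, by linarith, rfl⟩)
    have := hm hb.le (by linarith : (0 : ℝ) ≤ b + 1) (by linarith)
    exact div_nonneg (by linarith) (by linarith)
  · rcases lt_trichotomy x b with h | rfl | h
    · have := csSup_le hne (hub x hx h)
      rw [le_div_iff₀ (by linarith)] at this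
      linarith
    · simp
    · have := le_csSup hbdd ⟨x, h, rfl⟩
      rw [div_le_iff₀ (by linarith)] at this
      linarith

end

/-! ### The non-IC optimum and its dual -/

section

namespace BayesianMarket

variable (I : BayesianMarket)

/-! ### The non-IC optimum -/

/-- The fraction of the market bought by the non-IC optimum. -/
def frac (B : ℝ) : ℝ := I.opt B / (I.n * I.u)

lemma integrable_max_sub (r : ℝ) : Integrable (fun c => max (r - I.n * c) 0) I.μ := by
  refine Integrable.of_bound (by fun_prop) (max r 0) ?_
  filter_upwards [I.ae_nonneg] with c hc
  rw [Real.norm_eq_abs, abs_of_nonneg (le_max_right _ _)]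
  refine max_le_max ?_ le_rfl
  have := mul_nonneg I.n_cast_pos.le hc
  linarith

/-- Layer cake: for `t > 0`, the integrand is at least `t` exactly if `n * c ≤ r - t`. This makes
the dual of the knapsack a family of constraints on the integral of `G`. -/
lemma integral_max_sub {r : ℝ} (hr : 0 ≤ r) :
    ∫ c, max (r - I.n * c) 0 ∂I.μ = ∫ y in (0 : ℝ)..r, I.G y := by
  have hb : (fun c => max (r - I.n * c) 0) ≤ᵐ[I.μ] fun _ => r := by
    filter_upwards [I.ae_nonneg] with c hc
    refine max_le ?_ hr
    have := mul_nonneg I.n_cast_pos.le hc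
    linarith
  rw [Integrable.integral_eq_integral_Ioc_meas_le (I.integrable_max_sub r)
    (Filter.Eventually.of_forall fun c => le_max_right _ _) hb,
    ← intervalIntegral.integral_of_le hr]
  have h1 : ∫ t in (0 : ℝ)..r, I.μ.real {a | t ≤ max (r - I.n * a) 0} =
      ∫ t in (0 : ℝ)..r, I.G (r - t) := by
    rw [intervalIntegral.integral_of_le hr, intervalIntegral.integral_of_le hr]
    refine setIntegral_congr_fun measurableSet_Ioc fun t ht => ?_
    rw [G_eq]
    congr 1
    ext a
    simp only [Set.mem_ofPred_eq, le_max_iff, not_le.2 ht.1, or_false]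
    constructor <;> intro h <;> linarith
  rw [h1, intervalIntegral.integral_comp_sub_left (fun y => I.G y) r]
  simp

/-- The allocations that are affordable when costs are public. -/
def fracSet (B : ℝ) : Set ℝ :=
  {v | ∃ x : ℝ → ℝ, Measurable x ∧ (∀ c, x c ∈ Set.Icc (0 : ℝ) 1) ∧
    Integrable (fun c => c * x c) I.μ ∧ I.n * (∫ c, c * x c ∂I.μ) ≤ B ∧
    v = I.n * I.u * ∫ c, x c ∂I.μ}

lemma integrable_of_mem_Icc {x : ℝ → ℝ} (hx : Measurable x) (h : ∀ c, x c ∈ Set.Icc (0 : ℝ) 1) :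
    Integrable x I.μ :=
  Integrable.of_bound hx.aestronglyMeasurable 1 (Filter.Eventually.of_forall fun c => by
    rw [Real.norm_eq_abs, abs_of_nonneg (h c).1]; exact (h c).2)

lemma fracSet_bddAbove (B : ℝ) : BddAbove (I.fracSet B) := by
  refine ⟨I.n * I.u, ?_⟩
  rintro v ⟨x, hx, h, -, -, rfl⟩
  refine mul_le_of_le_one_right I.nu_pos.le ?_
  calc ∫ c, x c ∂I.μ ≤ ∫ _, (1 : ℝ) ∂I.μ :=
        integral_mono (I.integrable_of_mem_Icc hx h) (integrable_const _) fun c => (h c).2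
    _ = 1 := by simp

lemma le_frac {B : ℝ} {x : ℝ → ℝ} (hx : Measurable x) (h : ∀ c, x c ∈ Set.Icc (0 : ℝ) 1)
    (hi : Integrable (fun c => c * x c) I.μ) (hB : I.n * (∫ c, c * x c ∂I.μ) ≤ B) :
    ∫ c, x c ∂I.μ ≤ I.frac B := by
  unfold frac
  rw [le_div_iff₀ I.nu_pos, mul_comm]
  exact le_csSup (I.fracSet_bddAbove B) ⟨x, hx, h, hi, hB, rfl⟩

lemma frac_le {B a : ℝ} (hB : 0 ≤ B) (h : ∀ x : ℝ → ℝ, Measurable x →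
    (∀ c, x c ∈ Set.Icc (0 : ℝ) 1) → Integrable (fun c => c * x c) I.μ →
    I.n * (∫ c, c * x c ∂I.μ) ≤ B → ∫ c, x c ∂I.μ ≤ a) : I.frac B ≤ a := by
  unfold frac
  rw [div_le_iff₀ I.nu_pos, mul_comm]
  refine csSup_le ⟨0, fun _ => 0, measurable_const, fun _ => ⟨le_rfl, zero_le_one⟩, by simp,
    by simpa using hB, by simp⟩ ?_
  rintro v ⟨x, hx, h1, h2, h3, rfl⟩
  exact mul_le_mul_of_nonneg_left (h x hx h1 h2 h3) I.nu_pos.le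

lemma frac_le_one {B : ℝ} (hB : 0 ≤ B) : I.frac B ≤ 1 := by
  refine I.frac_le hB fun x hx h _ _ => ?_
  calc ∫ c, x c ∂I.μ ≤ ∫ _, (1 : ℝ) ∂I.μ :=
        integral_mono (I.integrable_of_mem_Icc hx h) (integrable_const _) fun c => (h c).2
    _ = 1 := by simp

/-- Weak duality for the non-IC optimum. -/
lemma frac_mul_le {B r : ℝ} (hB : 0 ≤ B) (hr : 0 ≤ r) :
    I.frac B * r ≤ B + ∫ y in (0 : ℝ)..r, I.G y := by
  rcases hr.eq_or_lt with rfl | hr0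
  · simpa using hB
  rw [← le_div_iff₀ hr0]
  refine I.frac_le hB fun x hx h hi hb => ?_
  rw [le_div_iff₀ hr0, ← I.integral_max_sub hr]
  have hxi := I.integrable_of_mem_Icc hx h
  calc (∫ c, x c ∂I.μ) * r = ∫ c, x c * r ∂I.μ := (integral_mul_const _ _).symm
    _ ≤ ∫ c, (I.n * (c * x c) + max (r - I.n * c) 0) ∂I.μ := by
        refine integral_mono (hxi.mul_const _) ((hi.const_mul _).add (I.integrable_max_sub r))
          fun c => ?_
        change x c * r ≤ I.n * (c * x c) + max (r - I.n * c) 0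
        have h1 : x c * (r - I.n * c) ≤ max (r - I.n * c) 0 := by
          rcases le_total 0 (r - I.n * c) with h0 | h0
          · rw [max_eq_left h0]; exact mul_le_of_le_one_left h0 (h c).2
          · rw [max_eq_right h0]; exact mul_nonpos_of_nonneg_of_nonpos (h c).1 h0
        linarith
    _ = I.n * (∫ c, c * x c ∂I.μ) + ∫ c, max (r - I.n * c) 0 ∂I.μ := by
        rw [integral_add (hi.const_mul _) (I.integrable_max_sub r), integral_const_mul]
    _ ≤ _ := by linarith

/-- The cost of all items up to a threshold. -/
lemma G_le_frac {B r : ℝ} (hr : 0 ≤ r) (h : r * I.G r - ∫ y in (0 : ℝ)..r, I.G y ≤ B) :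
    I.G r ≤ I.frac B := by
  set x : ℝ → ℝ := Set.indicator {c | I.n * c ≤ r} 1 with hx
  have hm : MeasurableSet {c : ℝ | I.n * c ≤ r} := measurableSet_le (by fun_prop) measurable_const
  have hxm : Measurable x := measurable_one.indicator hm
  have hx01 : ∀ c, x c ∈ Set.Icc (0 : ℝ) 1 := by
    intro c
    by_cases hc : c ∈ {c : ℝ | I.n * c ≤ r}
    · rw [hx, Set.indicator_of_mem hc]; simp
    · rw [hx, Set.indicator_of_notMem hc]; simp
  have hxi := I.integrable_of_mem_Icc hxm hx01
  have hval : ∫ c, x c ∂I.μ = I.G r := by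
    rw [hx, integral_indicator_one hm, G_eq]
  have he : ∀ c, I.n * (c * x c) = r * x c - max (r - I.n * c) 0 := by
    intro c
    by_cases hc : c ∈ {c : ℝ | I.n * c ≤ r}
    · rw [hx, Set.indicator_of_mem hc]
      have : I.n * c ≤ r := hc
      rw [max_eq_left (by linarith)]; simp
    · rw [hx, Set.indicator_of_notMem hc]
      have : ¬ I.n * c ≤ r := hc
      rw [max_eq_right (by linarith)]; simp
  have hni : Integrable (fun c => I.n * (c * x c)) I.μ := by
    simp_rw [he]
    exact (hxi.const_mul r).sub (I.integrable_max_sub r)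
  have hci : Integrable (fun c => c * x c) I.μ := by
    have := hni.const_mul (I.n : ℝ)⁻¹
    refine this.congr (Filter.Eventually.of_forall fun c => ?_)
    exact inv_mul_cancel_left₀ I.n_cast_pos.ne' _
  rw [← hval]
  refine I.le_frac hxm hx01 hci ?_
  rw [← integral_const_mul]
  simp_rw [he]
  rw [integral_sub (hxi.const_mul r) (I.integrable_max_sub r), integral_const_mul, hval,
    I.integral_max_sub hr]
  exact h

/-- Strong duality for the non-IC optimum. -/
theorem le_frac_of_forall {B v : ℝ} (hB : 0 < B) (hv1 : v ≤ 1)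
    (hv : ∀ r, 0 ≤ r → v * r ≤ B + ∫ y in (0 : ℝ)..r, I.G y) : v ≤ I.frac B := by
  -- `S r` is the cost of all items with `n * c ≤ r`. If it reaches `B`, some threshold costs
  -- exactly `B` by continuity, and the constraint there reads `v ≤ G r`. Otherwise all thresholds
  -- are affordable, and `v ≤ 1` suffices.
  set S : ℝ → ℝ := fun r => r * I.G r - ∫ y in (0 : ℝ)..r, I.G y with hS
  by_cases h : ∃ R, 0 ≤ R ∧ B ≤ S R
  · obtain ⟨R, hR, hSR⟩ := h
    have hcont : ContinuousOn S (Set.Icc 0 R) := by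
      refine ContinuousOn.sub (continuousOn_id.mul (I.G_continuousOn.mono fun _ h => h.1)) ?_
      exact (intervalIntegral.continuous_primitive (fun a b => I.G_intervalIntegrable a b) 0).continuousOn
    have hS0 : S 0 = 0 := by simp [hS]
    obtain ⟨r, hr, hrS⟩ := intermediate_value_Icc hR hcont (show B ∈ Set.Icc (S 0) (S R) from
      ⟨by rw [hS0]; exact hB.le, hSR⟩)
    have hr0 : 0 < r := by
      rcases hr.1.eq_or_lt with h0 | h0
      · rw [← h0, hS0] at hrS; linarith
      · exact h0
    have h1 := hv r hr0.le
    have h2 : v ≤ I.G r := by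
      have : v * r ≤ I.G r * r := by
        have : S r = r * I.G r - ∫ y in (0 : ℝ)..r, I.G y := rfl
        linarith
      exact le_of_mul_le_mul_right this hr0
    exact h2.trans (I.G_le_frac hr0.le hrS.le)
  · push Not at h
    refine hv1.trans (le_of_tendsto I.G_tendsto ?_)
    filter_upwards [Filter.eventually_ge_atTop 0] with r hr
    exact I.G_le_frac hr (h r hr).le

lemma frac_pos {B : ℝ} (hB : 0 < B) : 0 < I.frac B := by
  obtain ⟨R, hR0, hR⟩ := ((Filter.eventually_gt_atTop 0).and
    (I.G_tendsto.eventually (lt_mem_nhds (show (1 / 2 : ℝ) < 1 by norm_num)))).exists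
  have hv : 0 < min (1 / 2) (B / R) := lt_min (by norm_num) (div_pos hB hR0)
  refine lt_of_lt_of_le hv (I.le_frac_of_forall hB ((min_le_left _ _).trans (by norm_num)) ?_)
  intro r hr
  have hnn : ∀ a b, a ≤ b → 0 ≤ ∫ y in a..b, I.G y := fun a b hab =>
    intervalIntegral.integral_nonneg hab fun y _ => I.G_nonneg y
  have h1 : min (1 / 2) (B / R) * R ≤ B := by
    calc _ ≤ B / R * R := mul_le_mul_of_nonneg_right (min_le_right _ _) hR0.le
      _ = B := by field_simp
  rcases le_total r R with hrR | hrR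
  · have := hnn 0 r hr
    have : min (1 / 2) (B / R) * r ≤ min (1 / 2) (B / R) * R := mul_le_mul_of_nonneg_left hrR hv.le
    linarith
  · have h2 : ∫ y in (0 : ℝ)..r, I.G y = (∫ y in (0 : ℝ)..R, I.G y) + ∫ y in R..r, I.G y :=
      (intervalIntegral.integral_add_adjacent_intervals (I.G_intervalIntegrable _ _)
        (I.G_intervalIntegrable _ _)).symm
    have h3 : 1 / 2 * (r - R) ≤ ∫ y in R..r, I.G y := by
      have : ∫ y in R..r, (1 / 2 : ℝ) ≤ ∫ y in R..r, I.G y :=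
        intervalIntegral.integral_mono_on hrR (by simp) (I.G_intervalIntegrable _ _)
          fun y hy => hR.le.trans (I.G_mono hy.1)
      rw [intervalIntegral.integral_const, smul_eq_mul] at this
      linarith
    have h4 : min (1 / 2) (B / R) * (r - R) ≤ 1 / 2 * (r - R) :=
      mul_le_mul_of_nonneg_right (min_le_left _ _) (by linarith)
    have := hnn 0 R hR0.le
    linarith

/-- The multiplier `1 / r` gives the dual constraint at `r`, because `G y * (r - y)` is at most the
integral of the monotone `G` up to `r`. -/
lemma icOpt_le_frac {B : ℝ} (hB : 0 < B) : I.icOpt B ≤ I.frac B := by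
  refine I.le_frac_of_forall hB (I.icOpt_le_one hB.le) fun r hr => ?_
  rcases hr.eq_or_lt with rfl | hr0
  · simpa using hB.le
  have h := I.icOpt_le (l := 1 / r) (κ := 1 / r * ∫ y in (0 : ℝ)..r, I.G y) hB.le (by positivity) ?_
  · calc I.icOpt B * r ≤ (1 / r * (∫ y in (0 : ℝ)..r, I.G y) + 1 / r * B) * r :=
          mul_le_mul_of_nonneg_right h hr
      _ = _ := by field_simp; ring
  · intro y hy
    have e : I.G y * (1 - 1 / r * y) = 1 / r * (I.G y * (r - y)) := by field_simp
    rw [e]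
    refine mul_le_mul_of_nonneg_left ?_ (by positivity)
    have hnn : ∀ a b, a ≤ b → 0 ≤ ∫ y in a..b, I.G y := fun a b hab =>
      intervalIntegral.integral_nonneg hab fun y _ => I.G_nonneg y
    rcases le_total y r with hyr | hyr
    · have h2 : ∫ y in (0 : ℝ)..r, I.G y = (∫ y in (0 : ℝ)..y, I.G y) + ∫ y in y..r, I.G y :=
        (intervalIntegral.integral_add_adjacent_intervals (I.G_intervalIntegrable _ _)
          (I.G_intervalIntegrable _ _)).symm
      have h3 : ∫ _ in y..r, I.G y ≤ ∫ z in y..r, I.G z :=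
        intervalIntegral.integral_mono_on hyr (by simp) (I.G_intervalIntegrable _ _)
          fun z hz => I.G_mono hz.1
      rw [intervalIntegral.integral_const, smul_eq_mul] at h3
      have := hnn 0 y hy
      linarith
    · have := mul_nonpos_of_nonneg_of_nonpos (I.G_nonneg y) (show r - y ≤ 0 by linarith)
      linarith [hnn 0 r hr]

/-- The dual constraints for `B'`, scaled by `B / B' ≤ 1`, imply those for `B`. -/
lemma frac_mul_budget_le {B B' : ℝ} (hB : 0 < B) (hBB' : B ≤ B') :
    B / B' * I.frac B' ≤ I.frac B := by
  have hB' := hB.trans_le hBB'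
  have h1 : B / B' ≤ 1 := (div_le_one hB').2 hBB'
  have h0 : 0 ≤ B / B' := by positivity
  refine I.le_frac_of_forall hB ?_ fun r hr => ?_
  · exact mul_le_one₀ h1 (I.frac_pos hB').le (I.frac_le_one hB'.le)
  · have h2 := mul_le_mul_of_nonneg_left (I.frac_mul_le hB'.le hr) h0
    have h3 : 0 ≤ ∫ y in (0 : ℝ)..r, I.G y :=
      intervalIntegral.integral_nonneg hr fun y _ => I.G_nonneg y
    have h4 : B / B' * B' = B := div_mul_cancel₀ _ hB'.ne'
    have h5 := mul_le_of_le_one_left h3 h1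
    nlinarith

lemma frac_mono {B B' : ℝ} (hB : 0 < B) (hBB' : B ≤ B') : I.frac B ≤ I.frac B' := by
  refine I.le_frac_of_forall (hB.trans_le hBB') (I.frac_le_one hB.le) fun r hr => ?_
  linarith [I.frac_mul_le hB.le hr]

/-! ### The best ratio -/

variable {m : ℕ} (D : BudgetDistribution m)

lemma opt_eq (B : ℝ) : I.opt B = I.n * I.u * I.frac B :=
  (mul_div_cancel₀ _ I.nu_pos.ne').symm

lemma utility_div_opt (M : Mechanism I.n) (B : ℝ) :
    I.utility M / I.opt B = I.utility M / (I.n * I.u) / I.frac B := by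
  rw [opt_eq, div_div]

lemma ratio_le_of_feasible {M : Fin m → Mechanism I.n} (hM : ∀ k, I.Feasible (D.budget k) (M k)) :
    ∑ k, D.prob k * (I.utility (M k) / I.opt (D.budget k)) ≤
      ∑ k, D.prob k * (I.icOpt (D.budget k) / I.frac (D.budget k)) := by
  refine Finset.sum_le_sum fun k _ => mul_le_mul_of_nonneg_left ?_ (D.prob_pos k).le
  rw [utility_div_opt]
  exact div_le_div_of_nonneg_right (hM k).le_icOpt (I.frac_pos (D.budget_pos k)).le

/-- The mechanisms for different budgets are independent choices; nearly optimal ones suffice, as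
attainment is not yet known. -/
theorem bestRatio_eq : I.bestRatio D =
    ∑ k, D.prob k * (I.icOpt (D.budget k) / I.frac (D.budget k)) := by
  have hbdd : BddAbove {r | ∃ M : Fin m → Mechanism I.n, (∀ k, I.Feasible (D.budget k) (M k)) ∧
      r = ∑ k, D.prob k * (I.utility (M k) / I.opt (D.budget k))} :=
    ⟨_, by rintro r ⟨M, hM, rfl⟩; exact I.ratio_le_of_feasible D hM⟩
  refine le_antisymm (csSup_le ?_ ?_) ?_
  · exact ⟨_, fun k => Mechanism.cutoff I.n 0, fun k => I.cutoff_feasible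
      (by simpa using (D.budget_pos k).le), rfl⟩
  · rintro r ⟨M, hM, rfl⟩; exact I.ratio_le_of_feasible D hM
  · have key : ∀ e : ℝ, 0 < e → ∑ k, D.prob k * ((I.icOpt (D.budget k) - e) / I.frac (D.budget k)) ≤
        I.bestRatio D := by
      intro e he
      choose M hM1 hM2 using fun k => I.exists_feasible_gt (D.budget_pos k).le
        (sub_lt_self (I.icOpt (D.budget k)) he)
      refine le_trans ?_ (le_csSup hbdd ⟨M, hM1, rfl⟩)
      refine Finset.sum_le_sum fun k _ => mul_le_mul_of_nonneg_left ?_ (D.prob_pos k).le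
      rw [utility_div_opt]
      exact div_le_div_of_nonneg_right (hM2 k).le (I.frac_pos (D.budget_pos k)).le
    have hcont : Continuous fun e : ℝ =>
        ∑ k, D.prob k * ((I.icOpt (D.budget k) - e) / I.frac (D.budget k)) := by fun_prop
    have hlim := (hcont.tendsto 0).mono_left (nhdsWithin_le_nhds (s := Set.Ioi 0))
    have := le_of_tendsto hlim (by filter_upwards [self_mem_nhdsWithin] with e he using key e he)
    simpa using this

end BayesianMarket

end

/-! ### Envelopes of hyperbolas and configurations of lines -/

section

/-! ### The largest distribution function below given hyperbolas -/

/-- The largest `s ≤ M` with `s * (1 - l * c) ≤ κ`. -/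
def piece (M κ l c : ℝ) : ℝ := if M * (1 - l * c) ≤ κ then M else κ / (1 - l * c)

section piece

variable {M κ l c : ℝ}

lemma piece_pos_denom (hM : 0 < M) (hκ : 0 ≤ κ) (h : ¬ M * (1 - l * c) ≤ κ) : 0 < 1 - l * c := by
  by_contra hc
  push Not at hc
  exact h ((mul_nonpos_of_nonneg_of_nonpos hM.le hc).trans hκ)

lemma piece_le (hM : 0 < M) (hκ : 0 ≤ κ) : piece M κ l c ≤ M := by
  unfold piece
  split_ifs with h
  · exact le_rfl
  · have := piece_pos_denom hM hκ h
    rw [div_le_iff₀ this]; linarith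

lemma piece_mul_le (hM : 0 < M) (hκ : 0 ≤ κ) : piece M κ l c * (1 - l * c) ≤ κ := by
  unfold piece
  split_ifs with h
  · exact h
  · rw [div_mul_cancel₀ _ (piece_pos_denom hM hκ h).ne']

lemma le_piece {s : ℝ} (hM : 0 < M) (hκ : 0 ≤ κ) (h1 : s ≤ M) (h2 : s * (1 - l * c) ≤ κ) :
    s ≤ piece M κ l c := by
  unfold piece
  split_ifs with h
  · exact h1
  · rwa [le_div_iff₀ (piece_pos_denom hM hκ h)]

lemma piece_nonneg (hM : 0 < M) (hκ : 0 ≤ κ) : 0 ≤ piece M κ l c :=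
  le_piece hM hκ hM.le (by simpa using hκ)

/-- In this form continuity in `c` is visible: the denominator is bounded away from zero. -/
lemma piece_eq (hM : 0 < M) (hκ : 0 < κ) : piece M κ l c = κ / max (κ / M) (1 - l * c) := by
  unfold piece
  split_ifs with h
  · rw [max_eq_left ((le_div_iff₀ hM).2 (by linarith))]
    field_simp
  · rw [max_eq_right]
    push Not at h
    rw [div_le_iff₀ hM]; linarith

end piece

variable {m : ℕ}

/-- The largest `s ≤ M` with `s * (1 - l k * c) ≤ κ k` for all `k`. -/
def envelope (M : ℝ) (κ l : Fin (m + 1) → ℝ) (c : ℝ) : ℝ :=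
  Finset.univ.inf' Finset.univ_nonempty fun k => piece M (κ k) (l k) c

section envelope

variable {M : ℝ} {κ l : Fin (m + 1) → ℝ}

lemma envelope_le_piece (k : Fin (m + 1)) (c : ℝ) : envelope M κ l c ≤ piece M (κ k) (l k) c :=
  Finset.inf'_le _ (Finset.mem_univ k)

lemma envelope_le (hM : 0 < M) (hκ : ∀ k, 0 ≤ κ k) (c : ℝ) : envelope M κ l c ≤ M :=
  (envelope_le_piece 0 c).trans (piece_le hM (hκ 0))

lemma envelope_nonneg (hM : 0 < M) (hκ : ∀ k, 0 ≤ κ k) (c : ℝ) : 0 ≤ envelope M κ l c :=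
  Finset.le_inf' _ _ fun k _ => piece_nonneg hM (hκ k)

lemma le_envelope {s c : ℝ} (hM : 0 < M) (hκ : ∀ k, 0 ≤ κ k) (h1 : s ≤ M)
    (h2 : ∀ k, s * (1 - l k * c) ≤ κ k) : s ≤ envelope M κ l c :=
  Finset.le_inf' _ _ fun k _ => le_piece hM (hκ k) h1 (h2 k)

lemma exists_envelope_eq (M : ℝ) (κ l : Fin (m + 1) → ℝ) (c : ℝ) :
    ∃ k, envelope M κ l c = piece M (κ k) (l k) c := by
  obtain ⟨k, -, hk⟩ := Finset.exists_mem_eq_inf' Finset.univ_nonempty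
    fun k => piece M (κ k) (l k) c
  exact ⟨k, hk⟩

lemma envelope_mul_le (hM : 0 < M) (hκ : ∀ k, 0 ≤ κ k) (k : Fin (m + 1)) {c : ℝ} :
    envelope M κ l c * (1 - l k * c) ≤ κ k := by
  rcases le_total (1 - l k * c) 0 with h | h
  · exact (mul_nonpos_of_nonneg_of_nonpos (envelope_nonneg hM hκ c) h).trans (hκ k)
  · exact (mul_le_mul_of_nonneg_right (envelope_le_piece k c) h).trans (piece_mul_le hM (hκ k))

lemma envelope_mono (hM : 0 < M) (hκ : ∀ k, 0 ≤ κ k) (hl : ∀ k, 0 ≤ l k) :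
    Monotone (envelope M κ l) := fun c c' h =>
  le_envelope hM hκ (envelope_le hM hκ c) fun k => by
    refine le_trans (mul_le_mul_of_nonneg_left ?_ (envelope_nonneg hM hκ c))
      (envelope_mul_le hM hκ k (c := c))
    have := mul_le_mul_of_nonneg_left h (hl k)
    linarith

lemma envelope_continuous (hM : 0 < M) (hκ : ∀ k, 0 < κ k) : Continuous (envelope M κ l) := by
  have h : ∀ k, Continuous fun c => piece M (κ k) (l k) c := by
    intro k
    have : (fun c => piece M (κ k) (l k) c) = fun c => κ k / max (κ k / M) (1 - l k * c) :=
      funext fun c => piece_eq hM (hκ k)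
    rw [this]
    refine Continuous.div continuous_const (by fun_prop) fun c => ?_
    exact (lt_max_of_lt_left (div_pos (hκ k) hM)).ne'
  unfold envelope
  exact Continuous.finset_inf'_apply Finset.univ_nonempty fun k _ => h k

/-- Beyond `1 / l k` a line of positive slope imposes nothing. Horizontal lines add `1 / 0 = 0` to
the sum and are harmless by `h0`. -/
lemma envelope_eq_of_large (hM : 0 < M) (hκ : ∀ k, 0 ≤ κ k) (hl : ∀ k, 0 ≤ l k)
    (h0 : ∀ k, l k = 0 → M ≤ κ k) {c : ℝ} (hc : ∑ k, 1 / l k ≤ c) : envelope M κ l c = M := by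
  refine le_antisymm (envelope_le hM hκ c) (le_envelope hM hκ le_rfl fun k => ?_)
  rcases (hl k).eq_or_lt with h | h
  · rw [← h]; simpa using h0 k h.symm
  · have h1 : 1 / l k ≤ c := le_trans (Finset.single_le_sum (f := fun k => 1 / l k)
      (fun k _ => one_div_nonneg.2 (hl k)) (Finset.mem_univ k)) hc
    rw [div_le_iff₀ h] at h1
    exact (mul_nonpos_of_nonneg_of_nonpos hM.le (by linarith)).trans (hκ k)

end envelope

/-! ### Configurations -/

/-- Lines `b ↦ κ k + l k * b` above the utilities that can be achieved with the budget `b`, together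
with lower bounds `o k` on the fraction that the non-IC optimum buys with the budget `B k` in the
market (of size `M`) that is determined by these lines. -/
structure Configuration (D : BudgetDistribution (m + 1)) (M : ℝ) (κ l o : Fin (m + 1) → ℝ) :
    Prop where
  M_pos : 0 < M
  κ_nonneg : ∀ k, 0 ≤ κ k
  l_nonneg : ∀ k, 0 ≤ l k
  o_pos : ∀ k, 0 < o k
  o_le : ∀ k, o k ≤ M
  le_κ : ∀ k, l k = 0 → M ≤ κ k
  mul_le : ∀ k r, 0 ≤ r → o k * r ≤ D.budget k + ∫ y in (0 : ℝ)..r, envelope M κ l y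

/-- The ratio of the lines of a configuration to its non-IC optima. -/
def configValue (D : BudgetDistribution (m + 1)) (κ l o : Fin (m + 1) → ℝ) : ℝ :=
  ∑ k, D.prob k * ((κ k + l k * D.budget k) / o k)

namespace Configuration

variable {D : BudgetDistribution (m + 1)} {M : ℝ} {κ l o : Fin (m + 1) → ℝ}

lemma intervalIntegrable (h : Configuration D M κ l o) (a b : ℝ) :
    IntervalIntegrable (envelope M κ l) volume a b :=
  (envelope_mono h.M_pos h.κ_nonneg h.l_nonneg).intervalIntegrable

/-- Dividing fractions by `M` and multiplying prices by `M` preserves the hyperbolas. Sizes other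
than `1` are there to give room for perturbations. -/
lemma scale (h : Configuration D M κ l o) : Configuration D 1 (fun k => κ k / M)
    (fun k => l k / M) (fun k => o k / M) where
  M_pos := one_pos
  κ_nonneg k := div_nonneg (h.κ_nonneg k) h.M_pos.le
  l_nonneg k := div_nonneg (h.l_nonneg k) h.M_pos.le
  o_pos k := div_pos (h.o_pos k) h.M_pos
  o_le k := (div_le_one h.M_pos).2 (h.o_le k)
  le_κ k hk := by
    rw [div_eq_zero_iff, or_iff_left h.M_pos.ne'] at hk
    exact (one_le_div h.M_pos).2 (h.le_κ k hk)
  mul_le k r hr := by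
    have hM := h.M_pos
    have hκ1 : ∀ k, 0 ≤ κ k / M := fun k => div_nonneg (h.κ_nonneg k) hM.le
    have h1 := h.mul_le k (r / M) (div_nonneg hr hM.le)
    have h2 : ∫ y in (0 : ℝ)..r, envelope M κ l (y / M) / M =
        ∫ y in (0 : ℝ)..(r / M), envelope M κ l y := by
      rw [intervalIntegral.integral_div, intervalIntegral.integral_comp_div _ hM.ne', smul_eq_mul,
        zero_div, mul_div_cancel_left₀ _ hM.ne']
    have h3 : ∫ y in (0 : ℝ)..r, envelope M κ l (y / M) / M ≤
        ∫ y in (0 : ℝ)..r, envelope 1 (fun k => κ k / M) (fun k => l k / M) y := by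
      refine intervalIntegral.integral_mono_on hr ?_ ?_ fun y _ => ?_
      · exact Monotone.intervalIntegrable fun a b hab => div_le_div_of_nonneg_right
          (envelope_mono hM h.κ_nonneg h.l_nonneg (div_le_div_of_nonneg_right hab hM.le)) hM.le
      · exact (envelope_mono one_pos hκ1
          fun k => div_nonneg (h.l_nonneg k) hM.le).intervalIntegrable
      · refine le_envelope one_pos hκ1 ((div_le_one hM).2 (envelope_le hM h.κ_nonneg _)) fun k => ?_
        have := envelope_mul_le (l := l) hM h.κ_nonneg k (c := y / M)
        calc envelope M κ l (y / M) / M * (1 - l k / M * y)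
            = envelope M κ l (y / M) * (1 - l k * (y / M)) / M := by ring
          _ ≤ κ k / M := div_le_div_of_nonneg_right this hM.le
    have : o k / M * r = o k * (r / M) := by ring
    linarith

lemma configValue_scale (h : 0 < M) : configValue D (fun k => κ k / M)
    (fun k => l k / M) (fun k => o k / M) = configValue D κ l o := by
  unfold configValue
  refine Finset.sum_congr rfl fun k _ => ?_
  congr 1
  rw [div_mul_eq_mul_div, ← add_div, div_div_div_cancel_right₀ h.ne']

/-- The distribution function of the market of a configuration. -/
def cdfFun (κ l : Fin (m + 1) → ℝ) (c : ℝ) : ℝ := if c < 0 then 0 else envelope 1 κ l c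

/-- Lines with positive intercepts belong to a market. -/
lemma exists_market_of_one (h : Configuration D 1 κ l o) (hκ : ∀ k, 0 < κ k) :
    ∃ J : BayesianMarket, (∀ y, 0 ≤ y → J.G y = envelope 1 κ l y) := by
  have hnn := envelope_nonneg (l := l) one_pos h.κ_nonneg
  have hmono := envelope_mono one_pos h.κ_nonneg h.l_nonneg
  have hcont := envelope_continuous (l := l) one_pos hκ
  have h0 : ∀ c, 0 ≤ c → cdfFun κ l c = envelope 1 κ l c := fun c hc => if_neg (not_lt.2 hc)
  have h0' : ∀ c, c < 0 → cdfFun κ l c = 0 := fun c hc => if_pos hc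
  -- The value of the envelope at `0` becomes an atom; positive intercepts give the required
  -- continuity on `[0, ∞)`.
  let f : StieltjesFunction ℝ :=
    { toFun := cdfFun κ l
      mono' := by
        intro a b hab
        rcases lt_or_ge a 0 with ha | ha
        · rw [h0' a ha]
          rcases lt_or_ge b 0 with hb | hb
          · rw [h0' b hb]
          · rw [h0 b hb]; exact hnn b
        · rw [h0 a ha, h0 b (ha.trans hab)]; exact hmono hab
      right_continuous' := by
        intro x
        rcases lt_or_ge x 0 with hx | hx
        · refine ContinuousAt.continuousWithinAt ?_
          refine (continuousAt_const (y := (0 : ℝ))).congr ?_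
          filter_upwards [Iio_mem_nhds hx] with c hc using (h0' c hc).symm
        · refine (hcont.continuousWithinAt).congr (fun c hc => h0 c (le_trans hx hc)) (h0 x hx) }
  have hf : ∀ c, f c = cdfFun κ l c := fun c => rfl
  have hbot : Filter.Tendsto f Filter.atBot (nhds 0) := by
    refine tendsto_const_nhds.congr' ?_
    filter_upwards [Filter.eventually_lt_atBot (0 : ℝ)] with c hc
    rw [hf, h0' c hc]
  have htop : Filter.Tendsto f Filter.atTop (nhds 1) := by
    refine tendsto_const_nhds.congr' ?_
    filter_upwards [Filter.eventually_ge_atTop 0, Filter.eventually_ge_atTop (∑ k, 1 / l k)]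
      with c hc hc2
    rw [hf, h0 c hc, envelope_eq_of_large one_pos h.κ_nonneg h.l_nonneg h.le_κ hc2]
  have hprob : IsProbabilityMeasure f.measure := f.isProbabilityMeasure hbot htop
  have hcdf : cdf f.measure = f := cdf_measure_stieltjesFunction f hbot htop
  refine ⟨⟨1, one_pos, 1, one_pos, f.measure, hprob, ?_, ?_⟩, ?_⟩
  · have : Set.Iio (0 : ℝ) = ⋃ n : ℕ, Set.Iic (-(1 / ((n : ℝ) + 1))) := by
      ext x
      simp only [Set.mem_Iio, Set.mem_iUnion, Set.mem_Iic]
      constructor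
      · intro hx
        obtain ⟨n, hn⟩ := exists_nat_one_div_lt (neg_pos.2 hx)
        exact ⟨n, by linarith⟩
      · rintro ⟨n, hn⟩
        have : 0 < 1 / ((n : ℝ) + 1) := Nat.one_div_pos_of_nat
        linarith
    rw [this, measure_iUnion_null_iff]
    intro n
    rw [f.measure_Iic hbot, hf, h0' _ (neg_neg_of_pos Nat.one_div_pos_of_nat)]
    simp
  · rw [hcdf]
    exact hcont.continuousOn.congr fun c hc => h0 c hc
  · intro y hy
    simp only [BayesianMarket.G, BayesianMarket.F, hcdf, Nat.cast_one, div_one]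
    exact h0 y hy

/-- A configuration of positive intercepts yields a market on which no mechanism has a larger ratio. -/
theorem exists_market_of_pos (h : Configuration D M κ l o) (hκ : ∀ k, 0 < κ k) :
    ∃ J : BayesianMarket, J.bestRatio D ≤ configValue D κ l o ∧
      ∀ k, o k / M ≤ J.frac (D.budget k) := by
  have hs := h.scale
  obtain ⟨J, hJ⟩ := hs.exists_market_of_one fun k => div_pos (hκ k) h.M_pos
  have hfrac : ∀ k, o k / M ≤ J.frac (D.budget k) := by
    intro k
    refine J.le_frac_of_forall (D.budget_pos k) (hs.o_le k) fun r hr => ?_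
    refine (hs.mul_le k r hr).trans (le_of_eq ?_)
    congr 1
    refine intervalIntegral.integral_congr fun y hy => ?_
    rw [Set.uIcc_of_le hr] at hy
    exact (hJ y hy.1).symm
  refine ⟨J, ?_, hfrac⟩
  rw [← configValue_scale h.M_pos, J.bestRatio_eq]
  refine Finset.sum_le_sum fun k _ => mul_le_mul_of_nonneg_left ?_ (D.prob_pos k).le
  refine div_le_div₀ ?_ ?_ (hs.o_pos k) (hfrac k)
  · exact add_nonneg (hs.κ_nonneg k) (mul_nonneg (hs.l_nonneg k) (D.budget_pos k).le)
  · refine J.icOpt_le (D.budget_pos k).le (hs.l_nonneg k) fun y hy => ?_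
    rw [hJ y hy]
    exact envelope_mul_le one_pos hs.κ_nonneg k

end Configuration

end

/-! ### Removing lines through the origin -/

section

lemma exists_pos_forall_le {m : ℕ} {a : Fin (m + 1) → ℝ} (ha : ∀ k, 0 < a k) :
    ∃ ε, 0 < ε ∧ ∀ k, ε ≤ a k :=
  ⟨Finset.univ.inf' Finset.univ_nonempty a, (Finset.lt_inf'_iff _).2 fun k _ => ha k,
    fun k => Finset.inf'_le _ (Finset.mem_univ k)⟩

namespace Configuration

variable {m : ℕ} {D : BudgetDistribution (m + 1)} {M : ℝ} {κ l o : Fin (m + 1) → ℝ}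

lemma value_pos (h : Configuration D M κ l o) (k : Fin (m + 1)) : 0 < κ k + l k * D.budget k := by
  rcases (h.l_nonneg k).eq_or_lt with h0 | h0
  · have := h.le_κ k h0.symm
    have := h.M_pos
    rw [← h0]; linarith
  · have := h.κ_nonneg k
    have := mul_pos h0 (D.budget_pos k)
    linarith

/-- The effect on the value of raising lines and lower bounds. -/
lemma ratio_le {v w b L ε : ℝ} (hv : 0 < v) (hw : 0 < w) (hε : 0 < ε) (hL : (1 + b) * w / v ≤ L)
    (hL0 : 0 < L) : (v + ε * (1 + b)) / (w + L * ε) ≤ v / w := by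
  rw [div_le_iff₀ hv] at hL
  rw [div_le_div_iff₀ (by positivity) hw]
  nlinarith

lemma envelope_eq_zero (h : Configuration D M κ l o) {k : Fin (m + 1)} (hk : κ k = 0) {c : ℝ}
    (hc : c < 1 / l k) : envelope M κ l c = 0 := by
  have hl : 0 < l k := by
    refine (h.l_nonneg k).lt_of_ne fun h0 => ?_
    have := h.le_κ k h0.symm
    linarith [h.M_pos]
  rw [lt_div_iff₀ hl] at hc
  refine le_antisymm ?_ (envelope_nonneg h.M_pos h.κ_nonneg c)
  have h1 := envelope_mul_le (l := l) h.M_pos h.κ_nonneg k (c := c)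
  rw [hk] at h1
  by_contra h2
  push Not at h2
  nlinarith [mul_pos h2 (show 0 < 1 - l k * c by linarith)]

/-- The lines of a configuration can be raised to have positive intercepts, without increasing the
value. -/
lemma exists_pos (h : Configuration D M κ l o) (hZ : ∃ k, κ k = 0) :
    ∃ M' κ' l' o', Configuration D M' κ' l' o' ∧ (∀ k, 0 < κ' k) ∧
      configValue D κ' l' o' ≤ configValue D κ l o ∧ ∀ k, o k / M ≤ o' k / M' := by
  have hM := h.M_pos
  -- A line through the origin makes the envelope vanish before `1 / l k`, after which it may jump.
  -- The flattest such line is decisive.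
  obtain ⟨k₀, hk₀, hmax⟩ : ∃ k₀, κ k₀ = 0 ∧ ∀ k, κ k = 0 → l k₀ ≤ l k := by
    obtain ⟨k₁, hk₁⟩ := hZ
    obtain ⟨k₀, hk₀, hk₂⟩ := Finset.exists_min_image (Finset.univ.filter fun k => κ k = 0) l
      ⟨k₁, by simpa using hk₁⟩
    simp only [Finset.mem_filter, Finset.mem_univ, true_and] at hk₀ hk₂
    exact ⟨k₀, hk₀, hk₂⟩
  have hl₀ : 0 < l k₀ := by
    refine (h.l_nonneg k₀).lt_of_ne fun h0 => ?_
    have := h.le_κ k₀ h0.symm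
    linarith
  set r₀ : ℝ := 1 / l k₀ with hr₀
  have hr₀pos : 0 < r₀ := one_div_pos.2 hl₀
  have hzero : ∀ c, c < r₀ → envelope M κ l c = 0 := fun c hc => h.envelope_eq_zero hk₀ hc
  have hint0 : ∀ r, 0 ≤ r → r ≤ r₀ → ∫ y in (0 : ℝ)..r, envelope M κ l y = 0 := by
    intro r hr hr2
    refine intervalIntegral.integral_zero_ae ?_
    have : ∀ᵐ y : ℝ, y ≠ r₀ := by simp [ae_iff, measure_singleton]
    filter_upwards [this] with y hy hy2
    rw [Set.uIoc_of_le hr] at hy2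
    exact hzero y (lt_of_le_of_ne (hy2.2.trans hr2) hy)
  have ho₀ : ∀ k, o k * r₀ ≤ D.budget k := fun k => by
    simpa [hint0 r₀ hr₀pos.le le_rfl] using h.mul_le k r₀ hr₀pos.le
  -- Intercepts and slopes will be raised by `ε`. For this `L`, raising each `o k` by `L * ε`
  -- compensates for it in every ratio.
  set L : ℝ := ∑ k, (1 + D.budget k) * o k / (κ k + l k * D.budget k) with hL
  have hLk : ∀ k, (1 + D.budget k) * o k / (κ k + l k * D.budget k) ≤ L := fun k =>
    Finset.single_le_sum (f := fun k => (1 + D.budget k) * o k / (κ k + l k * D.budget k))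
      (fun k _ => div_nonneg (mul_nonneg (by linarith [D.budget_pos k]) (h.o_pos k).le)
        (h.value_pos k).le) (Finset.mem_univ k)
  have hLpos : 0 < L := lt_of_lt_of_le (div_pos (mul_pos (by linarith [D.budget_pos 0]) (h.o_pos 0))
    (h.value_pos 0)) (hLk 0)
  -- Beyond `R` the raised envelope is at its cap; the summand `L / M` takes care of horizontal
  -- lines.
  set R : ℝ := ∑ k, 1 / l k + L / M with hR
  have hsum : 0 ≤ ∑ k, 1 / l k := Finset.sum_nonneg fun k _ => one_div_nonneg.2 (h.l_nonneg k)
  have hlR : ∀ k, 1 / l k ≤ R := fun k => by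
    have := Finset.single_le_sum (f := fun k => 1 / l k)
      (fun k _ => one_div_nonneg.2 (h.l_nonneg k)) (Finset.mem_univ k)
    have : 0 < L / M := div_pos hLpos hM
    linarith
  have hRpos : 0 < R := hr₀pos.trans_le (hlR k₀)
  have hLR : L / M ≤ R := by linarith
  -- Before `r₀` the raised envelope will exceed `ε * r₀ / (r₀ - c)`. Cut off at `r₀ * (1 - e)`,
  -- this has integral `ε * r₀ * log (1 / e)`, which equals `L * ε * R` for this `e`: enough to
  -- raise each `o k` by `L * ε` up to the price `R`.
  set e : ℝ := Real.exp (-(L * R / r₀)) with he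
  have he0 : 0 < e := Real.exp_pos _
  have he1 : e < 1 := Real.exp_lt_one_iff.2 (neg_neg_of_pos (by positivity))
  -- So small that, up to the cut-off, the hyperbola stays below the positive intercepts and below
  -- `M`, and that the budgets absorb the raise of `o`.
  obtain ⟨ε, hε, hεk⟩ := exists_pos_forall_le
    (a := fun k => e * min (if κ k = 0 then 1 else κ k) (min M (D.budget k / (L * r₀))))
    (fun k => mul_pos he0 (lt_min (by
      split_ifs with hk
      · exact one_pos
      · exact (h.κ_nonneg k).lt_of_ne (Ne.symm hk)) (lt_min hM
        (div_pos (D.budget_pos k) (by positivity)))))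
  have hεκ : ∀ k, κ k ≠ 0 → ε / e ≤ κ k := fun k hk => by
    rw [div_le_iff₀' he0]
    refine (hεk k).trans (mul_le_mul_of_nonneg_left ((min_le_left _ _).trans ?_) he0.le)
    rw [if_neg hk]
  have hεM : ε / e ≤ M := by
    rw [div_le_iff₀' he0]
    exact (hεk 0).trans (mul_le_mul_of_nonneg_left
      ((min_le_right _ _).trans (min_le_left _ _)) he0.le)
  have hεB : ∀ k, L * ε * r₀ ≤ e * D.budget k := fun k => by
    have := (hεk k).trans (mul_le_mul_of_nonneg_left
      ((min_le_right _ _).trans (min_le_right _ _)) he0.le)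
    rw [← mul_div_assoc, le_div_iff₀ (by positivity)] at this
    linarith
  set M' := M + L * ε with hM'
  have hLε : 0 < L * ε := mul_pos hLpos hε
  have hM'pos : 0 < M' := by positivity
  set κ' := fun k => κ k + ε with hκ'
  set l' := fun k => l k + ε with hl'
  have hκ'pos : ∀ k, 0 < κ' k := fun k => add_pos_of_nonneg_of_pos (h.κ_nonneg k) hε
  have hκ'nn : ∀ k, 0 ≤ κ' k := fun k => (hκ'pos k).le
  have hl'pos : ∀ k, 0 < l' k := fun k => add_pos_of_nonneg_of_pos (h.l_nonneg k) hε
  have hmono' : Monotone (envelope M' κ' l') :=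
    envelope_mono hM'pos hκ'nn fun k => (hl'pos k).le
  have hi : ∀ a b, IntervalIntegrable (envelope M κ l) volume a b := h.intervalIntegrable
  have hi' : ∀ a b, IntervalIntegrable (envelope M' κ' l') volume a b := fun a b =>
    hmono'.intervalIntegrable
  have hge : ∀ c, 0 ≤ c → envelope M κ l c ≤ envelope M' κ' l' c := fun c hc =>
    le_envelope hM'pos hκ'nn ((envelope_le hM h.κ_nonneg c).trans (by linarith)) fun k => by
      have h1 := envelope_mul_le (l := l) hM h.κ_nonneg k (c := c)
      have h2 := mul_nonneg (envelope_nonneg (l := l) hM h.κ_nonneg c) (mul_nonneg hε.le hc)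
      simp only [hκ', hl']
      nlinarith
  have hge0 : ∀ c, 0 ≤ c → envelope M' κ' l' c ≥ 0 := fun c _ => envelope_nonneg hM'pos hκ'nn c
  set r₁ := r₀ * (1 - e) with hr₁
  have hr₁pos : 0 < r₁ := mul_pos hr₀pos (by linarith)
  have hr₁lt : r₁ < r₀ := by nlinarith
  have hge1 : ∀ c ∈ Set.Icc 0 r₁, ε * r₀ * (r₀ - c)⁻¹ ≤ envelope M' κ' l' c := by
    rintro c ⟨hc0, hc1⟩
    have hd : r₀ * e ≤ r₀ - c := by nlinarith
    have hd0 : 0 < r₀ - c := lt_of_lt_of_le (by positivity) hd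
    have hs : ε * r₀ * (r₀ - c)⁻¹ ≤ ε / e := by
      rw [← div_eq_mul_inv, div_le_div_iff₀ hd0 he0]
      nlinarith
    have hs0 : 0 ≤ ε * r₀ * (r₀ - c)⁻¹ := by positivity
    refine le_envelope hM'pos hκ'nn (hs.trans (hεM.trans (by linarith))) fun k => ?_
    have hlc : 0 ≤ ε * c := by positivity
    by_cases hk : κ k = 0
    · have h1 : 1 - l' k * c ≤ (r₀ - c) / r₀ := by
        rw [sub_div, div_self hr₀pos.ne', hr₀, div_div_eq_mul_div, div_one]
        have := mul_le_mul_of_nonneg_right (hmax k hk) hc0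
        simp only [hl']
        linarith
      calc ε * r₀ * (r₀ - c)⁻¹ * (1 - l' k * c) ≤ ε * r₀ * (r₀ - c)⁻¹ * ((r₀ - c) / r₀) :=
            mul_le_mul_of_nonneg_left h1 hs0
        _ = ε := by field_simp
        _ ≤ κ' k := by simp only [hκ']; linarith [h.κ_nonneg k]
    · have h1 : 1 - l' k * c ≤ 1 := by
        have := mul_nonneg (hl'pos k).le hc0
        linarith
      calc ε * r₀ * (r₀ - c)⁻¹ * (1 - l' k * c) ≤ ε * r₀ * (r₀ - c)⁻¹ * 1 :=
            mul_le_mul_of_nonneg_left h1 hs0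
        _ ≤ κ k := by rw [mul_one]; exact hs.trans (hεκ k hk)
        _ ≤ κ' k := by simp only [hκ']; linarith
  have hlog : L * ε * R ≤ ∫ y in (0 : ℝ)..r₁, envelope M' κ' l' y := by
    have h1 : ∫ y in (0 : ℝ)..r₁, ε * r₀ * (r₀ - y)⁻¹ = L * ε * R := by
      rw [intervalIntegral.integral_const_mul,
        intervalIntegral.integral_comp_sub_left (fun x => x⁻¹) r₀, sub_zero,
        integral_inv_of_pos (by linarith) hr₀pos]
      have : r₀ / (r₀ - r₁) = Real.exp (L * R / r₀) := by
        have : r₀ - r₁ = r₀ * e := by rw [hr₁]; ring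
        rw [this, he, Real.exp_neg]
        field_simp
      rw [this, Real.log_exp]
      field_simp
    rw [← h1]
    refine intervalIntegral.integral_mono_on hr₁pos.le ?_ (hi' _ _) hge1
    refine ContinuousOn.intervalIntegrable ?_
    rw [Set.uIcc_of_le hr₁pos.le]
    refine ContinuousOn.mul continuousOn_const (ContinuousOn.inv₀ (by fun_prop) fun y hy => ?_)
    have := hy.2
    linarith
  have hmid : ∀ k r, 0 ≤ r → r ≤ R →
      (o k + L * ε) * r ≤ D.budget k + ∫ y in (0 : ℝ)..r, envelope M' κ' l' y := by
    intro k r hr hrR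
    -- Before the cut-off, `o k * r₀ ≤ D.budget k` leaves the slack `e * D.budget k`.
    rcases le_total r r₁ with hr1 | hr1
    · have h1 : 0 ≤ ∫ y in (0 : ℝ)..r, envelope M' κ' l' y :=
        intervalIntegral.integral_nonneg hr fun y hy => hge0 y hy.1
      have h2 : (o k + L * ε) * r ≤ (o k + L * ε) * r₁ :=
        mul_le_mul_of_nonneg_left hr1 (by linarith [h.o_pos k])
      have h3 := mul_le_mul_of_nonneg_right (ho₀ k) (by linarith : 0 ≤ 1 - e)
      have h4 := mul_le_mul_of_nonneg_left hr₁lt.le hLε.le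
      have h5 := hεB k
      have h6 : o k * r₁ = o k * r₀ * (1 - e) := by rw [hr₁]; ring
      nlinarith
    · have h1 := h.mul_le k r hr
      rw [← intervalIntegral.integral_add_adjacent_intervals (hi 0 r₁) (hi r₁ r),
        hint0 r₁ hr₁pos.le hr₁lt.le] at h1
      rw [← intervalIntegral.integral_add_adjacent_intervals (hi' 0 r₁) (hi' r₁ r)]
      have h2 : ∫ y in r₁..r, envelope M κ l y ≤ ∫ y in r₁..r, envelope M' κ' l' y :=
        intervalIntegral.integral_mono_on hr1 (hi _ _) (hi' _ _)
          fun y hy => hge y (hr₁pos.le.trans hy.1)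
      have h3 := mul_le_mul_of_nonneg_left hrR hLε.le
      linarith
  refine ⟨M', κ', l', fun k => o k + L * ε, ⟨hM'pos, hκ'nn, fun k => (hl'pos k).le,
    fun k => by linarith [h.o_pos k], fun k => by linarith [h.o_le k],
    fun k hk => absurd hk (hl'pos k).ne', fun k r hr => ?_⟩, hκ'pos, ?_, fun k => ?_⟩
  · rcases le_total r R with hrR | hrR
    · exact hmid k r hr hrR
    · have h1 := hmid k R hRpos.le le_rfl
      rw [← intervalIntegral.integral_add_adjacent_intervals (hi' 0 R) (hi' R r)]
      have h2 : M' * (r - R) ≤ ∫ y in R..r, envelope M' κ' l' y := by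
        have : ∫ _ in R..r, M' = M' * (r - R) := by
          rw [intervalIntegral.integral_const, smul_eq_mul, mul_comm]
        rw [← this]
        refine intervalIntegral.integral_mono_on hrR intervalIntegrable_const (hi' _ _)
          fun y hy => ?_
        refine le_envelope hM'pos hκ'nn le_rfl fun k => ?_
        have hy1 : R ≤ y := hy.1
        have hy0 : 0 ≤ y := hRpos.le.trans hy1
        rcases (h.l_nonneg k).eq_or_lt with h0 | h0
        · have h3 := h.le_κ k h0.symm
          have h4 : L ≤ M * y := by
            have := hLR.trans hy1
            rwa [div_le_iff₀' hM] at this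
          have h5 := mul_le_mul_of_nonneg_right h4 hε.le
          have h6 : 0 ≤ L * ε * (ε * y) := by positivity
          simp only [hκ', hl', ← h0, hM']
          nlinarith
        · have h3 : 1 / l k ≤ y := (hlR k).trans hy1
          rw [div_le_iff₀ h0] at h3
          refine (mul_nonpos_of_nonneg_of_nonpos hM'pos.le ?_).trans (hκ'nn k)
          simp only [hl']
          nlinarith
      have h3 : (o k + L * ε) * (r - R) ≤ M' * (r - R) :=
        mul_le_mul_of_nonneg_right (by linarith [h.o_le k]) (by linarith)
      linarith
  · refine Finset.sum_le_sum fun k _ => mul_le_mul_of_nonneg_left ?_ (D.prob_pos k).le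
    have h1 := ratio_le (h.value_pos k) (h.o_pos k) hε (hLk k) hLpos
    refine le_trans (le_of_eq ?_) h1
    simp only [hκ', hl']
    congr 1
    ring
  · rw [div_le_div_iff₀ hM hM'pos]
    have := mul_le_mul_of_nonneg_right (h.o_le k) hLε.le
    rw [hM']
    linarith

/-- Every configuration yields a market on which no mechanism has a larger ratio. -/
theorem exists_market (h : Configuration D M κ l o) :
    ∃ J : BayesianMarket, J.bestRatio D ≤ configValue D κ l o ∧
      ∀ k, o k / M ≤ J.frac (D.budget k) := by
  by_cases hZ : ∃ k, κ k = 0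
  · obtain ⟨M', κ', l', o', h', hpos, hval, ho⟩ := h.exists_pos hZ
    obtain ⟨J, hJ1, hJ2⟩ := h'.exists_market_of_pos hpos
    exact ⟨J, hJ1.trans hval, fun k => (ho k).trans (hJ2 k)⟩
  · push Not at hZ
    exact h.exists_market_of_pos fun k => (h.κ_nonneg k).lt_of_ne (hZ k).symm

end Configuration

end

/-! ### The lines of a market, compactness, and existence of worst markets -/

section

/-! ### Truncation of the non-IC optimum -/

/-- A lower bound on the non-IC optimum that is at most `T` only depends on the distribution function
up to the level `T`. -/
lemma mul_le_integral_min {W : ℝ → ℝ} (hW : Monotone W) {a b T : ℝ} (haT : a ≤ T)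
    (h : ∀ r, 0 ≤ r → a * r ≤ b + ∫ y in (0 : ℝ)..r, W y) {r : ℝ} (hr : 0 ≤ r) :
    a * r ≤ b + ∫ y in (0 : ℝ)..r, min (W y) T := by
  have hmin : Monotone fun y => min (W y) T := hW.min monotone_const
  -- Before `s` nothing is cut off; after it the integral grows with slope `T ≥ a`.
  obtain ⟨s, hs0, hsr, h1, h2⟩ : ∃ s, 0 ≤ s ∧ s ≤ r ∧ (∀ y, 0 ≤ y → y < s → W y ≤ T) ∧
      ∀ y, y ≤ r → s < y → T ≤ W y := by
    by_cases hne : ∃ y, 0 ≤ y ∧ y ≤ r ∧ W y ≤ T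
    · obtain ⟨y₀, hy0, hyr, hy⟩ := hne
      set S := {y | 0 ≤ y ∧ y ≤ r ∧ W y ≤ T}
      have hbdd : BddAbove S := ⟨r, fun y hy => hy.2.1⟩
      have hmem : y₀ ∈ S := ⟨hy0, hyr, hy⟩
      have hs0 : 0 ≤ sSup S := hy0.trans (le_csSup hbdd hmem)
      refine ⟨sSup S, hs0, csSup_le ⟨y₀, hmem⟩ fun y hy => hy.2.1, fun y _ hlt => ?_,
        fun y hyr hlt => ?_⟩
      · obtain ⟨z, hz, hyz⟩ := exists_lt_of_lt_csSup ⟨y₀, hmem⟩ hlt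
        exact (hW hyz.le).trans hz.2.2
      · by_contra hc
        push Not at hc
        exact absurd (le_csSup hbdd ⟨hs0.trans hlt.le, hyr, hc.le⟩) (not_le.2 hlt)
    · push Not at hne
      exact ⟨0, le_rfl, hr, fun y h0 h1 => absurd h0 (not_le.2 h1),
        fun y hyr hy => (hne y hy.le hyr).le⟩
  have hi := fun a b => hmin.intervalIntegrable (μ := volume) (a := a) (b := b)
  have e1 : ∫ y in (0 : ℝ)..s, W y = ∫ y in (0 : ℝ)..s, min (W y) T := by
    refine intervalIntegral.integral_congr_ae ?_
    have : ∀ᵐ y : ℝ, y ≠ s := by simp [ae_iff, measure_singleton]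
    filter_upwards [this] with y hy hy2
    rw [Set.uIoc_of_le hs0] at hy2
    rw [min_eq_left (h1 y hy2.1.le (lt_of_le_of_ne hy2.2 hy))]
  have e2 : ∫ y in s..r, min (W y) T = T * (r - s) := by
    have : ∫ _ in s..r, T = T * (r - s) := by
      rw [intervalIntegral.integral_const, smul_eq_mul, mul_comm]
    rw [← this]
    refine intervalIntegral.integral_congr_ae (Filter.Eventually.of_forall fun y hy => ?_)
    rw [Set.uIoc_of_le hsr] at hy
    exact min_eq_right (h2 y hy.2 hy.1)
  rw [← intervalIntegral.integral_add_adjacent_intervals (hi 0 s) (hi s r), e2, ← e1]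
  have := h s hs0
  have := mul_le_mul_of_nonneg_right haT (sub_nonneg.2 hsr)
  linarith

variable {m : ℕ}

/-! ### The lines of a market -/

namespace BayesianMarket

/-- Supporting lines of the utilities that mechanisms can achieve, at the possible budgets. -/
structure Lines (I : BayesianMarket) (D : BudgetDistribution m) (κ l : Fin m → ℝ) : Prop where
  κ_nonneg : ∀ k, 0 ≤ κ k
  l_nonneg : ∀ k, 0 ≤ l k
  eq_icOpt : ∀ k, κ k + l k * D.budget k = I.icOpt (D.budget k)
  icOpt_le : ∀ k x, 0 ≤ x → I.icOpt x ≤ κ k + l k * x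

variable {I : BayesianMarket}

lemma exists_lines (I : BayesianMarket) (D : BudgetDistribution m) : ∃ κ l, I.Lines D κ l := by
  choose l hl0 hl using fun k =>
    exists_supporting_line I.icOpt_concaveOn I.icOpt_monotoneOn (D.budget_pos k)
  refine ⟨fun k => I.icOpt (D.budget k) - l k * D.budget k, l, fun k => ?_, hl0,
    fun k => sub_add_cancel _ _, fun k x hx => ?_⟩
  · have h1 := hl k 0 le_rfl
    have h2 := (I.G_nonneg 0).trans (I.G_le_icOpt (y := 0) (B := 0) (by simp))
    linarith
  · have := hl k x hx
    linarith

namespace Lines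

variable {D : BudgetDistribution (m + 1)} {κ l : Fin (m + 1) → ℝ}

/-- A posted price is a mechanism of budget `y * G y`, so it lies below the line at this budget. -/
lemma G_mul_le (h : I.Lines D κ l) (k : Fin (m + 1)) {y : ℝ} (hy : 0 ≤ y) :
    I.G y * (1 - l k * y) ≤ κ k := by
  have h1 := (I.G_le_icOpt (le_refl (y * I.G y))).trans
    (h.icOpt_le k _ (mul_nonneg hy (I.G_nonneg y)))
  linarith

lemma one_le_κ (h : I.Lines D κ l) {k : Fin (m + 1)} (hk : l k = 0) : 1 ≤ κ k := by
  refine le_of_tendsto I.G_tendsto ?_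
  filter_upwards [Filter.eventually_ge_atTop 0] with y hy
  simpa [hk] using h.G_mul_le k hy

lemma value_eq (h : I.Lines D κ l) :
    configValue D κ l (fun k => I.frac (D.budget k)) = I.bestRatio D := by
  rw [I.bestRatio_eq]
  simp only [configValue, h.eq_icOpt]

/-- A market with its lines is a configuration, when capped at the fraction that is bought by the
non-IC optimum with the largest budget. -/
lemma configuration (h : I.Lines D κ l) :
    Configuration D (I.frac (D.budget (Fin.last m))) κ l (fun k => I.frac (D.budget k)) where
  M_pos := I.frac_pos (D.budget_pos _)
  κ_nonneg := h.κ_nonneg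
  l_nonneg := h.l_nonneg
  o_pos k := I.frac_pos (D.budget_pos k)
  o_le k := I.frac_mono (D.budget_pos k) (D.budget_strictMono.monotone (Fin.le_last k))
  le_κ k hk := (I.frac_le_one (D.budget_pos _).le).trans (h.one_le_κ hk)
  mul_le k r hr := by
    set T := I.frac (D.budget (Fin.last m))
    have hT : 0 < T := I.frac_pos (D.budget_pos _)
    refine (mul_le_integral_min I.G_mono (T := T)
      (I.frac_mono (D.budget_pos k) (D.budget_strictMono.monotone (Fin.le_last k)))
      (fun r hr => I.frac_mul_le (D.budget_pos k).le hr) hr).trans ?_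
    gcongr
    refine intervalIntegral.integral_mono_on hr
      (I.G_mono.min monotone_const).intervalIntegrable
      (envelope_mono hT h.κ_nonneg h.l_nonneg).intervalIntegrable fun y hy => ?_
    refine le_envelope hT h.κ_nonneg (min_le_right _ _) fun k => ?_
    rcases le_total (1 - l k * y) 0 with h0 | h0
    · exact (mul_nonpos_of_nonneg_of_nonpos (le_min (I.G_nonneg y) hT.le) h0).trans (h.κ_nonneg k)
    · exact (mul_le_mul_of_nonneg_right (min_le_left _ _) h0).trans (h.G_mul_le k hy.1)

end Lines

end BayesianMarket

/-! ### Existence of worst markets -/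

/-- Parameters that include, up to scaling, those of all markets. -/
def candidates (D : BudgetDistribution (m + 1)) :
    Set ((Fin (m + 1) → ℝ) × (Fin (m + 1) → ℝ) × (Fin (m + 1) → ℝ)) :=
  Set.Icc (0, 0, fun k => D.budget k / D.budget (Fin.last m)) (1, fun k => 1 / D.budget k, 1) ∩
    {x | x.2.2 (Fin.last m) = 1 ∧ ∀ k r, 0 ≤ r →
      x.2.2 k * r ≤ D.budget k + ∫ y in (0 : ℝ)..r, envelope 1 x.1 x.2.1 y}

variable {D : BudgetDistribution (m + 1)}

/-- The only condition not built in is that horizontal lines are not below `1`. Otherwise the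
envelope is bounded by some `κ k < 1`, and the constraint of the last budget, whose `o` is `1`,
fails at a large price. -/
lemma candidates.configuration {x : (Fin (m + 1) → ℝ) × (Fin (m + 1) → ℝ) × (Fin (m + 1) → ℝ)}
    (h : x ∈ candidates D) : Configuration D 1 x.1 x.2.1 x.2.2 := by
  obtain ⟨⟨⟨h1, h2, h3⟩, h4, -, h6⟩, h7, h8⟩ := h
  refine ⟨one_pos, h1, h2, fun k => (div_pos (D.budget_pos k) (D.budget_pos _)).trans_le (h3 k), h6,
    fun k hk => ?_, h8⟩
  by_contra hc
  push Not at hc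
  have h9 : ∀ r, 0 ≤ r → r ≤ D.budget (Fin.last m) + x.1 k * r := fun r hr => by
    have h10 := h8 (Fin.last m) r hr
    rw [h7, one_mul] at h10
    refine h10.trans (add_le_add_right ?_ _)
    have : ∫ _ in (0 : ℝ)..r, x.1 k = x.1 k * r := by
      rw [intervalIntegral.integral_const, smul_eq_mul, sub_zero, mul_comm]
    rw [← this]
    refine intervalIntegral.integral_mono_on hr
      (envelope_mono one_pos h1 h2).intervalIntegrable intervalIntegrable_const fun y _ => ?_
    have := envelope_mul_le (l := x.2.1) one_pos h1 k (c := y)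
    simpa [hk] using this
  have h10 := h9 ((D.budget (Fin.last m) + 1) / (1 - x.1 k))
    (div_nonneg (by linarith [D.budget_pos (Fin.last m)]) (by linarith))
  have h11 : (1 - x.1 k) * ((D.budget (Fin.last m) + 1) / (1 - x.1 k)) =
    D.budget (Fin.last m) + 1 := mul_div_cancel₀ _ (by linarith)
  linarith

/-- Zero intercepts must be allowed in the limit, so the pole is excluded; it is a single price and
does not matter for integrals. -/
lemma tendsto_piece {M c κ₀ l₀ : ℝ} {κ l : ℕ → ℝ} (hM : 0 < M) (hκ0 : 0 ≤ κ₀) (hκ : ∀ n, 0 ≤ κ n)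
    (h : Filter.Tendsto κ Filter.atTop (nhds κ₀)) (h' : Filter.Tendsto l Filter.atTop (nhds l₀))
    (hc : 1 - l₀ * c ≠ 0) :
    Filter.Tendsto (fun n => piece M (κ n) (l n) c) Filter.atTop (nhds (piece M κ₀ l₀ c)) := by
  have ha : Filter.Tendsto (fun n => 1 - l n * c) Filter.atTop (nhds (1 - l₀ * c)) :=
    tendsto_const_nhds.sub (h'.mul_const c)
  have hpos : ∀ κ l, 0 < 1 - l * c → piece M κ l c = min M (κ / (1 - l * c)) := by
    intro κ l hl
    unfold piece
    simp only [← le_div_iff₀ hl, min_def]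
  have hneg : ∀ κ l, 0 ≤ κ → 1 - l * c < 0 → piece M κ l c = M := by
    intro κ l hκ hl
    exact if_pos ((mul_nonpos_of_nonneg_of_nonpos hM.le hl.le).trans hκ)
  rcases lt_or_gt_of_ne hc with h0 | h0
  · rw [hneg _ _ hκ0 h0]
    refine tendsto_const_nhds.congr' ?_
    filter_upwards [ha.eventually_lt_const h0] with n hn using (hneg _ _ (hκ n) hn).symm
  · rw [hpos _ _ h0]
    refine (tendsto_const_nhds.min (h.div ha hc)).congr' ?_
    filter_upwards [ha.eventually_const_lt h0] with n hn using (hpos _ _ hn).symm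

lemma isClosed_candidates (D : BudgetDistribution (m + 1)) : IsClosed (candidates D) := by
  refine IsSeqClosed.isClosed fun xs x hxs hx => ?_
  have hbox : x ∈ Set.Icc (0, 0, fun k => D.budget k / D.budget (Fin.last m))
      ((1, fun k => 1 / D.budget k, 1) :
        (Fin (m + 1) → ℝ) × (Fin (m + 1) → ℝ) × (Fin (m + 1) → ℝ)) :=
    isClosed_Icc.mem_of_tendsto hx (Filter.Eventually.of_forall fun n => (hxs n).1)
  have t1 : ∀ k, Filter.Tendsto (fun n => (xs n).1 k) Filter.atTop (nhds (x.1 k)) := fun k =>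
    ((continuous_apply k).comp continuous_fst).continuousAt.tendsto.comp hx
  have t2 : ∀ k, Filter.Tendsto (fun n => (xs n).2.1 k) Filter.atTop (nhds (x.2.1 k)) := fun k =>
    ((continuous_apply k).comp (continuous_fst.comp continuous_snd)).continuousAt.tendsto.comp hx
  have t3 : ∀ k, Filter.Tendsto (fun n => (xs n).2.2 k) Filter.atTop (nhds (x.2.2 k)) := fun k =>
    ((continuous_apply k).comp (continuous_snd.comp continuous_snd)).continuousAt.tendsto.comp hx
  refine ⟨hbox, ?_, fun k r hr => ?_⟩
  · refine tendsto_nhds_unique (t3 (Fin.last m)) (tendsto_const_nhds.congr fun n => ?_)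
    exact (hxs n).2.1.symm
  · refine le_of_tendsto_of_tendsto' ((t3 k).mul_const r) (Filter.Tendsto.const_add _ ?_)
      fun n => (hxs n).2.2 k r hr
    have hκ : ∀ n, 0 ≤ (xs n).1 := fun n => (hxs n).1.1.1
    refine intervalIntegral.tendsto_integral_filter_of_dominated_convergence (fun _ => 1)
      (Filter.Eventually.of_forall fun n => ?_) (Filter.Eventually.of_forall fun n => ?_)
      intervalIntegrable_const ?_
    · exact (envelope_mono one_pos (hκ n) (hxs n).1.1.2.1).measurable.aestronglyMeasurable
    · refine Filter.Eventually.of_forall fun y _ => ?_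
      rw [Real.norm_eq_abs, abs_of_nonneg (envelope_nonneg one_pos (hκ n) y)]
      exact envelope_le one_pos (hκ n) y
    · have : ∀ᵐ y : ℝ, ∀ k, y ≠ 1 / x.2.1 k :=
        ae_all_iff.2 fun k => by simp [ae_iff, measure_singleton]
      filter_upwards [this] with y hy _
      unfold envelope
      refine Filter.Tendsto.finset_inf'_nhds_apply Finset.univ_nonempty fun k _ => ?_
      refine tendsto_piece one_pos (hbox.1.1 k) (fun n => hκ n k) (t1 k) (t2 k) fun h0 => hy k ?_
      have hl : x.2.1 k ≠ 0 := fun h1 => by simp [h1] at h0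
      rw [eq_div_iff hl]
      linarith

lemma isCompact_candidates (D : BudgetDistribution (m + 1)) : IsCompact (candidates D) :=
  isCompact_Icc.of_isClosed_subset (isClosed_candidates D) Set.inter_subset_left

lemma candidates_nonempty (D : BudgetDistribution (m + 1)) : (candidates D).Nonempty := by
  refine ⟨(1, 0, 1), ⟨⟨zero_le_one, le_rfl, fun k => ?_⟩, le_rfl, fun k => ?_, le_rfl⟩, rfl,
    fun k r hr => ?_⟩
  · exact (div_le_one (D.budget_pos _)).2 (D.budget_strictMono.monotone (Fin.le_last k))
  · exact one_div_nonneg.2 (D.budget_pos k).le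
  · have : envelope 1 (1 : Fin (m + 1) → ℝ) 0 = fun _ => 1 := by
      funext c
      refine le_antisymm (envelope_le one_pos (fun _ => zero_le_one) c)
        (le_envelope one_pos (fun _ => zero_le_one) le_rfl fun k => by simp)
    simp only [this]
    simp [(D.budget_pos k).le]

/-- Dividing by the non-IC fraction at the largest budget normalizes the last `o` to `1`; then
`icOpt ≤ frac` puts the lines into the box, and `frac_mul_budget_le` bounds the other `o k` from
below. -/
lemma exists_candidate (I : BayesianMarket) (D : BudgetDistribution (m + 1)) :
    ∃ x ∈ candidates D, configValue D x.1 x.2.1 x.2.2 = I.bestRatio D := by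
  obtain ⟨κ, l, h⟩ := I.exists_lines D
  have hT : 0 < I.frac (D.budget (Fin.last m)) := I.frac_pos (D.budget_pos _)
  have hs := h.configuration.scale
  set T := I.frac (D.budget (Fin.last m)) with hTdef
  have hle : ∀ k, κ k / T + l k / T * D.budget k ≤ 1 := fun k => by
    rw [div_mul_eq_mul_div, ← add_div, div_le_one hT, h.eq_icOpt]
    exact (I.icOpt_le_frac (D.budget_pos k)).trans
      (I.frac_mono (D.budget_pos k) (D.budget_strictMono.monotone (Fin.le_last k)))
  refine ⟨(fun k => κ k / T, fun k => l k / T, fun k => I.frac (D.budget k) / T),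
    ⟨⟨⟨hs.κ_nonneg, hs.l_nonneg, fun k => ?_⟩, fun k => ?_, fun k => ?_, hs.o_le⟩,
    div_self hT.ne', hs.mul_le⟩, ?_⟩
  · change D.budget k / D.budget (Fin.last m) ≤ I.frac (D.budget k) / T
    rw [le_div_iff₀ hT]
    exact I.frac_mul_budget_le (D.budget_pos k) (D.budget_strictMono.monotone (Fin.le_last k))
  · have := hle k
    have := mul_nonneg (hs.l_nonneg k) (D.budget_pos k).le
    change κ k / T ≤ 1
    linarith
  · have := hle k
    have := hs.κ_nonneg k
    change l k / T ≤ 1 / D.budget k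
    rw [le_div_iff₀ (D.budget_pos k)]
    linarith
  · exact (Configuration.configValue_scale hT).trans h.value_eq

/-- A worst market exists in which the non-IC optimum with the largest budget buys everything. -/
theorem exists_isWorst (D : BudgetDistribution (m + 1)) :
    ∃ I : BayesianMarket, I.IsWorst D ∧ I.frac (D.budget (Fin.last m)) = 1 := by
  have hcont : ContinuousOn (fun x : (Fin (m + 1) → ℝ) × (Fin (m + 1) → ℝ) × (Fin (m + 1) → ℝ) =>
      configValue D x.1 x.2.1 x.2.2) (candidates D) := by
    unfold configValue
    refine continuousOn_finsetSum _ fun k _ => continuousOn_const.mul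
      (ContinuousOn.div (by fun_prop) (by fun_prop) fun x hx => ?_)
    exact ((candidates.configuration hx).o_pos k).ne'
  obtain ⟨x, hx, hmin⟩ := (isCompact_candidates D).exists_isMinOn (candidates_nonempty D) hcont
  -- The minimizer may have zero intercepts; a market that is no better for mechanisms exists all
  -- the same.
  obtain ⟨I, hI1, hI2⟩ := (candidates.configuration hx).exists_market
  refine ⟨I, fun J => ?_, le_antisymm (I.frac_le_one (D.budget_pos _).le) ?_⟩
  · obtain ⟨y, hy, hyJ⟩ := exists_candidate J D
    exact hI1.trans ((hmin hy).trans hyJ.le)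
  · have := hI2 (Fin.last m)
    rwa [hx.2.1, div_one] at this

/-- The tool for perturbation arguments: a competitor need not be a market, only a configuration of
any size. -/
lemma BayesianMarket.IsWorst.le_configValue {I : BayesianMarket} (h : I.IsWorst D) {M : ℝ}
    {κ l o : Fin (m + 1) → ℝ} (hc : Configuration D M κ l o) :
    I.bestRatio D ≤ configValue D κ l o := by
  obtain ⟨J, hJ, -⟩ := hc.exists_market
  exact (h J).trans hJ

end

/-! ### Perturbation of worst markets -/

section

variable {m : ℕ}

/-! ### The shape of worst markets -/

namespace BayesianMarket

variable {I : BayesianMarket} {D : BudgetDistribution (m + 1)} {κ l : Fin (m + 1) → ℝ}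

lemma integral_G_le (I : BayesianMarket) {M : ℝ} (hM : 1 ≤ M) (hκ : ∀ k, 0 ≤ κ k)
    (hl : ∀ k, 0 ≤ l k) (hG : ∀ k y, 0 ≤ y → I.G y * (1 - l k * y) ≤ κ k) {a b : ℝ} (ha : 0 ≤ a)
    (hab : a ≤ b) : ∫ y in a..b, I.G y ≤ ∫ y in a..b, envelope M κ l y :=
  intervalIntegral.integral_mono_on hab (I.G_intervalIntegrable _ _)
    (envelope_mono (one_pos.trans_le hM) hκ hl).intervalIntegrable fun y hy =>
      le_envelope (one_pos.trans_le hM) hκ ((I.G_le_one y).trans hM)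
        fun k => hG k y (ha.trans hy.1)

/-- If everything can be bought in expectation, then this is so at a posted price. -/
lemma G_eq_one_of_icOpt_eq_one (I : BayesianMarket) {B : ℝ} (hB : 0 < B) (h : I.icOpt B = 1) :
    I.G B = 1 := by
  refine le_antisymm (I.G_le_one B) ?_
  by_contra hc
  push Not at hc
  obtain ⟨q, hq1, hq2⟩ := exists_between hc
  have hcont : ContinuousAt I.G B := I.G_continuousOn.continuousAt (Ici_mem_nhds hB)
  obtain ⟨s, hs, hsB⟩ := Metric.continuousAt_iff.1 hcont (q - I.G B) (by linarith)
  have hGs : I.G (B + s / 2) ≤ q := by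
    have := hsB (x := B + s / 2) (by
      rw [Real.dist_eq, add_sub_cancel_left, abs_of_pos (by linarith)]; linarith)
    rw [Real.dist_eq] at this
    linarith [(abs_lt.1 this).2]
  set b := B + s / 2 with hb
  have hb0 : 0 < b := by linarith
  -- For this multiplier, prices up to `b` lose because they buy at most `q`, and higher prices
  -- because they pay too much: both stay below `1 - lam * B`.
  set lam := min ((1 - q) / (2 * B)) (1 / b) with hlam
  have hlam0 : 0 < lam := lt_min (div_pos (by linarith) (by linarith)) (one_div_pos.2 hb0)
  have h1 : lam * B < 1 - q := by
    have : lam ≤ (1 - q) / (2 * B) := min_le_left _ _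
    rw [le_div_iff₀ (by linarith)] at this
    linarith
  have h2 : lam * b ≤ 1 := by
    have : lam ≤ 1 / b := min_le_right _ _
    rwa [le_div_iff₀ hb0] at this
  have h3 := I.icOpt_le (κ := max q (1 - lam * b)) hB.le hlam0.le fun y hy => by
    rcases le_total y b with hyb | hyb
    · refine le_trans ?_ (le_max_left _ _)
      refine le_trans ?_ ((I.G_mono hyb).trans hGs)
      have := mul_nonneg (I.G_nonneg y) (mul_nonneg hlam0.le hy)
      linarith
    · refine le_trans ?_ (le_max_right _ _)
      have h4 := mul_le_mul_of_nonneg_left hyb hlam0.le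
      rcases le_total (1 - lam * y) 0 with h5 | h5
      · exact (mul_nonpos_of_nonneg_of_nonpos (I.G_nonneg y) h5).trans (by linarith)
      · exact (mul_le_of_le_one_left h5 (I.G_le_one y)).trans (by linarith)
  rw [h] at h3
  have h4 : max q (1 - lam * b) < 1 - lam * B := by
    refine max_lt (by linarith) ?_
    have := mul_lt_mul_of_pos_left (show B < b by linarith) hlam0
    linarith
  linarith

/-- Buying everything leaves some slack in the budget if every seller can be offered all of it. -/
lemma exists_slack (I : BayesianMarket) {B : ℝ} (hB : 0 < B) (h : I.G B = 1) :
    ∃ d, 0 < d ∧ ∀ r, 0 ≤ r → r + d ≤ B + ∫ y in (0 : ℝ)..r, I.G y := by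
  have hi := I.G_intervalIntegrable
  have hone : ∀ a b : ℝ, ∫ _ in a..b, (1 : ℝ) = b - a := fun a b => by simp
  -- The difference of `r` and the integral of `G` up to `r` increases until `B` and is constant
  -- afterwards, where `G = 1`.
  refine ⟨∫ y in (0 : ℝ)..B, I.G y, ?_, fun r hr => ?_⟩
  · have hcont : ContinuousAt I.G B := I.G_continuousOn.continuousAt (Ici_mem_nhds hB)
    obtain ⟨s, hs, hsB⟩ := Metric.continuousAt_iff.1 hcont (1 / 2) (by norm_num)
    set a := max (B / 2) (B - s / 2)
    have ha1 : B / 2 ≤ a := le_max_left _ _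
    have ha2 : B - s / 2 ≤ a := le_max_right _ _
    have haB : a < B := max_lt (by linarith) (by linarith)
    have ha : 1 / 2 ≤ I.G a := by
      have := hsB (x := a) (by
        rw [Real.dist_eq, abs_sub_comm, abs_of_pos (by linarith)]; linarith)
      rw [Real.dist_eq, h] at this
      linarith [(abs_lt.1 this).1]
    rw [← intervalIntegral.integral_add_adjacent_intervals (hi 0 a) (hi a B)]
    have h1 : 0 ≤ ∫ y in (0 : ℝ)..a, I.G y :=
      intervalIntegral.integral_nonneg (by linarith) fun y _ => I.G_nonneg y
    have h2 : ∫ _ in a..B, (1 / 2 : ℝ) ≤ ∫ y in a..B, I.G y :=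
      intervalIntegral.integral_mono_on haB.le intervalIntegrable_const (hi _ _)
        fun y hy => ha.trans (I.G_mono hy.1)
    rw [intervalIntegral.integral_const, smul_eq_mul] at h2
    linarith
  · rcases le_total r B with hrB | hrB
    · rw [← intervalIntegral.integral_add_adjacent_intervals (hi 0 r) (hi r B)]
      have : ∫ y in r..B, I.G y ≤ ∫ _ in r..B, (1 : ℝ) :=
        intervalIntegral.integral_mono_on hrB (hi _ _) intervalIntegrable_const
          fun y _ => I.G_le_one y
      rw [hone] at this
      linarith
    · rw [← intervalIntegral.integral_add_adjacent_intervals (hi 0 B) (hi B r)]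
      have : ∫ _ in B..r, (1 : ℝ) ≤ ∫ y in B..r, I.G y :=
        intervalIntegral.integral_mono_on hrB intervalIntegrable_const (hi _ _)
          fun y hy => h ▸ I.G_mono hy.1
      rw [hone] at this
      linarith

namespace Lines

/-- In a worst market, larger budgets strictly help. -/
lemma l_pos (h : I.Lines D κ l) (hw : I.IsWorst D) (k : Fin (m + 1)) : 0 < l k := by
  refine (h.l_nonneg k).lt_of_ne fun h0 => ?_
  -- A horizontal line forces both optima to be `1`, and then the dual constraints have slack. This
  -- allows tilting the line by `ε` while raising `o` to `1 + L * ε`.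
  have hZ : ∀ k, l k = 0 → κ k = 1 ∧ I.frac (D.budget k) = 1 ∧
      ∃ d, 0 < d ∧ ∀ r, 0 ≤ r → r + d ≤ D.budget k + ∫ y in (0 : ℝ)..r, I.G y := by
    intro k hk
    have hB := D.budget_pos k
    have h1 := h.one_le_κ hk
    have h2 := h.eq_icOpt k
    rw [hk, zero_mul, add_zero] at h2
    have h3 := I.icOpt_le_one hB.le
    have h4 := I.icOpt_le_frac hB
    have h5 := I.frac_le_one hB.le
    refine ⟨by linarith, by linarith, I.exists_slack hB
      (I.G_eq_one_of_icOpt_eq_one hB (by linarith))⟩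
  choose! hZκ hZo d hd0 hd using hZ
  -- Larger than every budget, so that `(1 + ε * D.budget k) / (1 + L * ε)` is below `1`.
  set L := D.budget (Fin.last m) + 1 with hL
  have hL0 : 0 < L := by linarith [D.budget_pos (Fin.last m)]
  set R := ∑ k, 1 / l k + L with hR
  have hsum : 0 ≤ ∑ k, 1 / l k := Finset.sum_nonneg fun k _ => one_div_nonneg.2 (h.l_nonneg k)
  have hR0 : 0 < R := by linarith
  obtain ⟨ε, hε, hεk⟩ := exists_pos_forall_le
    (a := fun k => if l k = 0 then d k / (L * R) else 1) (fun k => by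
      split_ifs with hk
      · exact div_pos (hd0 k hk) (by positivity)
      · exact one_pos)
  have hεd : ∀ k, l k = 0 → L * ε * R ≤ d k := fun k hk => by
    have := hεk k
    rw [if_pos hk, le_div_iff₀ (by positivity)] at this
    linarith
  have hLε : 0 < L * ε := by positivity
  set l' : Fin (m + 1) → ℝ := fun k => if l k = 0 then ε else l k with hl'
  set o' : Fin (m + 1) → ℝ := fun k => if l k = 0 then 1 + L * ε else I.frac (D.budget k) with ho'
  have hl'pos : ∀ k, 0 < l' k := fun k => by
    simp only [hl']
    split_ifs with hk
    · exact hε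
    · exact (h.l_nonneg k).lt_of_ne (Ne.symm hk)
  have hll' : ∀ k, l k ≤ l' k := fun k => by
    simp only [hl']
    split_ifs with hk
    · rw [hk]; exact hε.le
    · exact le_rfl
  have hM : 1 ≤ 1 + L * ε := by linarith
  have hG' : ∀ k y, 0 ≤ y → I.G y * (1 - l' k * y) ≤ κ k := fun k y hy => by
    refine le_trans (mul_le_mul_of_nonneg_left ?_ (I.G_nonneg y)) (h.G_mul_le k hy)
    have := mul_le_mul_of_nonneg_right (hll' k) hy
    linarith
  have hint : ∀ r, 0 ≤ r → ∫ y in (0 : ℝ)..r, I.G y ≤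
      ∫ y in (0 : ℝ)..r, envelope (1 + L * ε) κ l' y := fun r hr =>
    I.integral_G_le hM h.κ_nonneg (fun k => (hl'pos k).le) hG' le_rfl hr
  have hi' : ∀ a b, IntervalIntegrable (envelope (1 + L * ε) κ l') volume a b := fun a b =>
    (envelope_mono (by linarith) h.κ_nonneg fun k => (hl'pos k).le).intervalIntegrable
  have hlarge : ∀ y, R ≤ y → envelope (1 + L * ε) κ l' y = 1 + L * ε := by
    intro y hy
    have hy0 : 0 ≤ y := hR0.le.trans hy
    refine le_antisymm (envelope_le (by linarith) h.κ_nonneg y)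
      (le_envelope (by linarith) h.κ_nonneg le_rfl fun k => ?_)
    simp only [hl']
    split_ifs with hk
    · rw [hZκ k hk]
      have h1 : L ≤ y := by linarith
      have h2 : 0 ≤ ε * (y - L) := mul_nonneg hε.le (by linarith)
      have h3 : 0 ≤ L * ε * (ε * y) := by positivity
      nlinarith
    · have h1 : 1 / l k ≤ y := by
        have := Finset.single_le_sum (f := fun k => 1 / l k)
          (fun k _ => one_div_nonneg.2 (h.l_nonneg k)) (Finset.mem_univ k)
        linarith
      rw [div_le_iff₀ ((h.l_nonneg k).lt_of_ne (Ne.symm hk))] at h1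
      exact (mul_nonpos_of_nonneg_of_nonpos (by linarith) (by linarith)).trans (h.κ_nonneg k)
  have hconf : Configuration D (1 + L * ε) κ l' o' :=
    { M_pos := by linarith
      κ_nonneg := h.κ_nonneg
      l_nonneg := fun k => (hl'pos k).le
      o_pos := fun k => by
        simp only [ho']
        split_ifs with hk
        · linarith
        · exact I.frac_pos (D.budget_pos k)
      o_le := fun k => by
        simp only [ho']
        split_ifs with hk
        · exact le_rfl
        · exact (I.frac_le_one (D.budget_pos k).le).trans hM
      le_κ := fun k hk => absurd hk (hl'pos k).ne'
      mul_le := fun k r hr => by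
        simp only [ho']
        split_ifs with hk
        · have key : ∀ r, 0 ≤ r → r ≤ R → (1 + L * ε) * r ≤
              D.budget k + ∫ y in (0 : ℝ)..r, envelope (1 + L * ε) κ l' y := fun r hr hrR => by
            have h1 := hd k hk r hr
            have h2 := mul_le_mul_of_nonneg_left hrR hLε.le
            have h3 := hεd k hk
            have h4 := hint r hr
            linarith
          rcases le_total r R with hrR | hrR
          · exact key r hr hrR
          · rw [← intervalIntegral.integral_add_adjacent_intervals (hi' 0 R) (hi' R r)]
            have h1 := key R hR0.le le_rfl
            have h2 : ∫ y in R..r, envelope (1 + L * ε) κ l' y = (1 + L * ε) * (r - R) := by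
              have : ∫ _ in R..r, (1 + L * ε) = (1 + L * ε) * (r - R) := by
                rw [intervalIntegral.integral_const, smul_eq_mul, mul_comm]
              rw [← this]
              refine intervalIntegral.integral_congr fun y hy => ?_
              rw [Set.uIcc_of_le hrR] at hy
              exact hlarge y hy.1
            rw [h2]
            linarith
        · have h1 := I.frac_mul_le (D.budget_pos k).le hr
          have h2 := hint r hr
          linarith }
  have hle := hw.le_configValue hconf
  rw [← h.value_eq] at hle
  refine absurd hle (not_le.2 ?_)
  refine Finset.sum_lt_sum (fun i _ => ?_) ⟨k, Finset.mem_univ k, ?_⟩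
  · refine mul_le_mul_of_nonneg_left ?_ (D.prob_pos i).le
    simp only [hl', ho']
    split_ifs with hi
    · rw [hZκ i hi, hZo i hi, hi, div_one, div_le_iff₀ (by linarith)]
      have := D.budget_strictMono.monotone (Fin.le_last i)
      nlinarith
    · exact le_rfl
  · refine mul_lt_mul_of_pos_left ?_ (D.prob_pos k)
    simp only [hl', ho', if_pos h0.symm]
    rw [hZκ k h0.symm, hZo k h0.symm, ← h0, div_one, div_lt_iff₀ (by linarith)]
    have := D.budget_strictMono.monotone (Fin.le_last k)
    nlinarith

/-- The distribution function of a worst market is the largest one below the lines, as far as it is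
relevant to the non-IC optimum. -/
lemma G_eq_envelope (h : I.Lines D κ l) (hw : I.IsWorst D) {y : ℝ} (hy : 0 ≤ y)
    (hT : I.G y < I.frac (D.budget (Fin.last m))) : I.G y = envelope 2 κ l y := by
  set T := I.frac (D.budget (Fin.last m)) with hTdef
  have hl := h.l_pos hw
  have hT1 : T ≤ 1 := I.frac_le_one (D.budget_pos _).le
  have hT0 : 0 < T := I.frac_pos (D.budget_pos _)
  have hG : ∀ k y, 0 ≤ y → I.G y * (1 - l k * y) ≤ κ k := fun k y hy => h.G_mul_le k hy
  have hWmono : Monotone (envelope 2 κ l) := envelope_mono two_pos h.κ_nonneg h.l_nonneg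
  have hi := I.G_intervalIntegrable
  have hi' : ∀ a b, IntervalIntegrable (envelope 2 κ l) volume a b := fun a b =>
    hWmono.intervalIntegrable
  refine le_antisymm (le_envelope two_pos h.κ_nonneg ((I.G_le_one y).trans one_le_two)
    fun k => hG k y hy) ?_
  by_contra hc
  push Not at hc
  -- A gap between `G` and the envelope below the level `T` gives slack at the largest budget, so
  -- its `o` can be raised beyond `T`. The cap `2` leaves room for this, as `T ≤ 1`.
  obtain ⟨q, hq1, hq2⟩ := exists_between (lt_min hT hc)
  obtain ⟨hqT, hqW⟩ := lt_min_iff.1 hq2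
  obtain ⟨s, hs, hGs⟩ : ∃ s, 0 < s ∧ I.G (y + 2 * s) ≤ q := by
    have hcont : ContinuousWithinAt I.G (Set.Ici 0) y := I.G_continuousOn y hy
    obtain ⟨s, hs, hsB⟩ := Metric.continuousWithinAt_iff.1 hcont (q - I.G y) (by linarith)
    refine ⟨s / 4, by linarith, ?_⟩
    have := hsB (x := y + 2 * (s / 4)) (show 0 ≤ y + 2 * (s / 4) by linarith) (by
      rw [Real.dist_eq, add_sub_cancel_left, abs_of_pos (by linarith)]; linarith)
    rw [Real.dist_eq] at this
    linarith [(abs_lt.1 this).2]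
  set δ := min ((T - q) * s) ((envelope 2 κ l y - q) * s) with hδ
  have hδ0 : 0 < δ := lt_min (mul_pos (by linarith) hs) (mul_pos (by linarith) hs)
  have hslack : ∀ r, 0 ≤ r →
      T * r + δ ≤ D.budget (Fin.last m) + ∫ z in (0 : ℝ)..r, envelope 2 κ l z := by
    intro r hr
    have hW : ∀ a b, 0 ≤ a → a ≤ b → ∫ z in a..b, I.G z ≤ ∫ z in a..b, envelope 2 κ l z :=
      fun a b ha hab => I.integral_G_le one_le_two h.κ_nonneg h.l_nonneg hG ha hab
    have hconst : ∀ a b q : ℝ, ∫ _ in a..b, q = q * (b - a) := fun a b q => by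
      rw [intervalIntegral.integral_const, smul_eq_mul, mul_comm]
    -- Up to `y + s` the slack comes from the constraint at `y + 2 * s`, before which `G ≤ q < T`;
    -- later it comes from the area between `G` and the envelope on `[y, y + s]`.
    rcases le_total r (y + s) with hrs | hrs
    · have h1 := I.frac_mul_le (D.budget_pos (Fin.last m)).le (show 0 ≤ y + 2 * s by linarith)
      rw [← intervalIntegral.integral_add_adjacent_intervals (hi 0 r) (hi r _)] at h1
      have h2 : ∫ z in r..(y + 2 * s), I.G z ≤ ∫ _ in r..(y + 2 * s), q :=
        intervalIntegral.integral_mono_on (by linarith) (hi _ _) intervalIntegrable_const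
          fun z hz => (I.G_mono hz.2).trans hGs
      rw [hconst] at h2
      have h3 := hW 0 r le_rfl hr
      have h4 : (T - q) * s ≤ (T - q) * (y + 2 * s - r) :=
        mul_le_mul_of_nonneg_left (by linarith) (by linarith)
      have h5 : δ ≤ (T - q) * s := min_le_left _ _
      nlinarith
    · have h1 := I.frac_mul_le (D.budget_pos (Fin.last m)).le hr
      rw [← intervalIntegral.integral_add_adjacent_intervals (hi 0 y) (hi y r),
        ← intervalIntegral.integral_add_adjacent_intervals (hi y (y + s)) (hi (y + s) r)] at h1
      rw [← intervalIntegral.integral_add_adjacent_intervals (hi' 0 y) (hi' y r),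
        ← intervalIntegral.integral_add_adjacent_intervals (hi' y (y + s)) (hi' (y + s) r)]
      have h2 := hW 0 y le_rfl hy
      have h3 := hW (y + s) r (by linarith) hrs
      have h4 : ∫ z in y..(y + s), I.G z ≤ ∫ _ in y..(y + s), q :=
        intervalIntegral.integral_mono_on (by linarith) (hi _ _) intervalIntegrable_const
          fun z hz => (I.G_mono (hz.2.trans (by linarith))).trans hGs
      have h5 : ∫ _ in y..(y + s), envelope 2 κ l y ≤ ∫ z in y..(y + s), envelope 2 κ l z :=
        intervalIntegral.integral_mono_on (by linarith) intervalIntegrable_const (hi' _ _)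
          fun z hz => hWmono hz.1
      rw [hconst] at h4 h5
      have h6 : δ ≤ (envelope 2 κ l y - q) * s := min_le_right _ _
      linarith
  set R := ∑ k, 1 / l k + 1 with hR
  have hsum : 0 ≤ ∑ k, 1 / l k := Finset.sum_nonneg fun k _ => one_div_nonneg.2 (h.l_nonneg k)
  have hR0 : 0 < R := by linarith
  -- The raise costs at most `δ` up to `R`; beyond `R` the envelope is `2 ≥ T + d`.
  set d := min (δ / R) 1 with hd
  have hd0 : 0 < d := lt_min (div_pos hδ0 hR0) one_pos
  have hd1 : d ≤ 1 := min_le_right _ _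
  have hdR : d * R ≤ δ := by
    have : d ≤ δ / R := min_le_left _ _
    rwa [le_div_iff₀ hR0] at this
  set o' : Fin (m + 1) → ℝ := fun k => if k = Fin.last m then T + d else I.frac (D.budget k)
    with ho'
  have hconf : Configuration D 2 κ l o' :=
    { M_pos := two_pos
      κ_nonneg := h.κ_nonneg
      l_nonneg := h.l_nonneg
      o_pos := fun k => by
        simp only [ho']
        split_ifs
        · linarith
        · exact I.frac_pos (D.budget_pos k)
      o_le := fun k => by
        simp only [ho']
        split_ifs
        · linarith
        · exact (I.frac_le_one (D.budget_pos k).le).trans one_le_two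
      le_κ := fun k hk => absurd hk (hl k).ne'
      mul_le := fun k r hr => by
        simp only [ho']
        split_ifs with hk
        · rw [hk]
          have key : ∀ r, 0 ≤ r → r ≤ R → (T + d) * r ≤
              D.budget (Fin.last m) + ∫ z in (0 : ℝ)..r, envelope 2 κ l z := fun r hr hrR => by
            have h1 := hslack r hr
            have h2 := mul_le_mul_of_nonneg_left hrR hd0.le
            linarith
          rcases le_total r R with hrR | hrR
          · exact key r hr hrR
          · rw [← intervalIntegral.integral_add_adjacent_intervals (hi' 0 R) (hi' R r)]
            have h1 := key R hR0.le le_rfl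
            have h2 : ∫ z in R..r, envelope 2 κ l z = 2 * (r - R) := by
              have : ∫ _ in R..r, (2 : ℝ) = 2 * (r - R) := by
                rw [intervalIntegral.integral_const, smul_eq_mul, mul_comm]
              rw [← this]
              refine intervalIntegral.integral_congr fun z hz => ?_
              rw [Set.uIcc_of_le hrR] at hz
              exact envelope_eq_of_large two_pos h.κ_nonneg h.l_nonneg
                (fun k hk => absurd hk (hl k).ne') (by linarith [hz.1])
            have h3 : (T + d) * (r - R) ≤ 2 * (r - R) :=
              mul_le_mul_of_nonneg_right (by linarith) (by linarith)
            rw [h2]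
            linarith
        · have h1 := I.frac_mul_le (D.budget_pos k).le hr
          have h2 := I.integral_G_le one_le_two h.κ_nonneg h.l_nonneg hG le_rfl hr
          linarith }
  have hle := hw.le_configValue hconf
  rw [← h.value_eq] at hle
  have hv := h.configuration.value_pos
  refine absurd hle (not_le.2 ?_)
  refine Finset.sum_lt_sum (fun i _ => ?_) ⟨Fin.last m, Finset.mem_univ _, ?_⟩
  · refine mul_le_mul_of_nonneg_left ?_ (D.prob_pos i).le
    simp only [ho']
    split_ifs with hi
    · rw [hi]
      exact div_le_div_of_nonneg_left (hv _).le hT0 (by linarith)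
    · exact le_rfl
  · refine mul_lt_mul_of_pos_left ?_ (D.prob_pos _)
    simp only [ho', if_pos rfl]
    exact div_lt_div_of_pos_left (hv _) hT0 (by linarith)

end Lines
end BayesianMarket

end

/-! ### Convex piecewise-linear curves and optimal cutoffs -/

section

variable {m : ℕ}

/-! ### Maxima of lines -/

/-- The largest of zero and the lines `s ↦ (s - κ k) / l k`. -/
def lineMax (κ l : Fin (m + 1) → ℝ) (s : ℝ) : ℝ :=
  max 0 (Finset.univ.sup' Finset.univ_nonempty fun k => (s - κ k) / l k)

section lineMax

variable {κ l : Fin (m + 1) → ℝ}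

lemma lineMax_continuous (κ l : Fin (m + 1) → ℝ) : Continuous (lineMax κ l) := by
  unfold lineMax
  exact continuous_const.max
    (Continuous.finset_sup'_apply Finset.univ_nonempty fun k _ => by fun_prop)

lemma lineMax_eq_zero {s : ℝ} (h : ∀ k, (s - κ k) / l k ≤ 0) : lineMax κ l s = 0 :=
  max_eq_left (Finset.sup'_le _ _ fun k _ => h k)

lemma lineMax_eq {s a : ℝ} (k : Fin (m + 1)) (ha : 0 ≤ a) (hk : (s - κ k) / l k = a)
    (h : ∀ i, (s - κ i) / l i ≤ a) : lineMax κ l s = a := by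
  refine le_antisymm (max_le ha (Finset.sup'_le _ _ fun i _ => h i)) (le_max_of_le_right ?_)
  rw [← hk]
  exact Finset.le_sup' (fun i => (s - κ i) / l i) (Finset.mem_univ k)

/-- If the lines touch their maximum one after the other, then this maximum is made up of one piece
of each line. -/
lemma convexPiecewiseLinear_lineMax {h : Fin (m + 1) → ℝ} {T q : ℝ} (hq : 0 < q)
    (hl : ∀ k, 0 < l k) (hanti : Antitone l) (hκ : 0 ≤ κ 0) (hκh : κ 0 ≤ h 0) (hmono : Monotone h)
    (hT : h (Fin.last m) ≤ T) (htouch : ∀ i k, (h k - κ i) / l i ≤ (h k - κ k) / l k) :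
    ConvexPiecewiseLinear (m + 1) T fun s => lineMax κ l s / q := by
  have hdiff : ∀ i j s t, i ≤ j → s ≤ t → (s - κ i) / l i ≤ (s - κ j) / l j →
      (t - κ i) / l i ≤ (t - κ j) / l j := by
    intro i j s t hij hst hs
    have h1 : (t - s) / l i ≤ (t - s) / l j :=
      div_le_div_of_nonneg_left (sub_nonneg.2 hst) (hl j) (hanti hij)
    have h2 : ∀ k, (t - κ k) / l k = (s - κ k) / l k + (t - s) / l k := fun k => by ring
    rw [h2 i, h2 j]
    linarith
  have hdiff' : ∀ i j s t, i ≤ j → s ≤ t → (t - κ j) / l j ≤ (t - κ i) / l i →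
      (s - κ j) / l j ≤ (s - κ i) / l i := by
    intro i j s t hij hst hs
    have h1 : (t - s) / l i ≤ (t - s) / l j :=
      div_le_div_of_nonneg_left (sub_nonneg.2 hst) (hl j) (hanti hij)
    have h2 : ∀ k, (t - κ k) / l k = (s - κ k) / l k + (t - s) / l k := fun k => by ring
    rw [h2 i, h2 j] at hs
    linarith
  -- Each line is on top at its own touching point, so consecutive lines cross in between; the
  -- crossings are the breakpoints.
  have hcross : ∀ j : Fin m, ∃ c, h j.castSucc ≤ c ∧ c ≤ h j.succ ∧
      (c - κ j.castSucc) / l j.castSucc = (c - κ j.succ) / l j.succ := by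
    intro j
    have hle : h j.castSucc ≤ h j.succ := hmono (Fin.castSucc_lt_succ).le
    obtain ⟨c, hc, h0⟩ := intermediate_value_Icc hle
      (f := fun s => (s - κ j.succ) / l j.succ - (s - κ j.castSucc) / l j.castSucc)
      (by fun_prop) (show (0 : ℝ) ∈ _ from
        ⟨sub_nonpos.2 (htouch j.succ j.castSucc), sub_nonneg.2 (htouch j.castSucc j.succ)⟩)
    exact ⟨c, hc.1, hc.2, (sub_eq_zero.1 h0).symm⟩
  choose c hc1 hc2 hc3 using hcross
  -- The first breakpoint `κ 0` is the zero of the first line.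
  set x₁ : Fin (m + 1) → ℝ := Fin.cons (κ 0) c with hx₁
  set x : Fin (m + 1 + 1) → ℝ := Fin.snoc x₁ T with hx
  have hxc : ∀ j : Fin (m + 1), x j.castSucc = x₁ j := fun j => by simp [hx]
  have hlow : ∀ j, x₁ j ≤ h j := fun j => by
    refine Fin.cases ?_ (fun i => ?_) j
    · simpa [hx₁] using hκh
    · simpa [hx₁] using hc2 i
  have hupp : ∀ j : Fin (m + 1), h j ≤ x j.succ := fun j => by
    refine Fin.lastCases ?_ (fun i => ?_) j
    · rw [Fin.succ_last]
      simpa [hx] using hT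
    · rw [Fin.succ_castSucc, hxc]
      simpa [hx₁] using hc1 i
  have hbelow : ∀ i j : Fin (m + 1), i < j → (x₁ j - κ i) / l i ≤ (x₁ j - κ j) / l j := by
    intro i j
    refine Fin.cases (fun hij => absurd hij (Fin.not_lt_zero i)) (fun k hij => ?_) j
    have hik : i ≤ k.castSucc := Fin.le_castSucc_iff.2 hij
    simp only [hx₁, Fin.cons_succ]
    rw [← hc3 k]
    exact hdiff i _ _ _ hik (hc1 k) (htouch i _)
  have habove : ∀ i j : Fin (m + 1), j < i →
      (x j.succ - κ i) / l i ≤ (x j.succ - κ j) / l j := by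
    intro i j
    refine Fin.lastCases (fun hij => absurd hij (not_lt.2 (Fin.le_last i))) (fun k hij => ?_) j
    have hik : k.succ ≤ i := Fin.castSucc_lt_iff_succ_le.1 hij
    rw [Fin.succ_castSucc, hxc, show x₁ k.succ = c k by simp [hx₁], hc3 k]
    exact hdiff' _ i _ _ hik (hc2 k) (htouch i _)
  have hκ0 : ∀ s, κ 0 ≤ s → 0 ≤ (s - κ 0) / l 0 := fun s hs =>
    div_nonneg (sub_nonneg.2 hs) (hl 0).le
  have hx₁mono : ∀ j, κ 0 ≤ x₁ j := fun j => by
    refine Fin.cases ?_ (fun i => ?_) j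
    · simp [hx₁]
    · have := hmono (Fin.zero_le i.castSucc)
      have := hc1 i
      simp only [hx₁, Fin.cons_succ]
      linarith
  have hpiece : ∀ j : Fin (m + 1), ∀ s ∈ Set.Icc (x j.castSucc) (x j.succ),
      lineMax κ l s = (s - κ j) / l j := by
    rintro j s ⟨hs1, hs2⟩
    rw [hxc] at hs1
    have hle : ∀ i, (s - κ i) / l i ≤ (s - κ j) / l j := fun i => by
      rcases lt_trichotomy i j with hij | rfl | hij
      · exact hdiff i j _ _ hij.le hs1 (hbelow i j hij)
      · exact le_rfl
      · exact hdiff' j i _ _ hij.le hs2 (habove i j hij)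
    exact lineMax_eq j ((hκ0 s ((hx₁mono j).trans hs1)).trans (hle 0)) rfl hle
  refine ⟨x, fun j => 1 / l j / q, ?_, ?_, ?_, fun j => by have := hl j; positivity, ?_, ?_, ?_⟩
  · exact Fin.monotone_iff_le_succ.2 fun j => by
      rw [hxc]; exact (hlow j).trans (hupp j)
  · rw [← Fin.castSucc_zero, hxc]; simpa [hx₁] using hκ
  · simp [hx]
  · intro i j hij
    exact div_le_div_of_nonneg_right (one_div_le_one_div_of_le (hl j) (hanti hij)) hq.le
  · rintro s ⟨-, hs⟩
    rw [← Fin.castSucc_zero, hxc] at hs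
    have hs' : s ≤ κ 0 := by simpa [hx₁] using hs
    suffices h0 : lineMax κ l s = 0 by simp only [h0, zero_div]
    refine lineMax_eq_zero fun i => ?_
    refine (hdiff' 0 i s (h 0) (Fin.zero_le i) (hs'.trans hκh) (htouch i 0)).trans ?_
    exact div_nonpos_of_nonpos_of_nonneg (sub_nonpos.2 hs') (hl 0).le
  · intro j s hs
    simp only [hpiece j s hs, hpiece j _ ⟨le_rfl, hs.1.trans hs.2⟩]
    ring

end lineMax

namespace BayesianMarket

variable {I : BayesianMarket} {D : BudgetDistribution (m + 1)} {κ l : Fin (m + 1) → ℝ}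

namespace Lines

/-- The supporting line, read as expenditure in terms of utility; the other lines are below it at
this point by `touch_le`. -/
lemma touch (h : I.Lines D κ l) (hl : ∀ k, 0 < l k) (k : Fin (m + 1)) :
    (I.icOpt (D.budget k) - κ k) / l k = D.budget k := by
  rw [div_eq_iff (hl k).ne', ← h.eq_icOpt k]; ring

lemma touch_le (h : I.Lines D κ l) (hl : ∀ k, 0 < l k) (i k : Fin (m + 1)) :
    (I.icOpt (D.budget k) - κ i) / l i ≤ D.budget k := by
  rw [div_le_iff₀ (hl i)]
  linarith [h.icOpt_le i _ (D.budget_pos k).le]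

lemma l_antitone (h : I.Lines D κ l) : Antitone l := by
  intro i j hij
  rcases hij.eq_or_lt with rfl | hij
  · exact le_rfl
  · have hB := D.budget_strictMono hij
    have h1 := h.icOpt_le i _ (D.budget_pos j).le
    have h2 := h.icOpt_le j _ (D.budget_pos i).le
    rw [← h.eq_icOpt j] at h1
    rw [← h.eq_icOpt i] at h2
    by_contra hc
    push Not at hc
    nlinarith

lemma icOpt_le_frac_last (k : Fin (m + 1)) :
    I.icOpt (D.budget k) ≤ I.frac (D.budget (Fin.last m)) :=
  (I.icOpt_le_frac (D.budget_pos k)).trans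
    (I.frac_mono (D.budget_pos k) (D.budget_strictMono.monotone (Fin.le_last k)))

/-- The curve of a worst market is the maximum of its lines. -/
lemma mul_G_eq (h : I.Lines D κ l) (hw : I.IsWorst D) {y : ℝ} (hy : 0 ≤ y)
    (hlt : ∀ y', 0 ≤ y' → y' < y → I.G y' < I.frac (D.budget (Fin.last m))) :
    y * I.G y = lineMax κ l (I.G y) := by
  have hl := h.l_pos hw
  have hle : ∀ y, 0 ≤ y → ∀ k, (I.G y - κ k) / l k ≤ y * I.G y := fun y hy k => by
    rw [div_le_iff₀ (hl k)]
    linarith [h.G_mul_le k hy]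
  -- On the envelope some hyperbola binds, and solving it for `y * G y` gives its line. The cap `2`
  -- cannot be active, as `G ≤ 1`.
  have key : ∀ y, 0 ≤ y → I.G y < I.frac (D.budget (Fin.last m)) →
      y * I.G y = lineMax κ l (I.G y) := by
    intro y hy hT
    have hG := h.G_eq_envelope hw hy hT
    obtain ⟨k, hk⟩ := exists_envelope_eq 2 κ l y
    rw [← hG] at hk
    refine (lineMax_eq k (mul_nonneg hy (I.G_nonneg y)) ?_ (hle y hy)).symm
    rw [div_eq_iff (hl k).ne']
    have hG1 := I.G_le_one y
    unfold piece at hk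
    split_ifs at hk with h2
    · linarith
    · have := piece_pos_denom two_pos (h.κ_nonneg k) h2
      rw [eq_div_iff this.ne'] at hk
      linarith
  rcases hy.eq_or_lt with rfl | hy0
  · rw [lineMax_eq_zero, zero_mul]
    intro k
    simpa using hle 0 le_rfl k
  -- At the quantile itself `G` may have reached the level, so the identity is obtained as a limit
  -- from the left.
  · have hcont : Filter.Tendsto I.G (nhdsWithin y (Set.Iio y)) (nhds (I.G y)) :=
      (I.G_continuousOn.continuousAt (Ici_mem_nhds hy0)).tendsto.mono_left nhdsWithin_le_nhds
    have hid : Filter.Tendsto (fun z : ℝ => z) (nhdsWithin y (Set.Iio y)) (nhds y) :=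
      Filter.tendsto_id.mono_left nhdsWithin_le_nhds
    refine tendsto_nhds_unique_of_eventuallyEq (hid.mul hcont)
      (((lineMax_continuous κ l).tendsto _).comp hcont) ?_
    filter_upwards [Ioo_mem_nhdsLT hy0] with z hz
    exact key z hz.1.le (hlt z hz.1.le hz.2)

end Lines

theorem IsWorst.curveUpTo (hw : I.IsWorst D) :
    I.CurveUpTo (m + 1) (I.frac (D.budget (Fin.last m))) := by
  obtain ⟨κ, l, h⟩ := I.exists_lines D
  have hl := h.l_pos hw
  refine ⟨fun s => lineMax κ l s / I.n, convexPiecewiseLinear_lineMax I.n_cast_pos hl h.l_antitone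
    (h.κ_nonneg 0) (h := fun k => I.icOpt (D.budget k)) ?_ ?_ (Lines.icOpt_le_frac_last _) ?_, ?_⟩
  · have := mul_pos (hl 0) (D.budget_pos 0)
    have := h.eq_icOpt 0
    linarith
  · exact fun i j hij => I.icOpt_monotoneOn (D.budget_pos i).le (D.budget_pos j).le
      (D.budget_strictMono.monotone hij)
  · exact fun i k => (h.touch_le hl i k).trans (h.touch hl k).ge
  · intro c hc hlt
    have hn := I.n_cast_pos
    have h1 := h.mul_G_eq hw (mul_nonneg hn.le hc) fun y' hy' hlt' => by
      have := hlt (y' / I.n) (by rwa [div_lt_iff₀' hn])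
      rwa [← I.G_mul, mul_div_cancel₀ _ hn.ne'] at this
    rw [I.G_mul] at h1
    dsimp only
    rw [eq_div_iff hn.ne', ← h1]
    ring

/-- In a worst market, some uniform cutoff rule is optimal for each of the budgets. -/
theorem IsWorst.exists_cutoffOptimal (hw : I.IsWorst D) (k : Fin (m + 1)) :
    ∃ r, 0 ≤ r ∧ I.CutoffOptimal (D.budget k) r := by
  obtain ⟨κ, l, h⟩ := I.exists_lines D
  have hl := h.l_pos hw
  have hn := I.n_cast_pos
  have hu := I.u_pos
  set H := I.icOpt (D.budget k) with hH
  have hHT : H ≤ I.frac (D.budget (Fin.last m)) := Lines.icOpt_le_frac_last k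
  set R := ∑ k, 1 / l k with hR
  have hR0 : 0 ≤ R := Finset.sum_nonneg fun k _ => one_div_nonneg.2 (h.l_nonneg k)
  -- If `G R` were below the level, it would equal the envelope at `R`, which is `2`.
  have hGR : H ≤ I.G R := by
    refine hHT.trans (le_of_not_gt fun hlt => ?_)
    have h1 := h.G_eq_envelope hw hR0 hlt
    rw [envelope_eq_of_large two_pos h.κ_nonneg h.l_nonneg
      (fun k hk => absurd hk (hl k).ne') le_rfl] at h1
    linarith [I.G_le_one R]
  have hcont : ContinuousOn I.G (Set.Icc 0 R) :=
    I.G_continuousOn.mono Set.Icc_subset_Ici_self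
  have hcomp : IsCompact (Set.Icc 0 R ∩ I.G ⁻¹' Set.Ici H) :=
    isCompact_Icc.of_isClosed_subset (hcont.preimage_isClosed_of_isClosed isClosed_Icc isClosed_Ici)
      Set.inter_subset_left
  -- Before the least price that buys the optimal fraction, `G` is below the level, so `mul_G_eq`
  -- applies at it; there the curve has the value `D.budget k`, so this price spends exactly the
  -- budget.
  obtain ⟨y, ⟨⟨hy0, hyR⟩, hyH⟩, hmin⟩ := hcomp.exists_isLeast ⟨R, ⟨hR0, le_rfl⟩, hGR⟩
  have hGy : I.G y = H := by
    have h0 : I.G 0 ≤ H := (I.G_le_icOpt (y := 0) (B := 0) (by simp)).trans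
      (I.icOpt_monotoneOn (Set.mem_Ici.2 le_rfl) (D.budget_pos k).le (D.budget_pos k).le)
    obtain ⟨z, ⟨hz0, hzy⟩, hz⟩ := intermediate_value_Icc hy0
      (hcont.mono (Set.Icc_subset_Icc_right hyR)) ⟨h0, hyH⟩
    have : y ≤ z := hmin ⟨⟨hz0, hzy.trans hyR⟩, hz.ge⟩
    rw [le_antisymm this hzy, hz]
  have hpay : y * I.G y = D.budget k := by
    rw [h.mul_G_eq hw hy0 fun y' hy' hlt => lt_of_lt_of_le (lt_of_not_ge fun hge =>
      absurd (hmin ⟨⟨hy', hlt.le.trans hyR⟩, hge⟩) (not_le.2 hlt)) hHT, hGy]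
    exact lineMax_eq k (D.budget_pos k).le (h.touch hl k) fun i => h.touch_le hl i k
  have hr : I.u * (y / I.n / I.u) = y / I.n := by field_simp
  have hF : I.F (I.u * (y / I.n / I.u)) = H := by rw [hr]; exact hGy
  refine ⟨y / I.n / I.u, by positivity, I.cutoff_feasible ?_, fun M hM => ?_⟩
  · rw [hF, hr, ← hpay, hGy, mul_div_cancel₀ _ hn.ne']
  · rw [I.cutoff_utility, hF]
    exact hM.utility_le_icOpt

end BayesianMarket

end

end BudgetSmoothed

end

theorem mainTheorem3 :
    (∀ (m : ℕ) (D : BudgetSmoothed.BudgetDistribution (m + 1)),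
      -- a worst Bayesian market exists, and can be chosen such that the non-IC optimum with the
      -- largest budget buys the whole market, in which case the claim on the curve is for all of it
      (∃ I : BudgetSmoothed.BayesianMarket, I.IsWorst D ∧
        I.opt (D.budget (Fin.last m)) = I.n * I.u ∧ I.CurveUpTo (m + 1) 1) ∧
      (∀ I : BudgetSmoothed.BayesianMarket, I.IsWorst D →
        I.CurveUpTo (m + 1) (I.opt (D.budget (Fin.last m)) / (I.n * I.u)) ∧
        ∀ k, ∃ r, 0 ≤ r ∧ I.CutoffOptimal (D.budget k) r) ∧
      -- Greedy is worst-case optimal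
      (∀ δ : ℝ, 0 < δ → ∀ P : BudgetSmoothed.GeneralMechanism, P.Feasible D δ →
        BudgetSmoothed.smoothedRatio D δ P.utility ≤
          BudgetSmoothed.smoothedRatio D δ BudgetSmoothed.Market.greedyUtility)) ∧
    -- Random-Sampling-Greedy is worst-case optimal up to an arbitrarily small loss, for all budget
    -- distributions simultaneously
    (∀ ε : ℝ, 0 < ε → ∃ s : BudgetSmoothed.SamplingParameters,
      ∀ (ord : (n : ℕ) → Equiv.Perm (Fin n)) (m : ℕ)
        (D : BudgetSmoothed.BudgetDistribution (m + 1)) (δ : ℝ), 0 < δ → δ ≤ s.ε₁ / s.C →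
        ∀ P : BudgetSmoothed.GeneralMechanism, P.Feasible D δ →
          (1 - ε) * BudgetSmoothed.smoothedRatio D δ P.utility ≤
            BudgetSmoothed.smoothedRatio D δ
              (BudgetSmoothed.Market.samplingUtility s ord)) := by
  refine ⟨fun m D => ⟨?_, fun I hI => ⟨hI.curveUpTo, hI.exists_cutoffOptimal⟩, fun δ hδ P hP =>
    BudgetSmoothed.smoothedRatio_le_smoothedRatio_greedy hδ hP⟩,
    BudgetSmoothed.exists_smoothedRatio_le_sampling⟩
  obtain ⟨I, hI, hfrac⟩ := BudgetSmoothed.exists_isWorst D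
  refine ⟨I, hI, ?_, hfrac ▸ hI.curveUpTo⟩
  rw [I.opt_eq, hfrac, mul_one]
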